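/- Let $l\neq p$ be primes, $n\ge 1$, let $E$ be a non-archimedean local field of characteristic $0$ and residue characteristic $p$, and $F/E$ the unramified extension of degree $l$; $k\subset k_l$ are the residue fields of $E\subset F$, and $\sigma=\mathrm{Frob}$ is the arithmetic Frobenius, acting entrywise on $GL_n(k_l)$ and on $GL_n(F)$. Let $\overline{\mathbb Z}_l$ be the ring of integers of $\overline{\mathbb Q}_l$, $\mathfrak l$ its maximal ideal and $\overline{\mathbb F}_l=\overline{\mathbb Z}_l/\mathfrak l$. A representation of $GL_n$ of a finite field is cuspidal if for $1\le m\le n-1$ it has no nonzero homomorphism to a representation induced from the maximal parabolic $P_m$, trivially on its unipotent radical. Fix a uniformizer $\varpi$ of $E$. For $K\in\{E,F\}$ with residue field $k_K$ and a representation $\rho$ of $GL_n(k_K)$, extend the inflation of $\rho$ to $GL_n(\mathcal O_K)$ to a representation of $K^*GL_n(\mathcal O_K)=\varpi^{\mathbb Z}\times GL_n(\mathcal O_K)$ by letting $\varpi$ act trivially (if $\rho$ has a central character $\omega_\rho$, this means that $K^*\cong \varpi^{\mathbb Z}\times\mathcal O_K^*$ acts by $\omega_\rho$ extended trivially to $\varpi$).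 The lift $\pmb\rho$ is the compact induction of this representation to $GL_n(K)$. A lattice of an $l$-adic representation is an invariant free $\overline{\mathbb Z}_l$-submodule generating it over $\overline{\mathbb Q}_l$. The reduction $r_l$ is the semisimplification of $L/\mathfrak l L$ for a lattice $L$ (semisimplification: direct sum of the factors of a composition series). The Frobenius twist $\alpha^{(l)}$ of an $\overline{\mathbb F}_l$-representation has the same operators, and scalars $c$ act as $c^{1/l}$. For an operator $T$ with $T^l=1$ put $T^0=\ker(1-T)/\mathrm{Im}(1+T+\dots+T^{l-1})$. 1. Let $\pi$ be an irreducible cuspidal $\overline{\mathbb Q}_l$-representation of $GL_n(k)$. Then $\pi$ has a reduction, and if $r_l(\pi)$ is its reduction by any lattice, then the lift of $r_l(\pi)$ is a reduction of $\pmb\pi$ by some lattice, and every reduction of $\pmb\pi$ is isomorphic to it: $r_l(\pmb\pi)\cong\pmb{r_l(\pi)}$. 2. For every $\overline{\mathbb F}_l$-representation $\alpha$ of $GL_n(k)$ (in particular every irreducible cuspidal one), the lift of $\alpha^{(l)}$ is isomorphic to the Frobenius twist of the lift of $\alpha$. 3. Let $\rho$ be an irreducible cuspidal $\overline{\mathbb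 Q}_l$-representation of $GL_n(k_l)$ with $\rho\cong\rho\circ\mathrm{Frob}$. (a) There is an operator $T$ on $\rho$ with $T\rho(g)=\rho(\mathrm{Frob}(g))T$ and $T^l=1$. For every such $T$ the formula $(T'f)(\sigma(g))=T(f(g))$ defines an operator $T'$ on $\pmb\rho$ with $T'\pmb\rho(g)=\pmb\rho(\sigma(g))T'$ and $T'^l=1$. Let $T^0(\rho)$ denote the semisimplification of the $\overline{\mathbb F}_l$-representation $\overline{\mathbb F}_l\otimes T^0(L)$ of $GL_n(k)$, for a $T$-stable lattice $L$ of $\rho$, and $T^0(\pmb\rho)$ that of the $\overline{\mathbb F}_l$-representation $\overline{\mathbb F}_l\otimes T^0(\Lambda)$ of $GL_n(E)$, for a $T'$-stable lattice $\Lambda$ of $\pmb\rho$. Then such a $T^0(\rho)$ exists; for every choice of $L$, the lift of $T^0(\rho)$ arises as $T^0(\pmb\rho)$ for some $\Lambda$; and for every choice of $\Lambda$ for which $T^0(\pmb\rho)$ exists it is isomorphic to the lift of $T^0(\rho)$. (b) The same holds, without any compatibility between the operators, if $T^0(\rho)$ and $T^0(\pmb\rho)$ are instead defined as the semisimplifications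 of $T^0(L/\mathfrak l L)$ and $T^0(\Lambda/\mathfrak l\Lambda)$, for arbitrary lattices $L$, $\Lambda$ and arbitrary $\overline{\mathbb F}_l$-linear operators $T$, $T'$ on $L/\mathfrak l L$, $\Lambda/\mathfrak l\Lambda$ that satisfy $T^l=1$, $T'^l=1$ and intertwine the actions with their conjugates by $\mathrm{Frob}$ and $\sigma$. -/

import Mathlib

open scoped ValuativeRel TensorProduct

universe u v w

noncomputable section

namespace LevelZero

/-! ## Coefficients -/

/-- The ring `ℤ̄_ℓ` of integers of the algebraic closure of `ℚ_ℓ`. -/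
abbrev ZlBar (l : ℕ) [Fact l.Prime] : Subring (PadicAlgCl l) :=
  (Valued.v : Valuation (PadicAlgCl l) NNReal).integer

/-- The residue field `𝔽̄_ℓ` of `ℤ̄_ℓ`. -/
abbrev FlBar (l : ℕ) [Fact l.Prime] : Type := IsLocalRing.ResidueField (ZlBar l)

/-- `ℤ̄_ℓ` is the integral closure of `ℤ_ℓ` in the algebraic closure of `ℚ_ℓ`. -/
theorem mem_ZlBar_iff_isIntegral (l : ℕ) [Fact l.Prime] (x : PadicAlgCl l) :
    x ∈ ZlBar l ↔ IsIntegral ℤ_[l] x := by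
  have hx : IsIntegral ℚ_[l] x := (PadicAlgCl.isAlgebraic l).isAlgebraic x |>.isIntegral
  have h1 : x ∈ ZlBar l ↔ ‖x‖ ≤ 1 := by
    rw [Valuation.mem_integer_iff, ← NNReal.coe_le_coe, PadicAlgCl.valuation_coe]; simp
  rw [h1, ← PadicAlgCl.spectralNorm_eq, spectralNorm, spectralValue_le_one_iff (minpoly.monic hx)]
  constructor
  · intro h
    have hl : minpoly ℚ_[l] x ∈ Polynomial.lifts (algebraMap ℤ_[l] ℚ_[l]) := by
      rw [Polynomial.lifts_iff_coeff_lifts]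
      intro n
      exact ⟨⟨_, h n⟩, rfl⟩
    obtain ⟨q, hq, -, hqm⟩ :=
      Polynomial.lifts_and_natDegree_eq_and_monic hl (minpoly.monic hx)
    refine ⟨q, hqm, ?_⟩
    have h2 := minpoly.aeval ℚ_[l] x
    rw [← hq, Polynomial.aeval_map_algebraMap] at h2
    exact h2
  · intro h n
    rw [minpoly.isIntegrallyClosed_eq_field_fractions' ℚ_[l] h, Polynomial.coeff_map]
    exact PadicInt.norm_le_one _

instance charP_FlBar (l : ℕ) [hl : Fact l.Prime] : CharP (FlBar l) l := by
  refine (CharP.charP_iff_prime_eq_zero hl.out).2 ?_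
  have h : (l : FlBar l) = IsLocalRing.residue (ZlBar l) (l : ZlBar l) := by simp
  rw [h, IsLocalRing.residue_eq_zero_iff, IsLocalRing.mem_maximalIdeal, mem_nonunits_iff]
  intro hu
  have h1 := (Valuation.integer.integers (Valued.v : Valuation (PadicAlgCl l) NNReal)).one_of_isUnit hu
  have h2 : (Valued.v ((l : ℕ) : PadicAlgCl l) : NNReal) = 1 := by simpa using h1
  rw [PadicAlgCl.valuation_p] at h2
  have h3 : (l : NNReal) = 1 := by
    have := hl.out.ne_zero
    field_simp at h2
    exact h2.symm
  exact hl.out.ne_one (by exact_mod_cast h3)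

instance perfectRing_FlBar (l : ℕ) [hl : Fact l.Prime] : PerfectRing (FlBar l) l := by
  refine PerfectRing.ofSurjective (FlBar l) l fun x => ?_
  obtain ⟨y, rfl⟩ := IsLocalRing.residue_surjective x
  obtain ⟨z, hz⟩ := IsAlgClosed.exists_pow_nat_eq (y : PadicAlgCl l) hl.out.pos
  have hzm : z ∈ ZlBar l := by
    rw [Valuation.mem_integer_iff]
    have hy : Valued.v (y : PadicAlgCl l) ≤ (1 : NNReal) := y.2
    rw [← hz, map_pow] at hy
    exact (pow_le_one_iff hl.out.ne_zero).1 hy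
  refine ⟨IsLocalRing.residue _ ⟨z, hzm⟩, ?_⟩
  rw [frobenius_def, ← map_pow]
  congr 1
  exact Subtype.ext hz

/-! ## Generalities on representations -/

section Generalities

variable {G : Type*} [Group G]

/-- `σ` is a semisimplification of `ρ`: there is a (finite) composition series of `ρ` such that
`σ` is isomorphic to the direct sum of its irreducible subquotients. -/
def IsSemisimplification {k : Type*} [Field k] {V W : Type*} [AddCommGroup V] [Module k V]
    [AddCommGroup W] [Module k W] (σ : Representation k G W) (ρ : Representation k G V) : Prop :=
  ∃ (m : ℕ) (s : Fin (m + 1) → Subrepresentation ρ),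
    s 0 = ⊥ ∧ s (Fin.last m) = ⊤ ∧ (∀ i : Fin m, s i.castSucc ⋖ s i.succ) ∧
    Nonempty (σ.Equiv (Representation.directSum fun i : Fin m =>
      (s i.succ).toRepresentation.quotient
        ((s i.castSucc).toSubmodule.comap (s i.succ).toSubmodule.subtype)
        (fun g _ hx => (s i.castSucc).apply_mem_toSubmodule g hx)))

variable (l : ℕ) [Fact l.Prime]

/-- An `ℓ`-adic representation, viewed as a `ℤ̄_ℓ`-linear representation. -/
def integralRestrict {V : Type*} [AddCommGroup V] [Module (PadicAlgCl l) V]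
    (ρ : Representation (PadicAlgCl l) G V) : Representation (ZlBar l) G V where
  toFun g := (ρ g).restrictScalars (ZlBar l)
  map_one' := by ext; simp
  map_mul' g h := by ext; simp

/-- `L` is a `G`-invariant `ℤ̄_ℓ`-lattice of `ρ`: a `G`-stable free `ℤ̄_ℓ`-submodule that
generates `V` over `ℚ̄_ℓ`. -/
def IsLattice {V : Type*} [AddCommGroup V] [Module (PadicAlgCl l) V]
    {ρ : Representation (PadicAlgCl l) G V}
    (L : Subrepresentation (integralRestrict l ρ)) : Prop :=
  Module.Free (ZlBar l) L.toSubmodule ∧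
    Submodule.span (PadicAlgCl l) (L.toSubmodule : Set V) = ⊤

/-- The representation of `G` on `𝔽̄_ℓ ⊗ M = M / 𝔩 M`, for `𝔩` the maximal ideal of `ℤ̄_ℓ`. -/
def modL {M : Type*} [AddCommGroup M] [Module (ZlBar l) M]
    (ρ : Representation (ZlBar l) G M) :
    Representation (FlBar l) G (FlBar l ⊗[ZlBar l] M) where
  toFun g := (ρ g).baseChange (FlBar l)
  map_one' := by rw [map_one]; exact LinearMap.baseChange_id
  map_mul' g h := by rw [map_mul]; exact LinearMap.baseChange_comp _ _

/-- `S` is a reduction mod `ℓ` of `ρ`, i.e. `S ≅ r_ℓ(ρ)`: it is the semisimplification of `L / 𝔩 L`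
for some invariant lattice `L`. -/
def IsReduction {V W : Type*} [AddCommGroup V] [Module (PadicAlgCl l) V]
    [AddCommGroup W] [Module (FlBar l) W]
    (S : Representation (FlBar l) G W) (ρ : Representation (PadicAlgCl l) G V) : Prop :=
  ∃ L : Subrepresentation (integralRestrict l ρ),
    IsLattice l L ∧ IsSemisimplification S (modL l L.toRepresentation)

/-- The additive group `V` with the scalar multiplication `c * v = c ^ (1/ℓ) • v`. -/
def FrobTwist (_l : ℕ) (V : Type*) : Type _ := V

instance (V : Type*) [AddCommGroup V] : AddCommGroup (FrobTwist l V) :=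
  inferInstanceAs (AddCommGroup V)

instance (V : Type*) [AddCommGroup V] [Module (FlBar l) V] : Module (FlBar l) (FrobTwist l V) :=
  Module.compHom V (frobeniusEquiv (FlBar l) l).symm.toRingHom

/-- The Frobenius twist `α^(ℓ)`: the same operators on the twisted space. -/
def frobTwist {V : Type*} [AddCommGroup V] [Module (FlBar l) V]
    (α : Representation (FlBar l) G V) : Representation (FlBar l) G (FrobTwist l V) where
  toFun g :=
    { toFun := fun v => α g v
      map_add' := fun v w => map_add (α g) v w
      map_smul' := fun c v => (α g).map_smul ((frobeniusEquiv (FlBar l) l).symm c) v }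
  map_one' := LinearMap.ext fun v => by
    change α 1 v = v
    rw [map_one]
    rfl
  map_mul' g h := LinearMap.ext fun v => by
    change α (g * h) v = α g (α h v)
    rw [map_mul]
    rfl

end Generalities

/-! ## Tate cohomology -/

section Tate

/-- `T` realizes an isomorphism `ρ ≅ ρ ∘ φ` and has order dividing `ℓ`. -/
def IsTwistOperator {R G V : Type*} [CommRing R] [Group G] [AddCommGroup V] [Module R V]
    (φ : G →* G) (l : ℕ) (ρ : Representation R G V) (T : V →ₗ[R] V) : Prop :=
  (∀ g v, T (ρ g v) = ρ (φ g) (T v)) ∧ T ^ l = 1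

/-- The norm operator `N = 1 + T + ⋯ + T ^ (ℓ - 1)`. -/
def tateNorm {R Γ M : Type*} [CommRing R] [Group Γ] [AddCommGroup M] [Module R M]
    {ρ : Representation R Γ M} (l : ℕ) (T : ρ.IntertwiningMap ρ) : ρ.IntertwiningMap ρ :=
  ∑ i ∈ Finset.range l, T ^ i

/-- The representation of `Γ` on the Tate cohomology `T⁰ = ker (1 - T) / Im N` of an operator `T`
that commutes with `Γ`. -/
def tateH0 {R Γ M : Type*} [CommRing R] [Group Γ] [AddCommGroup M] [Module R M]
    {ρ : Representation R Γ M} (l : ℕ) (T : ρ.IntertwiningMap ρ) :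
    Representation R Γ ((1 - T).ker.toSubmodule ⧸
      (tateNorm l T).range.toSubmodule.comap (1 - T).ker.toSubmodule.subtype) :=
  (1 - T).ker.toRepresentation.quotient _
    (fun g _ hx => (tateNorm l T).range.apply_mem_toSubmodule g hx)

variable {G Γ : Type*} [Group G] [Group Γ] (l : ℕ) [Fact l.Prime]

/-- `S ≅ T⁰(ρ)`, for an `ℓ`-adic representation `ρ` of `G`, an operator `T` on its space, and
`ι : Γ → G` (the inclusion of the fixed points) whose image commutes with `T`: there is an
invariant lattice `L`, stable under `T`, such that the `𝔽̄_ℓ`-representation `S` of `Γ` is the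
semisimplification of `𝔽̄_ℓ ⊗ T⁰(L)`. -/
def IsTateH0 {V W : Type*} [AddCommGroup V] [Module (PadicAlgCl l) V]
    [AddCommGroup W] [Module (FlBar l) W] (ι : Γ →* G)
    (S : Representation (FlBar l) Γ W) (ρ : Representation (PadicAlgCl l) G V)
    (T : V →ₗ[PadicAlgCl l] V) : Prop :=
  ∃ (L : Subrepresentation (integralRestrict l ρ))
    (TL : Representation.IntertwiningMap (L.toRepresentation.comp ι) (L.toRepresentation.comp ι)),
    IsLattice l L ∧ (∀ x, ((TL x : L.toSubmodule) : V) = T x) ∧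
    IsSemisimplification S (modL l (tateH0 l TL))

/-- `S ≅ T⁰(r_ℓ(ρ))`: there are an invariant lattice `L` of `ρ` and an operator `T` on `L / 𝔩 L`
realizing its isomorphism with its `φ`-conjugate such that `S` is the semisimplification of
`T⁰(L / 𝔩 L)`. -/
def IsModularTateH0 {V W : Type*} [AddCommGroup V] [Module (PadicAlgCl l) V]
    [AddCommGroup W] [Module (FlBar l) W] (φ : G →* G) (ι : Γ →* G)
    (S : Representation (FlBar l) Γ W) (ρ : Representation (PadicAlgCl l) G V) : Prop :=
  ∃ (L : Subrepresentation (integralRestrict l ρ))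
    (T : Representation.IntertwiningMap ((modL l L.toRepresentation).comp ι)
      ((modL l L.toRepresentation).comp ι)),
    IsLattice l L ∧ IsTwistOperator φ l (modL l L.toRepresentation) T.toLinearMap ∧
    IsSemisimplification S (tateH0 l T)

end Tate

/-! ## Cuspidal representations of `GL_n` of a field -/

section Cuspidal

variable {k : Type*} [Field k] {n : ℕ}

/-- The maximal upper parabolic subgroup `P_m`: the lower left `(n - m) × m` block is zero. -/
def parabolic (k : Type*) [Field k] (n m : ℕ) : Subgroup (GL (Fin n) k) where
  carrier := {g | ∀ i j : Fin n, m ≤ (i : ℕ) → (j : ℕ) < m → g i j = 0}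
  one_mem' := by
    intro i j hi hj
    have : i ≠ j := fun h => by subst h; omega
    simp [this]
  mul_mem' := by
    intro a b ha hb i j hi hj
    rw [Units.val_mul, Matrix.mul_apply]
    refine Finset.sum_eq_zero fun x _ => ?_
    rcases lt_or_ge (x : ℕ) m with hx | hx
    · rw [ha i x hi hx, zero_mul]
    · rw [hb x j hx hj, mul_zero]
  inv_mem' := by
    intro g hg i j hi hj
    let b : Fin n → Bool := fun i => decide (m ≤ (i : ℕ))
    have hb : Matrix.BlockTriangular (g : Matrix (Fin n) (Fin n) k) b := by
      intro i j hij
      have h : m ≤ (i : ℕ) ∧ (j : ℕ) < m := by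
        have h1 := Bool.lt_iff.1 hij
        simpa [b, and_comm] using h1
      exact hg i j h.1 h.2
    have := Matrix.blockTriangular_inv_of_blockTriangular hb
    rw [Matrix.coe_units_inv]
    exact this (Bool.lt_iff.2 (by simp [b, hi, hj]))

/-- `g` lies in the unipotent radical `U_m` of `P_m`: it coincides with the identity outside of
the upper right `m × (n - m)` block. -/
def IsUnipotentRadicalElem (m : ℕ) (g : GL (Fin n) k) : Prop :=
  ∀ i j : Fin n, ¬ ((i : ℕ) < m ∧ m ≤ (j : ℕ)) → g i j = (1 : Matrix (Fin n) (Fin n) k) i j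

/-- `ρ` is cuspidal: for `1 ≤ m ≤ n - 1` there is no nonzero `GL_n`-homomorphism from `ρ` to a
representation induced from a representation of `P_m` inflated from `P_m / U_m`. -/
def IsCuspidal {R : Type*} [CommRing R] {V : Type u} [AddCommGroup V] [Module R V]
    (ρ : Representation R (GL (Fin n) k) V) : Prop :=
  ∀ m : ℕ, 1 ≤ m → m < n →
    ∀ (W : Type u) [AddCommGroup W] [Module R W] (τ : Representation R (parabolic k n m) W),
      (∀ x : parabolic k n m, IsUnipotentRadicalElem m (x : GL (Fin n) k) → τ x = 1) →
      ∀ Φ : ρ.IntertwiningMap (Representation.coind (parabolic k n m).subtype τ), Φ = 0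

end Cuspidal

/-! ## The lift to a local field -/

section Lift

variable {n : ℕ} {K : Type*} [Field K] [ValuativeRel K] [TopologicalSpace K]
  [IsNonarchimedeanLocalField K]

/-- `ϖ` is a uniformizer of `K`. -/
def IsUniformizer (ϖ : Kˣ) : Prop := ∃ x : 𝒪[K], Irreducible x ∧ (x : K) = ϖ

/-- The inclusion `GL_n(𝒪_K) → GL_n(K)`. -/
def glInt (n : ℕ) (K : Type*) [Field K] [ValuativeRel K] : GL (Fin n) 𝒪[K] →* GL (Fin n) K :=
  Matrix.GeneralLinearGroup.map (𝒪[K]).subtype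

/-- The reduction map `GL_n(𝒪_K) → GL_n(k)`, with `k` the residue field of `K`. -/
def glRed (n : ℕ) (K : Type*) [Field K] [ValuativeRel K] : GL (Fin n) 𝒪[K] →* GL (Fin n) 𝓀[K] :=
  Matrix.GeneralLinearGroup.map (IsLocalRing.residue 𝒪[K])

variable {R : Type*} [CommRing R] {V : Type*} [AddCommGroup V] [Module R V]

/-- The space of the compact induction of `ω ρ` from `K^* GL_n(𝒪_K)` to `GL_n(K)`.
Here `K^* GL_n(𝒪_K) = ϖ^ℤ × GL_n(𝒪_K)`, and `ω ρ` is the representation that is trivial on `ϖ` and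
inflated from `ρ` on `GL_n(𝒪_K)`; by `liftSpace_equivariance_iff` below this is the same as
multiplying the inflation of `ρ` by the character `ω` of `K^* = ϖ^ℤ × 𝒪_K^*` that is trivial on `ϖ`
and inflated from the central character of `ρ` on `𝒪_K^*`.
The elements are the functions `f : GL_n(K) → V` that satisfy `f (h g) = (ω ρ)(h) (f g)` for
`h ∈ K^* GL_n(𝒪_K)`, are invariant under right translation by an open subgroup, and have compact
support modulo `K^* GL_n(𝒪_K)`. -/
def liftSpace (ϖ : Kˣ) (ρ : Representation R (GL (Fin n) 𝓀[K]) V) :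
    Submodule R (GL (Fin n) K → V) where
  carrier := {f |
    (∀ (m : ℤ) (x : GL (Fin n) 𝒪[K]) (g : GL (Fin n) K),
      f (Matrix.GeneralLinearGroup.scalar (Fin n) (ϖ ^ m) * glInt n K x * g) =
        ρ (glRed n K x) (f g)) ∧
    (∃ U : Subgroup (GL (Fin n) K), IsOpen (U : Set (GL (Fin n) K)) ∧
      ∀ u ∈ U, ∀ g, f (g * u) = f g) ∧
    (∃ C : Set (GL (Fin n) K), IsCompact C ∧ ∀ g, f g ≠ 0 →
      ∃ (z : Kˣ) (x : GL (Fin n) 𝒪[K]), ∃ c ∈ C,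
        g = Matrix.GeneralLinearGroup.scalar (Fin n) z * glInt n K x * c)}
  zero_mem' := ⟨by simp, ⟨⊤, by simp, by simp⟩, ⟨∅, isCompact_empty, by simp⟩⟩
  add_mem' := by
    rintro f₁ f₂ ⟨h₁, ⟨U₁, hU₁, hf₁⟩, ⟨C₁, hC₁, hs₁⟩⟩ ⟨h₂, ⟨U₂, hU₂, hf₂⟩, ⟨C₂, hC₂, hs₂⟩⟩
    refine ⟨fun m x g => by simp only [Pi.add_apply, h₁, h₂, map_add], ⟨U₁ ⊓ U₂, hU₁.inter hU₂, fun u hu g => ?_⟩,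
      ⟨C₁ ∪ C₂, hC₁.union hC₂, fun g hg => ?_⟩⟩
    · simp [hf₁ u hu.1, hf₂ u hu.2]
    · by_cases h : f₁ g = 0
      · have h' : f₂ g ≠ 0 := fun h' => hg (by simp [h, h'])
        obtain ⟨z, x, c, hc, rfl⟩ := hs₂ g h'
        exact ⟨z, x, c, Or.inr hc, rfl⟩
      · obtain ⟨z, x, c, hc, rfl⟩ := hs₁ g h
        exact ⟨z, x, c, Or.inl hc, rfl⟩
  smul_mem' := by
    rintro a f ⟨h, ⟨U, hU, hf⟩, ⟨C, hC, hs⟩⟩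
    refine ⟨fun m x g => by simp only [Pi.smul_apply, h, map_smul], ⟨U, hU, fun u hu g => by simp [hf u hu]⟩,
      ⟨C, hC, fun g hg => hs g fun h0 => hg (by simp [h0])⟩⟩

/-- If `ρ` has central character `ω`, then the equivariance in `liftSpace` is equivariance under
the character of `K^* = ϖ^ℤ × 𝒪_K^*` given by `ω` on `𝒪_K^*` and `1` on `ϖ`, times `ρ`. -/
theorem liftSpace_equivariance_iff (ϖ : Kˣ) (ρ : Representation R (GL (Fin n) 𝓀[K]) V)
    (ω : 𝓀[K]ˣ →* Rˣ)
    (hω : ∀ (a : 𝓀[K]ˣ) (v : V),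
      ρ (Matrix.GeneralLinearGroup.scalar (Fin n) a) v = ((ω a : Rˣ) : R) • v)
    (f : GL (Fin n) K → V) :
    (∀ (m : ℤ) (x : GL (Fin n) 𝒪[K]) (g : GL (Fin n) K),
      f (Matrix.GeneralLinearGroup.scalar (Fin n) (ϖ ^ m) * glInt n K x * g) =
        ρ (glRed n K x) (f g)) ↔
    (∀ (m : ℤ) (a : 𝒪[K]ˣ) (x : GL (Fin n) 𝒪[K]) (g : GL (Fin n) K),
      f (Matrix.GeneralLinearGroup.scalar (Fin n)
          (ϖ ^ m * Units.map (𝒪[K]).subtype.toMonoidHom a) * glInt n K x * g) =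
        ((ω (Units.map (IsLocalRing.residue 𝒪[K]).toMonoidHom a) : Rˣ) : R) •
          ρ (glRed n K x) (f g)) := by
  have e1 : ∀ a : 𝒪[K]ˣ, Matrix.GeneralLinearGroup.scalar (Fin n)
      (Units.map (𝒪[K]).subtype.toMonoidHom a) =
      glInt n K (Matrix.GeneralLinearGroup.scalar (Fin n) a) := fun a => by
    ext i j
    by_cases h : i = j <;> simp [glInt, Matrix.GeneralLinearGroup.scalar, h]
  have e2 : ∀ a : 𝒪[K]ˣ, Matrix.GeneralLinearGroup.scalar (Fin n)
      (Units.map (IsLocalRing.residue 𝒪[K]).toMonoidHom a) =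
      glRed n K (Matrix.GeneralLinearGroup.scalar (Fin n) a) := fun a => by
    ext i j
    by_cases h : i = j <;> simp [glRed, Matrix.GeneralLinearGroup.scalar, h]
  constructor
  · intro h m a x g
    rw [map_mul, e1, mul_assoc _ (glInt n K _) (glInt n K _), ← map_mul, h, map_mul, ← e2, map_mul,
      Module.End.mul_apply, hω]
  · intro h m x g
    simpa using h m 1 x g

/-- The lift of `ρ`: the group `GL_n(K)` acts on the compact induction by right translation. -/
def lift (ϖ : Kˣ) (ρ : Representation R (GL (Fin n) 𝓀[K]) V) :
    Representation R (GL (Fin n) K) (liftSpace ϖ ρ) where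
  toFun y := (LinearMap.funLeft R V (· * y)).restrict fun f hf => by
    obtain ⟨h, ⟨U, hU, hf⟩, ⟨C, hC, hs⟩⟩ := hf
    refine ⟨fun m x g => ?_, ⟨U.comap (MulAut.conj y⁻¹).toMonoidHom, ?_, fun u hu g => ?_⟩,
      ⟨(· * y⁻¹) '' C, hC.image (continuous_mul_const y⁻¹), fun g hg => ?_⟩⟩
    · simpa [LinearMap.funLeft_apply, mul_assoc] using h m x (g * y)
    · refine hU.preimage (f := fun u => y⁻¹ * u * y⁻¹⁻¹) ?_
      fun_prop
    · have := hf _ hu (g * y)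
      simpa [LinearMap.funLeft_apply, mul_assoc] using this
    · obtain ⟨z, x, c, hc, hgc⟩ := hs (g * y) hg
      exact ⟨z, x, c * y⁻¹, ⟨c, hc, rfl⟩, by rw [← mul_assoc, ← hgc]; group⟩
  map_one' := by ext; simp [LinearMap.funLeft_apply]
  map_mul' y z := by ext; simp [LinearMap.funLeft_apply, mul_assoc]

end Lift

/-! ## Unramified extensions -/

section Extension

variable (E F : Type*) [Field E] [ValuativeRel E] [TopologicalSpace E]
  [IsNonarchimedeanLocalField E] [Field F] [ValuativeRel F] [TopologicalSpace F]
  [IsNonarchimedeanLocalField F] [Algebra E F] [ValuativeExtension E F]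

instance hasExtension :
    (ValuativeRel.valuation E).HasExtension (ValuativeRel.valuation F) where
  val_isEquiv_comap := by
    have := ValuativeExtension.compatible_comap E (ValuativeRel.valuation F)
    exact ValuativeRel.isEquiv _ _

/-- `F / E` is unramified of degree `l` (residue fields being finite, their extension is
automatically separable). -/
def IsUnramifiedOfDegree (l : ℕ) : Prop :=
  Module.finrank E F = l ∧ Ideal.map (algebraMap 𝒪[E] 𝒪[F]) 𝓂[E] = 𝓂[F]

variable {E F} in
/-- `σ` is the arithmetic Frobenius of `F / E`: it induces `x ↦ x ^ |k_E|` on the residue field. -/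
def IsArithFrobenius (σ : F ≃ₐ[E] F) : Prop :=
  ∀ x : 𝒪[F], ValuativeRel.valuation F (σ x - (x : F) ^ Nat.card 𝓀[E]) < 1

/-- The map `x ↦ x ^ |k_E|` on the residue field of `F`. -/
def residueFrob : 𝓀[F] →+* 𝓀[F] :=
  letI := Fintype.ofFinite 𝓀[E]
  (FiniteField.frobeniusAlgHom 𝓀[E] 𝓀[F]).toRingHom

variable (n : ℕ)

/-- The entrywise action of Frobenius on `GL_n(k_F)`. -/
def glResidueFrob : GL (Fin n) 𝓀[F] →* GL (Fin n) 𝓀[F] :=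
  Matrix.GeneralLinearGroup.map (residueFrob E F)

/-- The inclusion `GL_n(k_E) → GL_n(k_F)`. -/
def glResidueIncl : GL (Fin n) 𝓀[E] →* GL (Fin n) 𝓀[F] :=
  Matrix.GeneralLinearGroup.map (algebraMap 𝓀[E] 𝓀[F])

variable {E F} in
/-- The entrywise action of `σ` on `GL_n(F)`. -/
def glFrob (σ : F ≃ₐ[E] F) : GL (Fin n) F →* GL (Fin n) F :=
  Matrix.GeneralLinearGroup.map (σ : F →+* F)

/-- The inclusion `GL_n(E) → GL_n(F)`. -/
def glIncl : GL (Fin n) E →* GL (Fin n) F :=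
  Matrix.GeneralLinearGroup.map (algebraMap E F)

/-- A uniformizer of `E`, viewed in `F`. -/
def unitIncl (ϖ : Eˣ) : Fˣ := Units.map (algebraMap E F).toMonoidHom ϖ

end Extension

end LevelZero

end

open LevelZero

noncomputable section
namespace LevelZero
set_option linter.unusedSectionVars false

/-! The lift is the compact induction of `ρ ∘ θ` from `H = K^* GL_n(𝒪) = ϖ^ℤ × GL_n(𝒪)`, where `θ`
is reduction to `GL_n` of the residue field. `IndData` captures such inductions over any coefficient
ring by evaluation at `1` and extension by zero; it passes to subobjects, quotients, direct sums and
reductions modulo `𝔩`.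

The decisive fact is `liftIndData_hasAvg`. If `ρ` is cuspidal and `p` is invertible, a vector of the
lift that is fixed by the first congruence subgroup `K₁` is supported on `H`
(`liftSpace_apply_eq_zero`), so averaging over finitely many elements of `K₁` is the projection to
vectors supported on `H`. Hence every subrepresentation of the lift is induced from one of `ρ`
(`HasAvg.induce_evalSub`, `HasAvg.orderIso`). Over `𝔽̄_ℓ` this makes composition series correspond;
over `ℤ̄_ℓ` it makes every lattice of the lift induced from a lattice of `ρ`. The theorem becomes a
statement about finite groups.

Independence of the lattice follows from `IsLattice.modL_isIrreducible`: an irreducible cuspidal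
representation has irreducible reduction, so its lattices are homothetic. The proof is by Whittaker
vectors. Every nonzero cuspidal representation has one, also modulo `𝔩` (`CuspSum.exists_generic`),
whereas in characteristic zero they form at most a line (`exists_eqvSum_eq_smul`, by Gelfand's
trick); a reducible reduction would need two.

For Tate cohomology, `σ` permutes the cosets of `H`. An orbit of length `l` contributes only norms,
and a fixed coset has a representative in `GL_n(E)` by a Hilbert 90 argument (`cyclicDescent`), so
`T⁰` of an induction is the induction of `T⁰` (`IndData.tate`). The same orbit count on unipotent
radicals shows that `T⁰` preserves cuspidality (`CuspSum.tateH0`), so that semisimplifications can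
again be induced. For operators chosen on the reductions themselves, compatibility is automatic: by
Schur's lemma two choices differ by an `l`-th root of unity, which is `1` in characteristic `l`
(`twist_unique`).

The Frobenius twist changes scalars only, and both sides of the second statement are the same space
of functions. -/

theorem rep_apply_apply {R G X : Type*} [CommSemiring R] [Monoid G] [AddCommMonoid X] [Module R X]
    (P : Representation R G X) (g h : G) (x : X) : P g (P h x) = P (g * h) x := by
  rw [map_mul, Module.End.mul_apply]

theorem equiv_apply_rep {R G X Y : Type*} [CommSemiring R] [Monoid G] [AddCommMonoid X] [Module R X]
    [AddCommMonoid Y] [Module R Y] {P : Representation R G X} {Q : Representation R G Y}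
    (e : P.Equiv Q) (g : G) (x : X) : e (P g x) = Q g (e x) :=
  e.toIntertwiningMap.isIntertwining _ _ g x

/-! ## Recognizing compactly induced representations -/

/-- Data exhibiting `P` as the compact induction to `G` of the representation `ρ ∘ θ` of the
subgroup `H`: evaluation at `1`, and extension by zero. -/
structure IndData {R G Γ V X : Type*} [CommRing R] [Group G] [Group Γ] [AddCommGroup V] [Module R V]
    [AddCommGroup X] [Module R X] {H : Subgroup G} (θ : H →* Γ) (ρ : Representation R Γ V)
    (P : Representation R G X) where
  ev : X →ₗ[R] V
  sec : V →ₗ[R] X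
  ev_apply : ∀ (h : H) (x : X), ev (P h x) = ρ (θ h) (ev x)
  sec_apply : ∀ (h : H) (v : V), P h (sec v) = sec (ρ (θ h) v)
  ev_sec : ∀ v, ev (sec v) = v
  ev_apply_sec : ∀ g ∉ H, ∀ v, ev (P g (sec v)) = 0
  mem_closure : ∀ x, x ∈ AddSubgroup.closure {y | ∃ g v, y = P g (sec v)}

namespace IndData

section Basic

variable {R G Γ V X : Type*} [CommRing R] [Group G] [Group Γ] [AddCommGroup V] [Module R V]
  [AddCommGroup X] [Module R X] {H : Subgroup G} {θ : H →* Γ} {ρ : Representation R Γ V}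
  {P : Representation R G X} (D : IndData θ ρ P)

/-- The component of `x` supported on the coset `H * q`. -/
def comp (q : Quotient (QuotientGroup.rightRel H)) : X →ₗ[R] X :=
  P q.out⁻¹ ∘ₗ D.sec ∘ₗ D.ev ∘ₗ P q.out

/-- Two representatives of a coset differ by an element of `H`, which passes through `ev` and `sec`
as the same operator and cancels; so the representative chosen in `comp` is immaterial. -/
theorem comp_mk (g : G) (x : X) :
    D.comp (Quotient.mk _ g) x = P g⁻¹ (D.sec (D.ev (P g x))) := by
  have h : g * (Quotient.mk (QuotientGroup.rightRel H) g).out⁻¹ ∈ H :=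
    QuotientGroup.rightRel_apply.1 (Quotient.mk_out g)
  set c := (Quotient.mk (QuotientGroup.rightRel H) g).out
  have hg : g = (⟨_, h⟩ : H) * c := by simp
  have e1 : P g x = P (⟨_, h⟩ : H) (P c x) := by rw [rep_apply_apply, ← hg]
  have e2 : g⁻¹ * (⟨_, h⟩ : H) = c⁻¹ := by simp
  rw [e1, D.ev_apply, ← D.sec_apply, rep_apply_apply, e2]
  rfl

theorem ev_apply_comp_self (g : G) (x : X) :
    D.ev (P g (D.comp (Quotient.mk _ g) x)) = D.ev (P g x) := by
  rw [comp_mk, rep_apply_apply, mul_inv_cancel, map_one,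
    Module.End.one_apply, D.ev_sec]

open Classical in
theorem comp_apply_sec (q : Quotient (QuotientGroup.rightRel H)) (g : G) (v : V) :
    D.comp q (P g (D.sec v)) = if q = Quotient.mk _ g⁻¹ then P g (D.sec v) else 0 := by
  split_ifs with h
  · rw [h, comp_mk, rep_apply_apply, inv_mul_cancel, map_one, inv_inv,
      Module.End.one_apply, D.ev_sec]
  · induction q using Quotient.inductionOn with | _ c =>
    rw [comp_mk, rep_apply_apply, D.ev_apply_sec, map_zero, map_zero]
    intro hc
    refine h (Quotient.sound (QuotientGroup.rightRel_apply.2 ?_))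
    simpa using H.inv_mem hc

/-- A translate of `sec v` has at most one nonzero component, and such translates generate. This is
finiteness of the support modulo `H`. -/
theorem exists_sum_comp (x : X) : ∃ s : Finset (Quotient (QuotientGroup.rightRel H)),
    (∀ q ∉ s, D.comp q x = 0) ∧ ∑ q ∈ s, D.comp q x = x := by
  classical
  induction D.mem_closure x using AddSubgroup.closure_induction with
  | mem x hx =>
    obtain ⟨g, v, rfl⟩ := hx
    refine ⟨{Quotient.mk _ g⁻¹}, fun q hq => ?_, ?_⟩
    · rw [comp_apply_sec, if_neg (by simpa using hq)]
    · simp [comp_apply_sec]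
  | zero => exact ⟨∅, by simp, by simp⟩
  | add x y _ _ hx hy =>
    obtain ⟨s, hs, hs'⟩ := hx
    obtain ⟨t, ht, ht'⟩ := hy
    refine ⟨s ∪ t, fun q hq => ?_, ?_⟩
    · rw [Finset.mem_union, not_or] at hq
      rw [map_add, hs q hq.1, ht q hq.2, add_zero]
    · simp only [map_add, Finset.sum_add_distrib]
      rw [← Finset.sum_subset Finset.subset_union_left (fun q _ hq => hs q hq),
        ← Finset.sum_subset Finset.subset_union_right (fun q _ hq => ht q hq), hs', ht']
  | neg x _ hx =>
    obtain ⟨s, hs, hs'⟩ := hx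
    exact ⟨s, fun q hq => by rw [map_neg, hs q hq, neg_zero], by simp [hs']⟩

theorem eq_zero_of_ev (x : X) (h : ∀ g, D.ev (P g x) = 0) : x = 0 := by
  obtain ⟨s, -, hs⟩ := D.exists_sum_comp x
  rw [← hs]
  refine Finset.sum_eq_zero fun q _ => ?_
  induction q using Quotient.inductionOn with | _ c => rw [comp_mk, h, map_zero, map_zero]

theorem ext_ev {x y : X} (h : ∀ g, D.ev (P g x) = D.ev (P g y)) : x = y :=
  sub_eq_zero.1 (D.eq_zero_of_ev _ fun g => by rw [map_sub, map_sub, h, sub_self])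

theorem finite_ev (x : X) :
    {q : Quotient (QuotientGroup.rightRel H) | D.ev (P q.out x) ≠ 0}.Finite := by
  obtain ⟨s, hs, -⟩ := D.exists_sum_comp x
  refine s.finite_toSet.subset fun q hq => ?_
  by_contra h
  refine hq ?_
  have := D.ev_apply_comp_self q.out x
  rw [Quotient.out_eq, hs q h, map_zero, map_zero] at this
  exact this.symm

/-- Finitely supported functions on `H \ G` assemble to elements of the induced representation. -/
def ofFinsupp : (Quotient (QuotientGroup.rightRel H) →₀ V) →ₗ[R] X :=
  Finsupp.lsum R fun q => P q.out⁻¹ ∘ₗ D.sec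

theorem ev_ofFinsupp (f : Quotient (QuotientGroup.rightRel H) →₀ V)
    (q : Quotient (QuotientGroup.rightRel H)) : D.ev (P q.out (D.ofFinsupp f)) = f q := by
  classical
  induction f using Finsupp.induction_linear with
  | zero => simp
  | add f g hf hg => simp [hf, hg]
  | single r v =>
    simp only [ofFinsupp, Finsupp.lsum_single, LinearMap.comp_apply]
    rw [← Module.End.mul_apply (P q.out), ← map_mul, Finsupp.single_apply]
    split_ifs with h
    · subst h; simp [D.ev_sec]
    · refine D.ev_apply_sec _ (fun hc => h ?_) _
      rw [← Quotient.out_eq r, ← Quotient.out_eq q]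
      exact Quotient.sound (QuotientGroup.rightRel_apply.2 hc)

theorem ev_ext_out {x y : X}
    (h : ∀ q : Quotient (QuotientGroup.rightRel H), D.ev (P q.out x) = D.ev (P q.out y)) :
    x = y := by
  obtain ⟨s, -, hs⟩ := D.exists_sum_comp (x - y)
  refine sub_eq_zero.1 ?_
  rw [← hs]
  refine Finset.sum_eq_zero fun q _ => ?_
  simp [comp, h q]

/-- The underlying module is a direct sum of copies of `V` indexed by `H \ G`. -/
def finsuppEquiv : (Quotient (QuotientGroup.rightRel H) →₀ V) ≃ₗ[R] X :=
  LinearEquiv.ofBijective D.ofFinsupp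
    ⟨fun f g h => by ext q; rw [← D.ev_ofFinsupp f, h, D.ev_ofFinsupp],
     fun x => ⟨Finsupp.ofSupportFinite _ (D.finite_ev x), D.ev_ext_out fun q => by
      rw [D.ev_ofFinsupp]; rfl⟩⟩

theorem ev_finsuppEquiv (f : Quotient (QuotientGroup.rightRel H) →₀ V)
    (q : Quotient (QuotientGroup.rightRel H)) : D.ev (P q.out (D.finsuppEquiv f)) = f q :=
  D.ev_ofFinsupp f q

include D in
theorem free [Module.Free R V] : Module.Free R X := Module.Free.of_equiv D.finsuppEquiv

/-- The compact induction is unique up to isomorphism. -/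
def equiv {V' X' : Type*} [AddCommGroup V'] [Module R V'] [AddCommGroup X'] [Module R X']
    {ρ' : Representation R Γ V'} {P' : Representation R G X'} (D' : IndData θ ρ' P')
    (e : ρ.Equiv ρ') : P.Equiv P' := by
  let E : X ≃ₗ[R] X' := D.finsuppEquiv.symm ≪≫ₗ
    Finsupp.mapRange.linearEquiv e.toLinearEquiv ≪≫ₗ D'.finsuppEquiv
  have hout : ∀ x (q : Quotient (QuotientGroup.rightRel H)),
      D'.ev (P' q.out (E x)) = e (D.ev (P q.out x)) := by
    intro x q
    obtain ⟨f, rfl⟩ := D.finsuppEquiv.surjective x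
    simp only [E, LinearEquiv.trans_apply, LinearEquiv.symm_apply_apply, ev_finsuppEquiv]
    rfl
  have hE : ∀ x g, D'.ev (P' g (E x)) = e (D.ev (P g x)) := by
    intro x g
    obtain ⟨h, q, rfl⟩ : ∃ (h : H) (q : Quotient (QuotientGroup.rightRel H)), g = h * q.out :=
      ⟨⟨_, QuotientGroup.rightRel_apply.1 (Quotient.mk_out (s := QuotientGroup.rightRel H) g)⟩,
        Quotient.mk _ g, by simp⟩
    rw [map_mul, map_mul, Module.End.mul_apply, Module.End.mul_apply, D'.ev_apply, D.ev_apply,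
      hout]
    exact (equiv_apply_rep e _ _).symm
  refine Representation.Equiv.mk E fun g => LinearMap.ext fun x => D'.ext_ev fun c => ?_
  simp only [LinearMap.comp_apply, LinearEquiv.coe_coe]
  rw [hE, rep_apply_apply, ← hE, map_mul, Module.End.mul_apply]

/-- Transport along isomorphisms. -/
def congr {V' X' : Type*} [AddCommGroup V'] [Module R V'] [AddCommGroup X'] [Module R X']
    {ρ' : Representation R Γ V'} {P' : Representation R G X'} (D : IndData θ ρ P)
    (e : ρ.Equiv ρ') (E : P.Equiv P') : IndData θ ρ' P' where
  ev := e.toLinearMap ∘ₗ D.ev ∘ₗ E.symm.toLinearMap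
  sec := E.toLinearMap ∘ₗ D.sec ∘ₗ e.symm.toLinearMap
  ev_apply h x := by
    change e (D.ev (E.symm (P' h x))) = ρ' (θ h) (e (D.ev (E.symm x)))
    rw [show E.symm (P' h x) = P h (E.symm x) from equiv_apply_rep _ _ _,
      D.ev_apply]
    exact equiv_apply_rep _ _ _
  sec_apply h v := by
    change P' h (E (D.sec (e.symm v))) = E (D.sec (e.symm (ρ' (θ h) v)))
    rw [show e.symm (ρ' (θ h) v) = ρ (θ h) (e.symm v) from
      equiv_apply_rep _ _ _, ← D.sec_apply]
    exact (equiv_apply_rep _ _ _).symm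
  ev_sec v := by
    change e (D.ev (E.symm (E (D.sec (e.symm v))))) = v
    simp [D.ev_sec]
  ev_apply_sec g hg v := by
    change e (D.ev (E.symm (P' g (E (D.sec (e.symm v)))))) = 0
    rw [← show E (P g (D.sec (e.symm v))) = P' g (E (D.sec (e.symm v))) from
      equiv_apply_rep _ _ _]
    simp [D.ev_apply_sec g hg]
  mem_closure x := by
    have h := AddSubgroup.mem_map_of_mem E.toLinearMap.toAddMonoidHom (D.mem_closure (E.symm x))
    rw [AddMonoidHom.map_closure] at h
    have hx : E.toLinearMap.toAddMonoidHom (E.symm x) = x := E.apply_symm_apply x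
    rw [hx] at h
    refine AddSubgroup.closure_mono ?_ h
    rintro _ ⟨_, ⟨g, v, rfl⟩, rfl⟩
    refine ⟨g, e v, ?_⟩
    change E (P g (D.sec v)) = P' g (E (D.sec (e.symm (e v))))
    rw [e.symm_apply_apply]
    exact equiv_apply_rep _ _ _

end Basic

end IndData
namespace IndData

/-! ### Induced subobjects and quotients, and averaging. -/

section Constructions

variable {R G Γ V X : Type*} [CommRing R] [Group G] [Group Γ] [AddCommGroup V] [Module R V]
  [AddCommGroup X] [Module R X] {H : Subgroup G} {θ : H →* Γ} {ρ : Representation R Γ V}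
  {P : Representation R G X} (D : IndData θ ρ P)

/-- The subrepresentation of elements all of whose values lie in `Y`. -/
def induce (Y : Subrepresentation ρ) : Subrepresentation P where
  toSubmodule :=
    { carrier := {x | ∀ g, D.ev (P g x) ∈ Y.toSubmodule}
      zero_mem' := fun g => by simp
      add_mem' := fun {x y} hx hy g => by
        rw [map_add, map_add]; exact Y.toSubmodule.add_mem (hx g) (hy g)
      smul_mem' := fun c x hx g => by
        rw [map_smul, map_smul]; exact Y.toSubmodule.smul_mem c (hx g) }
  apply_mem_toSubmodule g x hx c := by
    rw [rep_apply_apply]; exact hx _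

theorem ev_mem {Y : Subrepresentation ρ} {x : X} (hx : x ∈ (D.induce Y).toSubmodule) :
    D.ev x ∈ Y.toSubmodule := by simpa using hx 1

theorem sec_mem {Y : Subrepresentation ρ} {v : V} (hv : v ∈ Y.toSubmodule) :
    D.sec v ∈ (D.induce Y).toSubmodule := by
  intro g
  by_cases hg : g ∈ H
  · rw [show g = (⟨g, hg⟩ : H) from rfl, D.ev_apply, D.ev_sec]
    exact Y.apply_mem_toSubmodule _ hv
  · rw [D.ev_apply_sec g hg]; exact Y.toSubmodule.zero_mem

/-- Compact induction of a subrepresentation. -/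
def restrictSub (Y : Subrepresentation ρ) :
    IndData θ Y.toRepresentation (D.induce Y).toRepresentation where
  ev := D.ev.restrict fun _ hx => D.ev_mem hx
  sec := D.sec.restrict fun _ hv => D.sec_mem hv
  ev_apply h x := Subtype.ext (D.ev_apply h x)
  sec_apply h v := Subtype.ext (D.sec_apply h v)
  ev_sec v := Subtype.ext (D.ev_sec v)
  ev_apply_sec g hg v := Subtype.ext (D.ev_apply_sec g hg v)
  mem_closure x := by
    obtain ⟨s, -, hs⟩ := D.exists_sum_comp x
    have hm : ∀ q, D.comp q x ∈ (D.induce Y).toSubmodule := fun q =>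
      (D.induce Y).apply_mem_toSubmodule _ (D.sec_mem (x.2 _))
    have hx : x = ∑ q ∈ s, (⟨D.comp q x, hm q⟩ : (D.induce Y).toSubmodule) :=
      Subtype.ext (by simp [hs])
    rw [hx]
    exact sum_mem fun q _ => AddSubgroup.subset_closure
      ⟨q.out⁻¹, ⟨D.ev (P q.out x), x.2 _⟩, rfl⟩

/-- Compact induction of a quotient representation. -/
def quot {Y : Submodule R V} (hY : ∀ g, Y ≤ Y.comap (ρ g)) {Z : Submodule R X}
    (hZ : ∀ g, Z ≤ Z.comap (P g)) (hev : Z ≤ Y.comap D.ev) (hsec : Y ≤ Z.comap D.sec) :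
    IndData θ (ρ.quotient Y hY) (P.quotient Z hZ) where
  ev := Submodule.mapQ _ _ D.ev hev
  sec := Submodule.mapQ _ _ D.sec hsec
  ev_apply h x := by
    obtain ⟨x, rfl⟩ := Submodule.mkQ_surjective _ x
    exact congrArg Y.mkQ (D.ev_apply h x)
  sec_apply h x := by
    obtain ⟨x, rfl⟩ := Submodule.mkQ_surjective _ x
    exact congrArg Z.mkQ (D.sec_apply h x)
  ev_sec x := by
    obtain ⟨x, rfl⟩ := Submodule.mkQ_surjective _ x
    exact congrArg Y.mkQ (D.ev_sec x)
  ev_apply_sec g hg x := by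
    obtain ⟨x, rfl⟩ := Submodule.mkQ_surjective _ x
    exact congrArg Y.mkQ (D.ev_apply_sec g hg x)
  mem_closure x := by
    obtain ⟨x, rfl⟩ := Submodule.mkQ_surjective _ x
    have h := AddSubgroup.mem_map_of_mem Z.mkQ.toAddMonoidHom (D.mem_closure x)
    rw [AddMonoidHom.map_closure] at h
    refine AddSubgroup.closure_mono ?_ h
    rintro _ ⟨_, ⟨g, v, rfl⟩, rfl⟩
    exact ⟨g, Y.mkQ v, rfl⟩

/-- Compact induction of a direct sum. -/
def directSum {ι : Type*} {V X : ι → Type*} [∀ i, AddCommGroup (V i)] [∀ i, Module R (V i)]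
    [∀ i, AddCommGroup (X i)] [∀ i, Module R (X i)] {ρ : ∀ i, Representation R Γ (V i)}
    {P : ∀ i, Representation R G (X i)} (D : ∀ i, IndData θ (ρ i) (P i)) :
    IndData θ (Representation.directSum ρ) (Representation.directSum P) where
  ev := DirectSum.lmap fun i => (D i).ev
  sec := DirectSum.lmap fun i => (D i).sec
  ev_apply h x := by
    exact DFinsupp.ext fun i => (D i).ev_apply h (x i)
  sec_apply h x := by
    exact DFinsupp.ext fun i => (D i).sec_apply h (x i)
  ev_sec x := by
    exact DFinsupp.ext fun i => (D i).ev_sec (x i)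
  ev_apply_sec g hg x := by
    exact DFinsupp.ext fun i => (D i).ev_apply_sec g hg (x i)
  mem_closure x := by
    classical
    induction x using DirectSum.induction_on with
    | zero => exact AddSubgroup.zero_mem _
    | of i x =>
      have h := AddSubgroup.mem_map_of_mem (DirectSum.of X i) ((D i).mem_closure x)
      rw [AddMonoidHom.map_closure] at h
      refine AddSubgroup.closure_mono ?_ h
      rintro _ ⟨_, ⟨g, v, rfl⟩, rfl⟩
      refine ⟨g, DirectSum.lof R ι V i v, ?_⟩
      rw [DirectSum.lmap_lof, Representation.directSum_apply, DirectSum.lmap_lof]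
      rfl
    | add x y hx hy => exact AddSubgroup.add_mem _ hx hy

/-- Elements can be averaged, over finite subsets of the kernel of `θ` of `p`-power cardinality,
to elements supported on `H`. -/
def HasAvg (p : ℕ) : Prop :=
  ∀ x, ∃ (m : ℕ) (t : Finset H), t.card = p ^ m ∧ (∀ h ∈ t, θ h = 1) ∧
    p ^ m • D.sec (D.ev x) = ∑ h ∈ t, P h x

variable {D} {p : ℕ}

theorem HasAvg.restrictSub (h : D.HasAvg p) (Y : Subrepresentation ρ) :
    (D.restrictSub Y).HasAvg p := fun x => by
  obtain ⟨m, t, ht, ht1, hs⟩ := h x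
  refine ⟨m, t, ht, ht1, Subtype.ext ?_⟩
  have e : ((∑ h ∈ t, (D.induce Y).toRepresentation h x : (D.induce Y).toSubmodule) : X) =
      ∑ h ∈ t, P h x := by
    rw [AddSubmonoidClass.coe_finsetSum]; rfl
  rw [e, ← hs]
  rfl

theorem smul_cancel (hp : IsUnit (p : R)) {m : ℕ} {x y : X} (h : p ^ m • x = p ^ m • y) :
    x = y := by
  rw [← Nat.cast_smul_eq_nsmul R, ← Nat.cast_smul_eq_nsmul R, Nat.cast_pow] at h
  exact (hp.pow m).smul_left_cancel.1 h

theorem smul_mem_cancel (hp : IsUnit (p : R)) {m : ℕ} {x : X} {Z : Submodule R X}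
    (h : p ^ m • x ∈ Z) : x ∈ Z := by
  rw [← Nat.cast_smul_eq_nsmul R, Nat.cast_pow] at h
  obtain ⟨u, hu⟩ := hp.pow m
  rw [← hu] at h
  simpa [Units.smul_def, smul_smul] using Z.smul_mem (↑u⁻¹ : R) h

/-- Averages stay inside a subrepresentation, and the power of `p` can be divided out: with `x`, the
subrepresentation contains the part of `x` supported on `H`. -/
theorem HasAvg.sec_ev_mem (h : D.HasAvg p) (hp : IsUnit (p : R)) (Z : Subrepresentation P) {x : X}
    (hx : x ∈ Z.toSubmodule) : D.sec (D.ev x) ∈ Z.toSubmodule := by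
  obtain ⟨m, t, -, -, hs⟩ := h x
  refine smul_mem_cancel hp (m := m) ?_
  rw [hs]
  exact sum_mem fun g _ => Z.apply_mem_toSubmodule g hx

/-- On a vector fixed by the kernel of `θ` the averaging sum is multiplication by `p ^ m`, so such a
vector is supported on `H`. -/
theorem HasAvg.eq_sec_ev (h : D.HasAvg p) (hp : IsUnit (p : R)) {x : X}
    (hx : ∀ k : H, θ k = 1 → P k x = x) : D.sec (D.ev x) = x := by
  obtain ⟨m, t, htc, ht1, hs⟩ := h x
  refine smul_cancel hp (m := m) ?_
  rw [hs, Finset.sum_congr rfl fun k hk => hx k (ht1 k hk), Finset.sum_const, htc]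

variable (D) in
/-- The values at `1` of a subrepresentation. -/
def evalSub (hθ : Function.Surjective θ) (Z : Subrepresentation P) : Subrepresentation ρ where
  toSubmodule := Z.toSubmodule.map D.ev
  apply_mem_toSubmodule g v hv := by
    obtain ⟨x, hx, rfl⟩ := hv
    obtain ⟨h, rfl⟩ := hθ g
    exact ⟨P h x, Z.apply_mem_toSubmodule _ hx, D.ev_apply h x⟩

/-- Each component of `x` is a translate of `sec` of a value of `x`. If the values come from `Z`,
averaging puts these vectors back into `Z`. -/
theorem HasAvg.induce_evalSub (h : D.HasAvg p) (hp : IsUnit (p : R)) (hθ : Function.Surjective θ)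
    (Z : Subrepresentation P) : D.induce (D.evalSub hθ Z) = Z := by
  apply Subrepresentation.toSubmodule_injective
  ext x
  constructor
  · intro hx
    obtain ⟨s, -, hs⟩ := D.exists_sum_comp x
    rw [← hs]
    refine sum_mem fun q _ => Z.apply_mem_toSubmodule _ ?_
    obtain ⟨z, hz, hz'⟩ := hx q.out
    change D.sec (D.ev (P q.out x)) ∈ _
    rw [← hz']
    exact h.sec_ev_mem hp Z hz
  · intro hx g
    exact ⟨P g x, Z.apply_mem_toSubmodule _ hx, rfl⟩

theorem evalSub_induce (hθ : Function.Surjective θ) (Y : Subrepresentation ρ) :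
    D.evalSub hθ (D.induce Y) = Y := by
  apply Subrepresentation.toSubmodule_injective
  ext v
  constructor
  · rintro ⟨x, hx, rfl⟩
    exact D.ev_mem hx
  · intro hv
    exact ⟨D.sec v, D.sec_mem hv, D.ev_sec v⟩

/-- Subrepresentations of `ρ` correspond to those of its compact induction. -/
def HasAvg.orderIso (h : D.HasAvg p) (hp : IsUnit (p : R)) (hθ : Function.Surjective θ) :
    Subrepresentation ρ ≃o Subrepresentation P where
  toFun := D.induce
  invFun := D.evalSub hθ
  left_inv := evalSub_induce hθ
  right_inv := h.induce_evalSub hp hθ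
  map_rel_iff' {Y Y'} := by
    constructor
    · intro hle v hv
      have := hle (show D.sec v ∈ D.induce Y from D.sec_mem hv)
      have := D.ev_mem this
      rwa [D.ev_sec] at this
    · intro hle x hx g
      exact hle (hx g)

end Constructions

end IndData

/-! ### Semisimplification and the Jordan–Hölder theorem. -/

section Semisimplification

variable {k G : Type*} [Field k] [Group G]

/-- The subquotient `B / (A ∩ B)` of a representation. -/
abbrev subquot {V : Type*} [AddCommGroup V] [Module k V] {ρ : Representation k G V}
    (A B : Subrepresentation ρ) :=
  B.toRepresentation.quotient (A.toSubmodule.comap B.toSubmodule.subtype)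
        (fun g _ hx => A.apply_mem_toSubmodule g hx)

/-- The direct sum of isomorphic representations, up to a permutation of the index set. -/
theorem nonempty_directSum_equiv {ι κ : Type*} {V : ι → Type*} {W : κ → Type*}
    [∀ i, AddCommGroup (V i)] [∀ i, Module k (V i)] [∀ i, AddCommGroup (W i)] [∀ i, Module k (W i)]
    {ρ : ∀ i, Representation k G (V i)} {τ : ∀ i, Representation k G (W i)} (f : ι ≃ κ)
    (e : ∀ i, Nonempty ((ρ i).Equiv (τ (f i)))) :
    Nonempty ((Representation.directSum ρ).Equiv (Representation.directSum τ)) := by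
  classical
  replace e := fun i => (e i).some
  let A : (DirectSum ι V) →ₗ[k] (DirectSum κ W) :=
    DirectSum.toModule k ι _ fun i => DirectSum.lof k κ W (f i) ∘ₗ (e i).toLinearMap
  have hA : ∀ i v, A (DirectSum.lof k ι V i v) = DirectSum.lof k κ W (f i) (e i v) := fun i v =>
    DirectSum.toModule_lof ..
  let A' : ∀ j, W j →ₗ[k] DirectSum ι V := fun j =>
    DirectSum.lof k ι V (f.symm j) ∘ₗ (e (f.symm j)).symm.toLinearMap ∘ₗ
      (LinearEquiv.cast (R := k) (M := W) (f.apply_symm_apply j).symm).toLinearMap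
  let B : (DirectSum κ W) →ₗ[k] (DirectSum ι V) := DirectSum.toModule k κ _ A'
  have hB : ∀ i w, B (DirectSum.lof k κ W (f i) w) = DirectSum.lof k ι V i ((e i).symm w) := by
    intro i w
    refine (DirectSum.toModule_lof ..).trans ?_
    have key : ∀ (i' : ι) (h : i' = i) (h' : f i = f i'),
        DirectSum.lof k ι V i' ((e i').symm (LinearEquiv.cast (R := k) (M := W) h' w)) =
          DirectSum.lof k ι V i ((e i).symm w) := by
      rintro i' rfl h'; rfl
    exact key _ (f.symm_apply_apply i) _
  refine ⟨Representation.Equiv.mk (LinearEquiv.ofLinearMap A B ?_ ?_) fun g => ?_⟩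
  · refine DirectSum.linearMap_ext _ fun j => LinearMap.ext fun w => ?_
    obtain ⟨i, rfl⟩ := f.surjective j
    simp only [LinearMap.comp_apply, hB, hA, Representation.Equiv.apply_symm_apply,
      LinearMap.id_apply]
  · refine DirectSum.linearMap_ext _ fun i => LinearMap.ext fun v => ?_
    simp only [LinearMap.comp_apply, hB, hA, Representation.Equiv.symm_apply_apply,
      LinearMap.id_apply]
  · refine DirectSum.linearMap_ext _ fun i => LinearMap.ext fun v => ?_
    simp only [LinearMap.comp_apply, Representation.directSum_apply, DirectSum.lmap_lof,
      LinearEquiv.coe_coe, LinearEquiv.coe_ofLinearMap, hA]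
    rw [equiv_apply_rep]

instance isModularLattice_subrepresentation {V : Type*} [AddCommGroup V] [Module k V]
    (ρ : Representation k G V) : IsModularLattice (Subrepresentation ρ) where
  sup_inf_le_assoc_of_le y _ h :=
    IsModularLattice.sup_inf_le_assoc_of_le (α := Submodule k V) y.toSubmodule h

/-- The second isomorphism theorem for representations. -/
theorem nonempty_subquot_sup_equiv {V : Type*} [AddCommGroup V] [Module k V]
    {ρ : Representation k G V} (x y : Subrepresentation ρ) :
    Nonempty ((subquot x (x ⊔ y)).Equiv (subquot (x ⊓ y) y)) := by
  let φ : (subquot (x ⊓ y) y).IntertwiningMap (subquot x (x ⊔ y)) :=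
    { toLinearMap := Submodule.mapQ _ _ (Submodule.inclusion le_sup_right) fun v hv => hv.1
      isIntertwining' := fun g => by
        apply Submodule.linearMap_qext
        ext v
        rfl }
  refine ⟨(φ.ofBijective ⟨?_, ?_⟩).symm⟩
  · refine (injective_iff_map_eq_zero φ.toLinearMap).2 fun v hv => ?_
    obtain ⟨v, rfl⟩ := Submodule.mkQ_surjective _ v
    have := (Submodule.Quotient.mk_eq_zero _).1 (hv :)
    exact (Submodule.Quotient.mk_eq_zero _).2 ⟨this, v.2⟩
  · intro v
    obtain ⟨⟨v, hv⟩, rfl⟩ := Submodule.mkQ_surjective _ v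
    obtain ⟨a, ha, b, hb, rfl⟩ := Submodule.mem_sup.1 hv
    refine ⟨Submodule.mkQ _ ⟨b, hb⟩, ?_⟩
    refine (Submodule.Quotient.eq _).2 ?_
    change b - (a + b) ∈ x.toSubmodule
    simpa using ha

/-- The semisimplification is unique up to isomorphism. -/
theorem IsSemisimplification.unique {V W W' : Type*} [AddCommGroup V] [Module k V]
    [AddCommGroup W] [Module k W] [AddCommGroup W'] [Module k W'] {ρ : Representation k G V}
    {S : Representation k G W} {S' : Representation k G W'} (h : IsSemisimplification S ρ)
    (h' : IsSemisimplification S' ρ) : Nonempty (S.Equiv S') := by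
  obtain ⟨m, s, s0, s1, hs, ⟨e⟩⟩ := h
  obtain ⟨m', s', s0', s1', hs', ⟨e'⟩⟩ := h'
  let c : CompositionSeries (Subrepresentation ρ) := ⟨m, s, hs⟩
  let c' : CompositionSeries (Subrepresentation ρ) := ⟨m', s', hs'⟩
  -- Jordan–Hölder holds in the modular lattice of subrepresentations. The equivalence of intervals
  -- it yields is generated by the second isomorphism theorem, so it implies isomorphism of the
  -- subquotients.
  obtain ⟨f, hf⟩ := CompositionSeries.jordan_holder c c' (s0.trans s0'.symm) (s1.trans s1'.symm)
  obtain ⟨E⟩ := nonempty_directSum_equiv (k := k) (G := G)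
    (ρ := fun i : Fin m => subquot (s i.castSucc) (s i.succ))
    (τ := fun i : Fin m' => subquot (s' i.castSucc) (s' i.succ)) f fun i =>
      (hf i).rel (fun X Y => Nonempty ((subquot X.1 X.2).Equiv (subquot Y.1 Y.2)))
        ⟨.refl _⟩ (fun ⟨f⟩ => ⟨f.symm⟩) (fun ⟨f⟩ ⟨g⟩ => ⟨f.trans g⟩)
        fun _ => nonempty_subquot_sup_equiv _ _
  exact ⟨(e.trans E).trans e'.symm⟩

end Semisimplification

section Semisimplification

variable {k G Γ : Type*} [Field k] [Group G] [Group Γ] {H : Subgroup G} {θ : H →* Γ}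
  {V W X Y : Type*} [AddCommGroup V] [Module k V] [AddCommGroup W] [Module k W]
  [AddCommGroup X] [Module k X] [AddCommGroup Y] [Module k Y]

/-- If submodules of `ρ` and of its compact induction correspond to each other, then compact
induction commutes with semisimplification. -/
theorem IsSemisimplification.induced {ρ : Representation k Γ V} {S : Representation k Γ W}
    {P : Representation k G X} {Q : Representation k G Y} {p : ℕ} (hp : IsUnit (p : k))
    (hθ : Function.Surjective θ) (h : IsSemisimplification S ρ) {D : IndData θ ρ P}
    (hD : D.HasAvg p) (D' : IndData θ S Q) : IsSemisimplification Q P := by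
  obtain ⟨m, s, s0, s1, hs, ⟨e⟩⟩ := h
  let o := hD.orderIso hp hθ
  refine ⟨m, fun i => o (s i), (congrArg o s0).trans o.map_bot,
    (congrArg o s1).trans o.map_top, fun i => (apply_covBy_apply_iff o).2 (hs i), ⟨D'.equiv (IndData.directSum fun i : Fin m => ?_) e⟩⟩
  exact (D.restrictSub (s i.succ)).quot _ _ (fun x hx => D.ev_mem hx) (fun v hv => D.sec_mem hv)

/-- A representation is compactly induced from the whole group. -/
def IndData.refl (ρ : Representation k G V) :
    IndData (Subgroup.topEquiv (G := G)).toMonoidHom ρ ρ where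
  ev := LinearMap.id
  sec := LinearMap.id
  ev_apply _ _ := rfl
  sec_apply _ _ := rfl
  ev_sec _ := rfl
  ev_apply_sec g hg := (hg trivial).elim
  mem_closure x := AddSubgroup.subset_closure ⟨1, x, by simp⟩

/-- An isomorphism exhibits its target as induced from the whole group, with a one-element averaging
set; transport is then a case of `IsSemisimplification.induced`. -/
theorem IsSemisimplification.congr {ρ : Representation k G V} {S : Representation k G W}
    {ρ' : Representation k G X} {S' : Representation k G Y} (h : IsSemisimplification S ρ)
    (e : ρ.Equiv ρ') (E : S.Equiv S') : IsSemisimplification S' ρ' := by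
  let D := (IndData.refl ρ).congr (.refl ρ) e
  refine h.induced (p := 1) (by simp) (Subgroup.topEquiv (G := G)).surjective (D := D) ?_
    ((IndData.refl S).congr (.refl S) E)
  intro x
  refine ⟨0, {1}, by simp, by simp, ?_⟩
  have : D.sec (D.ev x) = x := e.apply_symm_apply x
  simp [this]

/-- Both chain conditions on subspaces pass to subrepresentations and give a finite chain of
covering relations. -/
theorem exists_isSemisimplification {V : Type u} [AddCommGroup V] [Module k V]
    [FiniteDimensional k V] (ρ : Representation k G V) :
    ∃ (W : Type u) (_ : AddCommGroup W) (_ : Module k W) (S : Representation k G W),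
      IsSemisimplification S ρ := by
  have hm : StrictMono (Subrepresentation.toSubmodule : Subrepresentation ρ → Submodule k V) :=
    fun _ _ h => h
  have : WellFoundedLT (Subrepresentation ρ) := hm.wellFoundedLT
  have : WellFoundedGT (Subrepresentation ρ) := hm.wellFoundedGT
  obtain ⟨a, h0, m, h1, h⟩ := exists_covBy_seq_of_wellFoundedLT_wellFoundedGT (Subrepresentation ρ)
  exact ⟨_, _, _, _, m, fun i => a i, h0.eq_bot, h1.eq_top, fun i => h i i.2, ⟨.refl _⟩⟩

end Semisimplification

/-! ### Lattices over `ℤ̄_ℓ` and reduction modulo `𝔩`. -/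

section Coefficients

variable (l : ℕ) [hl : Fact l.Prime]

theorem isUnit_natCast_FlBar {p : ℕ} (hp : p.Prime) (h : l ≠ p) : IsUnit (p : FlBar l) := by
  rw [isUnit_iff_ne_zero, Ne, CharP.cast_eq_zero_iff (FlBar l) l]
  exact fun hd => h ((Nat.prime_dvd_prime_iff_eq hl.out hp).1 hd)

theorem isUnit_natCast_ZlBar {p : ℕ} (hp : p.Prime) (h : l ≠ p) : IsUnit (p : ZlBar l) := by
  have := isUnit_natCast_FlBar l hp h
  by_contra hu
  have h1 : IsLocalRing.residue (ZlBar l) (p : ZlBar l) = 0 := by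
    rw [IsLocalRing.residue_eq_zero_iff]; exact hu
  rw [map_natCast] at h1
  exact this.ne_zero h1

theorem isUnit_natCast_PadicAlgCl {p : ℕ} (hp : p.Prime) : IsUnit (p : PadicAlgCl l) := by
  rw [isUnit_iff_ne_zero]; exact_mod_cast hp.ne_zero

theorem exists_one_tmul {M : Type*} [AddCommGroup M] [Module (ZlBar l) M]
    (y : FlBar l ⊗[ZlBar l] M) : ∃ x : M, y = 1 ⊗ₜ x := by
  induction y using TensorProduct.induction_on with
  | zero => exact ⟨0, by simp⟩
  | tmul c x =>
    obtain ⟨a, rfl⟩ := IsLocalRing.residue_surjective c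
    refine ⟨a • x, ?_⟩
    rw [← TensorProduct.smul_tmul, Algebra.smul_def, mul_one]
    rfl
  | add x y hx hy =>
    obtain ⟨x, rfl⟩ := hx
    obtain ⟨y, rfl⟩ := hy
    exact ⟨x + y, by rw [TensorProduct.tmul_add]⟩

variable {l} {G Γ : Type*} [Group G] [Group Γ] {H : Subgroup G} {θ : H →* Γ}

/-- Compact induction commutes with reduction. -/
def IndData.modL {V X : Type*} [AddCommGroup V] [Module (ZlBar l) V] [AddCommGroup X]
    [Module (ZlBar l) X] {ρ : Representation (ZlBar l) Γ V} {P : Representation (ZlBar l) G X}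
    (D : IndData θ ρ P) : IndData θ (modL l ρ) (modL l P) where
  ev := D.ev.baseChange (FlBar l)
  sec := D.sec.baseChange (FlBar l)
  ev_apply h x := by
    obtain ⟨x, rfl⟩ := exists_one_tmul l x
    exact congrArg (TensorProduct.tmul _ 1) (D.ev_apply h x)
  sec_apply h x := by
    obtain ⟨x, rfl⟩ := exists_one_tmul l x
    exact congrArg (TensorProduct.tmul _ 1) (D.sec_apply h x)
  ev_sec x := by
    obtain ⟨x, rfl⟩ := exists_one_tmul l x
    exact congrArg (TensorProduct.tmul _ 1) (D.ev_sec x)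
  ev_apply_sec g hg x := by
    obtain ⟨x, rfl⟩ := exists_one_tmul l x
    refine (congrArg (TensorProduct.tmul _ 1) (D.ev_apply_sec g hg x)).trans ?_
    rw [TensorProduct.tmul_zero]
  mem_closure x := by
    obtain ⟨x, rfl⟩ := exists_one_tmul l x
    have h := AddSubgroup.mem_map_of_mem
      (TensorProduct.mk (ZlBar l) (FlBar l) X 1).toAddMonoidHom (D.mem_closure x)
    rw [AddMonoidHom.map_closure] at h
    refine AddSubgroup.closure_mono ?_ h
    rintro _ ⟨_, ⟨g, v, rfl⟩, rfl⟩
    exact ⟨g, 1 ⊗ₜ v, rfl⟩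

theorem IndData.HasAvg.modL {V X : Type*} [AddCommGroup V] [Module (ZlBar l) V] [AddCommGroup X]
    [Module (ZlBar l) X] {ρ : Representation (ZlBar l) Γ V} {P : Representation (ZlBar l) G X}
    {D : IndData θ ρ P} {p : ℕ} (h : D.HasAvg p) : D.modL.HasAvg p := fun x => by
  obtain ⟨x, rfl⟩ := exists_one_tmul l x
  obtain ⟨m, t, ht, ht1, hs⟩ := h x
  refine ⟨m, t, ht, ht1, ?_⟩
  have := congrArg (TensorProduct.mk (ZlBar l) (FlBar l) X 1) hs
  rw [map_nsmul, map_sum] at this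
  exact this

/-- The equivalence of reductions induced by an equivalence. -/
def modLEquiv {V X : Type*} [AddCommGroup V] [Module (ZlBar l) V] [AddCommGroup X]
    [Module (ZlBar l) X] {ρ : Representation (ZlBar l) G V} {P : Representation (ZlBar l) G X}
    (e : ρ.Equiv P) : (modL l ρ).Equiv (modL l P) :=
  Representation.Equiv.mk (e.toLinearEquiv.baseChange (ZlBar l) (FlBar l) _ _) fun g =>
    LinearMap.ext fun x => by
      obtain ⟨x, rfl⟩ := exists_one_tmul l x
      exact congrArg (TensorProduct.tmul _ 1) (equiv_apply_rep e g x)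

section Lattice

variable {V X : Type*} [AddCommGroup V] [Module (PadicAlgCl l) V] [AddCommGroup X]
  [Module (PadicAlgCl l) X] {π : Representation (PadicAlgCl l) Γ V}
  {P : Representation (PadicAlgCl l) G X}

/-- Compact induction over `ℤ̄_ℓ`. -/
def IndData.integral (D : IndData θ π P) :
    IndData θ (integralRestrict l π) (integralRestrict l P) where
  ev := D.ev.restrictScalars (ZlBar l)
  sec := D.sec.restrictScalars (ZlBar l)
  ev_apply := D.ev_apply
  sec_apply := D.sec_apply
  ev_sec := D.ev_sec
  ev_apply_sec := D.ev_apply_sec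
  mem_closure := D.mem_closure

theorem IndData.HasAvg.integral {D : IndData θ π P} {p : ℕ} (h : D.HasAvg p) :
    D.integral.HasAvg p := h

/-- Lattices induce to lattices. -/
theorem IsLattice.induce (D : IndData θ π P) {L : Subrepresentation (integralRestrict l π)}
    (hL : IsLattice l L) : IsLattice l (D.integral.induce L) := by
  have := hL.1
  refine ⟨(D.integral.restrictSub L).free, ?_⟩
  rw [eq_top_iff]
  intro x _
  induction D.mem_closure x using AddSubgroup.closure_induction with
  | mem x hx =>
    obtain ⟨g, v, rfl⟩ := hx
    have hv : v ∈ Submodule.span (PadicAlgCl l) (L.toSubmodule : Set V) := hL.2 ▸ Submodule.mem_top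
    have h := Submodule.mem_map_of_mem (f := P g ∘ₗ D.sec) hv
    rw [Submodule.map_span] at h
    refine Submodule.span_mono ?_ h
    rintro _ ⟨v, hv, rfl⟩
    exact (D.integral.induce L).apply_mem_toSubmodule g (D.integral.sec_mem hv)
  | zero => exact Submodule.zero_mem _
  | add x y _ _ hx hy => exact Submodule.add_mem _ (hx trivial) (hy trivial)
  | neg x _ hx => exact Submodule.neg_mem _ (hx trivial)

/-- `ℤ̄_ℓ` is not noetherian, but it is a valuation ring, hence Bézout: torsion-free modules are
flat, and finitely generated flat modules over a local ring are free. -/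
theorem free_of_fg {N : Submodule (ZlBar l) V} (h : N.FG) : Module.Free (ZlBar l) N := by
  have : Module.Finite (ZlBar l) N := Module.Finite.iff_fg.2 h
  have : Module.IsTorsionFree (ZlBar l) V := .trans_faithfulSMul (ZlBar l) (PadicAlgCl l) V
  have : Module.Flat (ZlBar l) N := by
    rw [Module.Flat.flat_iff_torsion_eq_bot_of_isBezout, ← Submodule.isTorsionFree_iff_torsion_eq_bot]
    infer_instance
  exact Module.free_of_flat_of_isLocalRing

/-- `ℚ̄_ℓ` is the fraction field of `ℤ̄_ℓ`, so the denominators of the finitely many coefficients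
can be cleared. -/
theorem exists_smul_mem_span {s : Set V} {x : V} (hx : x ∈ Submodule.span (PadicAlgCl l) s) :
    ∃ a : ZlBar l, a ≠ 0 ∧ a • x ∈ Submodule.span (ZlBar l) s := by
  induction hx using Submodule.span_induction with
  | mem x h => exact ⟨1, one_ne_zero, by simpa using Submodule.subset_span h⟩
  | zero => exact ⟨1, one_ne_zero, by simp⟩
  | add x y _ _ hx hy =>
    obtain ⟨a, ha, hx⟩ := hx
    obtain ⟨b, hb, hy⟩ := hy
    refine ⟨a * b, mul_ne_zero ha hb, ?_⟩
    rw [smul_add]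
    refine Submodule.add_mem _ ?_ ?_
    · rw [mul_comm, mul_smul]; exact Submodule.smul_mem _ b hx
    · rw [mul_smul]; exact Submodule.smul_mem _ a hy
  | smul c x _ hx =>
    obtain ⟨a, ha, hx⟩ := hx
    obtain ⟨⟨b, b'⟩, hb⟩ := IsLocalization.surj (nonZeroDivisors (ZlBar l)) c
    refine ⟨a * b', mul_ne_zero ha (nonZeroDivisors.ne_zero b'.2), ?_⟩
    have : (a * b' : ZlBar l) • c • x = b • a • x := by
      have hb' : c * ((b' : ZlBar l) : PadicAlgCl l) = (b : PadicAlgCl l) := hb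
      change (((a * b' : ZlBar l) : PadicAlgCl l)) • c • x =
        (b : PadicAlgCl l) • (a : PadicAlgCl l) • x
      rw [smul_smul, smul_smul, ← hb']
      congr 1
      push_cast
      ring
    rw [this]
    exact Submodule.smul_mem _ b hx

/-- Lattices in a finite-dimensional space are finitely generated. -/
theorem fg_of_isLattice_induce [FiniteDimensional (PadicAlgCl l) V] (D : IndData θ π P)
    {L : Subrepresentation (integralRestrict l π)} (h : IsLattice l (D.integral.induce L)) :
    L.toSubmodule.FG ∧ Submodule.span (PadicAlgCl l) (L.toSubmodule : Set V) = ⊤ := by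
  have hspan : Submodule.span (PadicAlgCl l) (L.toSubmodule : Set V) = ⊤ := by
    rw [eq_top_iff]
    intro v _
    have h1 : D.sec v ∈ Submodule.span (PadicAlgCl l)
        ((D.integral.induce L).toSubmodule : Set X) := h.2 ▸ Submodule.mem_top
    have h2 := Submodule.mem_map_of_mem (f := D.ev) h1
    rw [Submodule.map_span, D.ev_sec] at h2
    refine Submodule.span_mono ?_ h2
    rintro _ ⟨x, hx, rfl⟩
    exact D.integral.ev_mem hx
  refine ⟨?_, hspan⟩
  obtain ⟨T, hTL, hT⟩ := (Submodule.fg_span_iff_fg_span_finset_subset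
    (R := PadicAlgCl l) (L.toSubmodule : Set V)).1 (IsNoetherian.noetherian _)
  have := h.1
  let b := Module.Free.chooseBasis (ZlBar l) (D.integral.induce L).toSubmodule
  -- The coordinates of `sec v` in a basis, possibly infinite, of the induced lattice.
  let c : L.toSubmodule →ₗ[ZlBar l] _ := b.repr.toLinearMap ∘ₗ (D.integral.restrictSub L).sec
  classical
  let F := T.attach.biUnion fun v => (c ⟨v.1, hTL v.2⟩).support
  have hF : ∀ v ∈ Submodule.span (ZlBar l) (T : Set V), ∃ hv : v ∈ L.toSubmodule,
      (c ⟨v, hv⟩).support ⊆ F := by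
    intro v hv
    induction hv using Submodule.span_induction with
    | mem v h => exact ⟨hTL h, Finset.subset_biUnion_of_mem
        (fun v : T => (c ⟨v.1, hTL v.2⟩).support) (Finset.mem_attach T ⟨v, h⟩)⟩
    | zero => exact ⟨Submodule.zero_mem _, by
        rw [show (⟨0, _⟩ : L.toSubmodule) = 0 from rfl, map_zero]; simp⟩
    | add x y _ _ hx hy =>
      obtain ⟨hx, hx'⟩ := hx
      obtain ⟨hy, hy'⟩ := hy
      refine ⟨Submodule.add_mem _ hx hy, ?_⟩
      rw [show (⟨x + y, _⟩ : L.toSubmodule) = ⟨x, hx⟩ + ⟨y, hy⟩ from rfl, map_add]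
      exact Finsupp.support_add.trans (Finset.union_subset hx' hy')
    | smul a x _ hx =>
      obtain ⟨hx, hx'⟩ := hx
      refine ⟨Submodule.smul_mem _ a hx, ?_⟩
      rw [show (⟨a • x, _⟩ : L.toSubmodule) = a • ⟨x, hx⟩ from rfl, map_smul]
      exact Finsupp.support_smul.trans hx'
  -- Some nonzero multiple of `v` lies in the span of the finite set `T`, and coordinates have no
  -- torsion; so the finite set `F` of coordinates found for `T` serves all of `L`.
  have hF' : ∀ v : L.toSubmodule, (c v).support ⊆ F := by
    intro v
    obtain ⟨a, ha, hav⟩ := exists_smul_mem_span (l := l) (s := (T : Set V)) (x := v)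
      (by rw [← hT, hspan]; trivial)
    obtain ⟨hv', hs⟩ := hF _ hav
    intro i hi
    refine hs ?_
    rw [show (⟨a • (v : V), hv'⟩ : L.toSubmodule) = a • v from rfl, map_smul]
    rw [Finsupp.mem_support_iff] at hi ⊢
    exact mul_ne_zero ha hi
  -- Applying `ev` to the expansion of `sec v` expresses `v` through the vectors `ev (b i)` with `i
  -- ∈ F`, and these belong to `L`.
  have hle : L.toSubmodule = Submodule.span (ZlBar l)
      ((F.image fun i => D.ev (b i : X) : Finset V) : Set V) := by
    apply le_antisymm
    · intro v hv
      have hr := b.linearCombination_repr ((D.integral.restrictSub L).sec ⟨v, hv⟩)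
      have h2 := congrArg (fun y : (D.integral.induce L).toSubmodule =>
        (D.integral.ev (y : X))) hr
      have h3 : D.integral.ev (((D.integral.restrictSub L).sec ⟨v, hv⟩ :
        (D.integral.induce L).toSubmodule) : X) = v := D.ev_sec v
      rw [h3, Finsupp.linearCombination_apply, Finsupp.sum] at h2
      rw [← h2, AddSubmonoidClass.coe_finsetSum, map_sum]
      refine sum_mem fun i hi => ?_
      rw [Submodule.coe_smul, map_smul]
      refine Submodule.smul_mem _ _ (Submodule.subset_span ?_)
      exact Finset.mem_coe.2 (Finset.mem_image_of_mem _ (hF' ⟨v, hv⟩ hi))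
    · rw [Submodule.span_le]
      intro v hv
      obtain ⟨i, -, rfl⟩ := Finset.mem_image.1 (Finset.mem_coe.1 hv)
      exact D.integral.ev_mem (b i).2
  exact ⟨_, hle.symm⟩

theorem IsLattice.of_induce [FiniteDimensional (PadicAlgCl l) V] (D : IndData θ π P)
    {L : Subrepresentation (integralRestrict l π)} (h : IsLattice l (D.integral.induce L)) :
    IsLattice l L :=
  ⟨free_of_fg (fg_of_isLattice_induce D h).1, (fg_of_isLattice_induce D h).2⟩

end Lattice

end Coefficients

/-! ### Tate cohomology of compactly induced representations. -/

section TateInduction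

/-- A cyclic automorphism `σ` of `GF`, with fixed points `ι : GE → GF`, that is compatible with the
data `θF`, `θE` of compact inductions, and whose fixed cosets come from `GE`. -/
structure CyclicDescent {GF ΓF GE ΓE : Type*} [Group GF] [Group ΓF] [Group GE] [Group ΓE]
    {HF : Subgroup GF} {HE : Subgroup GE} (θF : HF →* ΓF) (θE : HE →* ΓE) (ι : GE →* GF)
    (κ : ΓE →* ΓF) (σ : GF →* GF) (φ : ΓF →* ΓF) (l : ℕ) : Prop where
  map_incl : ∀ g, σ (ι g) = ι g
  map_mem : ∀ h : HF, σ h ∈ HF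
  red_map : ∀ h h' : HF, (h' : GF) = σ h → θF h' = φ (θF h)
  incl_mem : ∀ g, ι g ∈ HF ↔ g ∈ HE
  red_incl : ∀ (h : HE) (h' : HF), (h' : GF) = ι h → θF h' = κ (θE h)
  exists_fixed : ∀ g, σ g * g⁻¹ ∈ HF → ∃ h ∈ HF, ∃ c, h * g = ι c
  iterate : ∀ g, σ^[l] g = g

theorem intertwining_pow_toLinearMap {R Γ M : Type*} [CommRing R] [Group Γ] [AddCommGroup M]
    [Module R M] {ρ : Representation R Γ M} (T : ρ.IntertwiningMap ρ) (i : ℕ) :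
    (T ^ i).toLinearMap = T.toLinearMap ^ i := by
  induction i with
  | zero => rfl
  | succ i ih => rw [pow_succ, pow_succ, ← ih]; rfl

theorem tateNorm_apply {R Γ M : Type*} [CommRing R] [Group Γ] [AddCommGroup M]
    [Module R M] {ρ : Representation R Γ M} (l : ℕ) (T : ρ.IntertwiningMap ρ) (x : M) :
    tateNorm l T x = ∑ i ∈ Finset.range l, (T.toLinearMap ^ i) x := by
  rw [tateNorm, Representation.IntertwiningMap.sum_apply]
  refine Finset.sum_congr rfl fun i _ => ?_
  rw [← intertwining_pow_toLinearMap]; rfl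

theorem mem_ker_one_sub {R Γ M : Type*} [CommRing R] [Group Γ] [AddCommGroup M]
    [Module R M] {ρ : Representation R Γ M} {T : ρ.IntertwiningMap ρ} {x : M} :
    x ∈ (1 - T).ker.toSubmodule ↔ T x = x := by
  have h : x ∈ (1 - T).ker.toSubmodule ↔ x - T x = 0 := Iff.rfl
  rw [h, sub_eq_zero, eq_comm]

theorem mem_range_tateNorm {R Γ M : Type*} [CommRing R] [Group Γ] [AddCommGroup M]
    [Module R M] {ρ : Representation R Γ M} {l : ℕ} {T : ρ.IntertwiningMap ρ} {x : M} :
    x ∈ (tateNorm l T).range.toSubmodule ↔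
      ∃ y, ∑ i ∈ Finset.range l, (T.toLinearMap ^ i) y = x := by
  have h : x ∈ (tateNorm l T).range.toSubmodule ↔ ∃ y, tateNorm l T y = x := Iff.rfl
  simp only [h, tateNorm_apply]

theorem semiconj_pow {R M N : Type*} [CommRing R] [AddCommGroup M] [Module R M] [AddCommGroup N]
    [Module R N] {S : M →ₗ[R] M} {T : N →ₗ[R] N} {f : M →ₗ[R] N} (h : ∀ x, f (S x) = T (f x))
    (i : ℕ) (x : M) : f ((S ^ i) x) = (T ^ i) (f x) := by
  induction i with
  | zero => rfl
  | succ i ih => rw [pow_succ', pow_succ', Module.End.mul_apply, h, ih]; rfl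

/-- Compatible maps induce maps on Tate cohomology. -/
def tateMap {R Γ Γ' M N : Type*} [CommRing R] [Group Γ] [Group Γ'] [AddCommGroup M] [Module R M]
    [AddCommGroup N] [Module R N] {ρ : Representation R Γ M} {ρ' : Representation R Γ' N} (l : ℕ)
    (S : ρ.IntertwiningMap ρ) (T : ρ'.IntertwiningMap ρ') (f : M →ₗ[R] N)
    (h : ∀ x, f (S x) = T (f x)) :
    ((1 - S).ker.toSubmodule ⧸
      (tateNorm l S).range.toSubmodule.comap (1 - S).ker.toSubmodule.subtype) →ₗ[R]
    ((1 - T).ker.toSubmodule ⧸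
      (tateNorm l T).range.toSubmodule.comap (1 - T).ker.toSubmodule.subtype) :=
  Submodule.mapQ _ _ (f.restrict fun x hx => by
    rw [mem_ker_one_sub] at hx ⊢
    rw [← h, hx]) fun x hx => by
      obtain ⟨y, hy⟩ := mem_range_tateNorm.1 (Submodule.mem_comap.1 hx)
      refine Submodule.mem_comap.2 (Submodule.mem_comap.2 (mem_range_tateNorm.2 ⟨f y, ?_⟩))
      change _ = f x
      rw [show (x : M) = _ from hy.symm, map_sum]
      exact Finset.sum_congr rfl fun i _ => (semiconj_pow (S := S.toLinearMap) h i y).symm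

/-- Tate cohomology respects isomorphisms. -/
def tateEquiv {R Γ M N : Type*} [CommRing R] [Group Γ] [AddCommGroup M] [Module R M]
    [AddCommGroup N] [Module R N] {ρ : Representation R Γ M} {τ : Representation R Γ N} (l : ℕ)
    (S : ρ.IntertwiningMap ρ) (T : τ.IntertwiningMap τ) (e : ρ.Equiv τ)
    (h : ∀ x, e (S x) = T (e x)) : (tateH0 l S).Equiv (tateH0 l T) :=
  Representation.Equiv.mk
    (LinearEquiv.ofLinearMap (tateMap l S T e.toLinearMap h)
      (tateMap l T S e.symm.toLinearMap fun x => by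
        obtain ⟨y, rfl⟩ := e.toLinearEquiv.surjective x
        change e.symm (T (e y)) = S (e.symm (e y))
        rw [← h, e.symm_apply_apply, e.symm_apply_apply])
      (LinearMap.ext fun x => by
        obtain ⟨x, rfl⟩ := Submodule.mkQ_surjective _ x
        exact congrArg (Submodule.mkQ _) (Subtype.ext (e.apply_symm_apply x.1)))
      (LinearMap.ext fun x => by
        obtain ⟨x, rfl⟩ := Submodule.mkQ_surjective _ x
        exact congrArg (Submodule.mkQ _) (Subtype.ext (e.symm_apply_apply x.1))))
    fun g => LinearMap.ext fun x => by
      obtain ⟨x, rfl⟩ := Submodule.mkQ_surjective _ x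
      exact congrArg (Submodule.mkQ _) (Subtype.ext (equiv_apply_rep e g x.1))

variable {R : Type*} [CommRing R] {GF ΓF GE ΓE : Type*} [Group GF] [Group ΓF] [Group GE] [Group ΓE]
    {HF : Subgroup GF} {HE : Subgroup GE} {θF : HF →* ΓF} {θE : HE →* ΓE} {ι : GE →* GF}
    {κ : ΓE →* ΓF} {σ : GF →* GF} {φ : ΓF →* ΓF} {l : ℕ}
    {V X : Type*} [AddCommGroup V] [Module R V] [AddCommGroup X] [Module R X]
    {ρ : Representation R ΓF V} {P : Representation R GF X}

theorem IndData.comp_comp (D : IndData θF ρ P) (q q' : Quotient (QuotientGroup.rightRel HF))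
    (x : X) : D.comp q (D.comp q' x) = open Classical in if q = q' then D.comp q' x else 0 := by
  have := D.comp_apply_sec q (q'.out⁻¹) (D.ev (P q'.out x))
  rw [inv_inv, Quotient.out_eq] at this
  exact this

/-- Elements of the compact induction fixed by `T'` are, up to norms, sums of translates under `GE`
of elements supported on `HF`. -/
theorem IndData.exists_sub_norm_mem (C : CyclicDescent θF θE ι κ σ φ l) (hl : l.Prime)
    (D : IndData θF ρ P) {T : V →ₗ[R] V} {T' : X →ₗ[R] X}
    (hT' : ∀ g x, T' (P g x) = P (σ g) (T' x)) (hev : ∀ x, D.ev (T' x) = T (D.ev x))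
    (hsec : ∀ v, T' (D.sec v) = D.sec (T v)) {x : X} (hx : T' x = x) :
    ∃ z, x - ∑ i ∈ Finset.range l, (T' ^ i) z ∈
      AddSubgroup.closure {y | ∃ g v, T v = v ∧ y = P (ι g) (D.sec v)} := by
  classical
  have hσr : ∀ a b : GF, QuotientGroup.rightRel HF a b → QuotientGroup.rightRel HF (σ a) (σ b) := by
    intro a b h
    rw [QuotientGroup.rightRel_apply] at h ⊢
    simpa using C.map_mem ⟨_, h⟩
  let s : Quotient (QuotientGroup.rightRel HF) → Quotient (QuotientGroup.rightRel HF) :=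
    Quotient.map σ hσr
  have hsl : ∀ q, s^[l] q = q := by
    intro q
    induction q using Quotient.inductionOn with | _ g =>
    have : ∀ i, s^[i] (Quotient.mk _ g) = Quotient.mk _ (σ^[i] g) := by
      intro i
      induction i with
      | zero => rfl
      | succ i ih => rw [Function.iterate_succ_apply', Function.iterate_succ_apply', ih]; rfl
    rw [this, C.iterate]
  have hcomp : ∀ q (y : X), T' (D.comp q y) = D.comp (s q) (T' y) := by
    intro q y
    induction q using Quotient.inductionOn with | _ g =>
    change _ = D.comp (Quotient.mk _ (σ g)) _
    rw [D.comp_mk, D.comp_mk, hT', hsec, map_inv, ← hev, hT']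
  -- Induction on the size of a finite set of cosets outside of which the components vanish. Each
  -- round clears one coset `q`, together with its whole `σ`-orbit.
  have main : ∀ (N : ℕ) (t : Finset (Quotient (QuotientGroup.rightRel HF))) (x : X), t.card = N →
      T' x = x → (∀ q ∉ t, D.comp q x = 0) →
      ∃ z, x - ∑ i ∈ Finset.range l, (T' ^ i) z ∈
        AddSubgroup.closure {y | ∃ g v, T v = v ∧ y = P (ι g) (D.sec v)} := by
    intro N
    induction N with
    | zero =>
      intro t x ht _ h
      rw [Finset.card_eq_zero] at ht
      subst ht
      obtain ⟨r, -, hr⟩ := D.exists_sum_comp x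
      refine ⟨0, ?_⟩
      rw [← hr, Finset.sum_eq_zero fun q _ => h q (Finset.notMem_empty q)]
      simp
    | succ N ih =>
      intro t x ht hx h
      obtain ⟨q, hq⟩ : t.Nonempty := by rw [← Finset.card_pos]; omega
      have hcard : (t.erase q).card = N := by rw [Finset.card_erase_of_mem hq]; omega
      have hpow : ∀ i, (T' ^ i) (D.comp q x) = D.comp (s^[i] q) x := by
        intro i
        induction i with
        | zero => rfl
        | succ i ih =>
          rw [pow_succ', Module.End.mul_apply, ih, hcomp, hx, Function.iterate_succ_apply']
      by_cases hfix : s q = q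
      -- By descent a fixed coset has a representative from `GE`, so the component there is a
      -- translate under `ι` of `sec` of a vector fixed by `T`.
      · obtain ⟨c, rfl⟩ : ∃ c, Quotient.mk _ (ι c) = q := by
          induction q using Quotient.inductionOn with | _ g =>
          have h1 := QuotientGroup.rightRel_apply.1 (Quotient.exact hfix)
          obtain ⟨h, hh, c, hc⟩ := C.exists_fixed g (by simpa using HF.inv_mem h1)
          refine ⟨c, Quotient.sound (QuotientGroup.rightRel_apply.2 ?_)⟩
          rw [← hc]
          simpa using HF.inv_mem hh
        set q : Quotient (QuotientGroup.rightRel HF) := Quotient.mk _ (ι c)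
        obtain ⟨z, hz⟩ := ih (t.erase q) (x - D.comp q x) hcard
          (by rw [map_sub, hcomp, hx, hfix]) fun r hr => by
            rw [map_sub, D.comp_comp]
            by_cases hrq : r = q
            · subst hrq; simp
            · rw [if_neg hrq, sub_zero]
              exact h r fun hrt => hr (Finset.mem_erase.2 ⟨hrq, hrt⟩)
        refine ⟨z, ?_⟩
        have h2 : D.comp q x ∈
            AddSubgroup.closure {y | ∃ g v, T v = v ∧ y = P (ι g) (D.sec v)} := by
          refine AddSubgroup.subset_closure ⟨c⁻¹, D.ev (P (ι c) x), ?_, ?_⟩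
          · rw [← hev, hT', C.map_incl, hx]
          · rw [map_inv]; exact D.comp_mk _ _
        have h3 := AddSubgroup.add_mem _ hz h2
        convert h3 using 1
        abel
      -- Since `l` is prime, a coset that is not fixed has exactly `l` conjugates, and the
      -- components of `x` along its orbit add up to the norm of one of them.
      · have hne : ∀ i ∈ Finset.range l, i ≠ 0 → s^[i] q ≠ q := by
          intro i hi hi0 hiq
          refine hfix ?_
          have h1 : Function.IsPeriodicPt s i q := hiq
          have h2 : Function.IsPeriodicPt s l q := hsl q
          have h3 := h2.gcd h1
          rwa [Nat.Coprime.gcd_eq_one ((Nat.coprime_of_lt_prime hi0 (Finset.mem_range.1 hi) hl))] at h3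
        have hfixed : T' (x - ∑ i ∈ Finset.range l, (T' ^ i) (D.comp q x)) =
            x - ∑ i ∈ Finset.range l, (T' ^ i) (D.comp q x) := by
          have hl0 : T' (∑ i ∈ Finset.range l, (T' ^ i) (D.comp q x)) =
              ∑ i ∈ Finset.range l, (T' ^ i) (D.comp q x) := by
            have e1 := Finset.sum_range_succ (fun i => (T' ^ i) (D.comp q x)) l
            rw [Finset.sum_range_succ'] at e1
            rw [hpow l, hsl, pow_zero, Module.End.one_apply] at e1
            rw [map_sum, ← add_right_cancel e1]
            exact Finset.sum_congr rfl fun i _ => by rw [pow_succ', Module.End.mul_apply]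
          rw [map_sub, hx, hl0]
        have hzero : ∀ r ∉ t.erase q,
            D.comp r (x - ∑ i ∈ Finset.range l, (T' ^ i) (D.comp q x)) = 0 := by
          intro r hr
          rw [map_sub, map_sum]
          simp only [hpow, D.comp_comp]
          by_cases hrq : r = q
          · subst hrq
            rw [Finset.sum_eq_single_of_mem 0 (Finset.mem_range.2 hl.pos)]
            · simp
            · intro i hi hi0
              rw [if_neg (hne i hi hi0).symm]
          · have hrx : D.comp r x = 0 := h r fun hrt => hr (Finset.mem_erase.2 ⟨hrq, hrt⟩)
            rw [hrx, zero_sub, neg_eq_zero]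
            refine Finset.sum_eq_zero fun i _ => ?_
            split_ifs with hri
            · rw [← hri, hrx]
            · rfl
        obtain ⟨z, hz⟩ := ih (t.erase q) _ hcard hfixed hzero
        refine ⟨D.comp q x + z, ?_⟩
        convert hz using 1
        simp only [map_add, Finset.sum_add_distrib]
        abel
  obtain ⟨t, ht, -⟩ := D.exists_sum_comp x
  exact main _ t x rfl hx ht

/-- Compact induction commutes with Tate cohomology. -/
def IndData.tate (C : CyclicDescent θF θE ι κ σ φ l) (hl : l.Prime) (D : IndData θF ρ P)
    (T : Representation.IntertwiningMap (ρ.comp κ) (ρ.comp κ))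
    (T' : Representation.IntertwiningMap (P.comp ι) (P.comp ι))
    (hT' : ∀ g x, T' (P g x) = P (σ g) (T' x)) (hev : ∀ x, D.ev (T' x) = T (D.ev x))
    (hsec : ∀ v, T' (D.sec v) = D.sec (T v)) :
    IndData θE (tateH0 l T) (tateH0 l T') where
  ev := tateMap l T' T D.ev hev
  sec := tateMap l T T' D.sec fun v => (hsec v).symm
  ev_apply h x := by
    obtain ⟨x, rfl⟩ := Submodule.mkQ_surjective _ x
    refine congrArg (Submodule.mkQ _) (Subtype.ext ?_)
    have := D.ev_apply ⟨ι h, (C.incl_mem h).2 h.2⟩ x.1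
    rw [C.red_incl h _ rfl] at this
    exact this
  sec_apply h x := by
    obtain ⟨x, rfl⟩ := Submodule.mkQ_surjective _ x
    refine congrArg (Submodule.mkQ _) (Subtype.ext ?_)
    have := D.sec_apply ⟨ι h, (C.incl_mem h).2 h.2⟩ x.1
    rw [C.red_incl h _ rfl] at this
    exact this
  ev_sec x := by
    obtain ⟨x, rfl⟩ := Submodule.mkQ_surjective _ x
    exact congrArg (Submodule.mkQ _) (Subtype.ext (D.ev_sec x.1))
  ev_apply_sec g hg x := by
    obtain ⟨x, rfl⟩ := Submodule.mkQ_surjective _ x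
    refine (congrArg (Submodule.mkQ _) (Subtype.ext ?_)).trans (map_zero _)
    exact D.ev_apply_sec (ι g) (fun h => hg ((C.incl_mem g).1 h)) x.1
  mem_closure x := by
    obtain ⟨⟨x, hx⟩, rfl⟩ := Submodule.mkQ_surjective _ x
    have hx' : T' x = x := mem_ker_one_sub.1 hx
    obtain ⟨z, hz⟩ := D.exists_sub_norm_mem C hl (T := T.toLinearMap) (T' := T'.toLinearMap)
      hT' hev hsec hx'
    set N := (tateNorm l T').range.toSubmodule.comap (1 - T').ker.toSubmodule.subtype
    have key : ∀ y ∈ AddSubgroup.closure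
        {y | ∃ g v, T.toLinearMap v = v ∧ y = P (ι g) (D.sec v)},
        ∃ hy : y ∈ (1 - T').ker.toSubmodule, N.mkQ ⟨y, hy⟩ ∈ AddSubgroup.closure
          {y | ∃ g v, y = tateH0 l T' g (tateMap l T T' D.sec (fun v => (hsec v).symm) v)} := by
      intro y hy
      induction hy using AddSubgroup.closure_induction with
      | mem y h =>
        obtain ⟨g, v, hv, rfl⟩ := h
        refine ⟨?_, AddSubgroup.subset_closure ⟨g, Submodule.mkQ _ ⟨v, mem_ker_one_sub.2 hv⟩, rfl⟩⟩
        rw [mem_ker_one_sub, hT', C.map_incl, hsec]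
        exact congrArg (fun w => P (ι g) (D.sec w)) hv
      | zero => exact ⟨Submodule.zero_mem _, AddSubgroup.zero_mem _⟩
      | add a b _ _ ha hb =>
        obtain ⟨ha, ha'⟩ := ha
        obtain ⟨hb, hb'⟩ := hb
        exact ⟨Submodule.add_mem _ ha hb, AddSubgroup.add_mem _ ha' hb'⟩
      | neg a _ ha =>
        obtain ⟨ha, ha'⟩ := ha
        exact ⟨Submodule.neg_mem _ ha, AddSubgroup.neg_mem _ ha'⟩
    obtain ⟨hy, hy'⟩ := key _ hz
    convert hy' using 1
    refine (Submodule.Quotient.eq _).2 (Submodule.mem_comap.2 (mem_range_tateNorm.2 ⟨z, ?_⟩))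
    simp

/-- An operator on the compact induction that intertwines it with its conjugate comes from an
operator on the inducing representation. -/
theorem IndData.HasAvg.ev_twist (C : CyclicDescent θF θE ι κ σ φ l) {D : IndData θF ρ P} {p : ℕ}
    (h : D.HasAvg p) (hp : IsUnit (p : R)) {T' : X →ₗ[R] X}
    (hT' : ∀ g x, T' (P g x) = P (σ g) (T' x)) (x : X) :
    D.ev (T' x) = D.ev (T' (D.sec (D.ev x))) := by
  obtain ⟨m, t, htc, ht1, hs⟩ := h x
  have h1 := congrArg (fun y => D.ev (T' y)) hs
  simp only [map_nsmul, map_sum] at h1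
  refine (IndData.smul_cancel hp (m := m) (h1.trans ?_)).symm
  -- Each `k` of the averaging set lies in the kernel of `θF`, and so does `σ k`; hence every
  -- summand equals `ev (T' x)`.
  rw [← htc, ← Finset.sum_const]
  refine Finset.sum_congr rfl fun k hk => ?_
  have h2 := D.ev_apply ⟨σ k, C.map_mem k⟩ (T' x)
  rw [C.red_map k _ rfl, ht1 k hk, map_one, map_one] at h2
  rw [hT']
  exact h2

/-- `sec v` is fixed by the kernel of `θF`, and `σ`, having finite order, maps this kernel onto
itself. So `T' (sec v)` is fixed by the kernel as well, and is supported on `HF`. -/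
theorem IndData.HasAvg.twist_sec (C : CyclicDescent θF θE ι κ σ φ l) (hl : l ≠ 0)
    {D : IndData θF ρ P} {p : ℕ} (h : D.HasAvg p) (hp : IsUnit (p : R)) {T' : X →ₗ[R] X}
    (hT' : ∀ g x, T' (P g x) = P (σ g) (T' x)) (v : V) :
    T' (D.sec v) = D.sec (D.ev (T' (D.sec v))) := by
  refine (h.eq_sec_ev hp fun k hk => ?_).symm
  have key : ∀ i, ∃ k' : HF, (k' : GF) = σ^[i] k ∧ θF k' = 1 := by
    intro i
    induction i with
    | zero => exact ⟨k, rfl, hk⟩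
    | succ i ih =>
      obtain ⟨k', hk', h1⟩ := ih
      refine ⟨⟨σ k', C.map_mem k'⟩, ?_, ?_⟩
      · rw [Function.iterate_succ_apply', ← hk']
      · rw [C.red_map k' _ rfl, h1, map_one]
  obtain ⟨k', hk', h1⟩ := key (l - 1)
  have hk'' : σ k' = k := by
    rw [hk', ← Function.iterate_succ_apply' σ, Nat.succ_eq_add_one, Nat.sub_add_cancel
      (Nat.one_le_iff_ne_zero.2 hl), C.iterate]
  rw [← hk'', ← hT', D.sec_apply, h1, map_one, Module.End.one_apply]

end TateInduction

/-! ## Cuspidality over a finite field -/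

section Cuspidality

variable {k : Type*} [Field k] [Finite k] {n : ℕ}

/-- The group of invertible matrices that coincide with the identity outside of the positions in
the transitive relation `Ω`. -/
def patternGroup (k : Type*) [Field k] [Finite k] {n : ℕ} (Ω : Fin n → Fin n → Prop)
    (hΩ : ∀ a b c, Ω a b → Ω b c → Ω a c) : Subgroup (GL (Fin n) k) :=
  let S : Submonoid (GL (Fin n) k) :=
    { carrier := {g | ∀ i j, ¬ Ω i j → g i j = (1 : Matrix (Fin n) (Fin n) k) i j}
      one_mem' := fun i j _ => rfl
      mul_mem' := by
        intro g h hg hh i j hij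
        rw [Units.val_mul, ← mul_one (1 : Matrix (Fin n) (Fin n) k), Matrix.mul_apply,
          Matrix.mul_apply]
        refine Finset.sum_congr rfl fun x _ => ?_
        by_cases hix : Ω i x
        · have hxj : ¬ Ω x j := fun h => hij (hΩ _ _ _ hix h)
          have hne : x ≠ j := fun h => hij (h ▸ hix)
          rw [hh x j hxj, Matrix.one_apply_ne hne, mul_zero, mul_zero]
        · rw [hg i x hix]
          by_cases h : i = x
          · subst h; rw [hh i j hij]
          · rw [Matrix.one_apply_ne h, zero_mul, zero_mul] }
  { S with
    inv_mem' := by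
      intro g hg
      -- In a finite group an inverse is a power, so closure under products suffices.
      obtain ⟨r, hr, hr1⟩ := (isOfFinOrder_of_finite g).exists_pow_eq_one
      have : g⁻¹ = g ^ (r - 1) := by
        rw [inv_eq_iff_mul_eq_one, ← pow_succ', Nat.sub_add_cancel hr, hr1]
      rw [this]
      exact S.pow_mem hg _ }

theorem mem_patternGroup {Ω : Fin n → Fin n → Prop} {hΩ : ∀ a b c, Ω a b → Ω b c → Ω a c}
    {g : GL (Fin n) k} : g ∈ patternGroup k Ω hΩ ↔
      ∀ i j, ¬ Ω i j → g i j = (1 : Matrix (Fin n) (Fin n) k) i j := Iff.rfl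

/-- Every factor moves at least one step to the right: a nonzero entry `(i, j)` of the `r`-th power
has `i + r ≤ j`. -/
theorem strictUpper_pow_eq_zero {A : Matrix (Fin n) (Fin n) k} (h : ∀ i j, j ≤ i → A i j = 0) :
    A ^ n = 0 := by
  have key : ∀ r (i j : Fin n), (A ^ r) i j ≠ 0 → (i : ℕ) + r ≤ j := by
    intro r
    induction r with
    | zero =>
      intro i j hij
      rw [pow_zero] at hij
      by_contra hc
      exact hij (Matrix.one_apply_ne (by rintro rfl; omega))
    | succ r ih =>
      intro i j hij
      rw [pow_succ, Matrix.mul_apply] at hij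
      obtain ⟨x, -, hx⟩ := Finset.exists_ne_zero_of_sum_ne_zero hij
      have h1 := ih i x (left_ne_zero_of_mul hx)
      have h2 : x < j := by
        by_contra hc
        exact right_ne_zero_of_mul hx (h x j (not_lt.1 hc))
      have h3 : (x : ℕ) < j := h2
      omega
  ext i j
  by_contra hc
  have := key n i j hc
  omega

/-- The group is a `p`-group: with `N = g - 1` nilpotent, `(1 + N) ^ (p ^ n) = 1 + N ^ (p ^ n) = 1`,
because `p ^ n ≥ n`. Its order is thus invertible wherever `p` is. -/
theorem card_patternGroup {p : ℕ} [Fact p.Prime] [CharP k p] {Ω : Fin n → Fin n → Prop}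
    {hΩ : ∀ a b c, Ω a b → Ω b c → Ω a c} (hlt : ∀ i j, Ω i j → i < j) :
    ∃ a, Nat.card (patternGroup k Ω hΩ) = p ^ a := by
  refine IsPGroup.iff_card.1 fun g => ⟨n, Subtype.ext (Units.ext ?_)⟩
  have hN : ((g : GL (Fin n) k) : Matrix (Fin n) (Fin n) k) =
      (((g : GL (Fin n) k) : Matrix (Fin n) (Fin n) k) - 1) + 1 := by simp
  set N := ((g : GL (Fin n) k) : Matrix (Fin n) (Fin n) k) - 1
  have hN0 : N ^ n = 0 := strictUpper_pow_eq_zero fun i j hij => by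
    have := mem_patternGroup.1 g.2 i j fun h => not_lt.2 hij (hlt _ _ h)
    simp [N, this]
  have hle : n ≤ p ^ n := (Nat.lt_pow_self (Fact.out : p.Prime).one_lt).le
  have : Nonempty (Fin n) ∨ IsEmpty (Fin n) := (isEmpty_or_nonempty _).symm
  rcases this with hne | hne
  · change (((g : GL (Fin n) k) : Matrix (Fin n) (Fin n) k)) ^ p ^ n = 1
    rw [hN, add_pow_char_pow_of_commute _ _ (Commute.one_right N), one_pow,
      pow_eq_zero_of_le hle hN0, zero_add]
  · ext i
    exact hne.elim i

/-- The unipotent radical of the maximal parabolic `P_m`. -/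
def radGroup (k : Type*) [Field k] [Finite k] (n m : ℕ) : Subgroup (GL (Fin n) k) :=
  patternGroup k (fun i j => (i : ℕ) < m ∧ m ≤ (j : ℕ)) fun _ _ _ h h' => ⟨h.1, h'.2⟩

/-- The norm of the unipotent radical of each maximal parabolic vanishes. -/
def CuspSum {R V : Type*} [CommRing R] [AddCommGroup V] [Module R V]
    (ρ : Representation R (GL (Fin n) k) V) : Prop :=
  ∀ m, 1 ≤ m → m < n → ∀ v, ∑ᶠ u : radGroup k n m, ρ u v = 0

variable {R V : Type*} [CommRing R] [AddCommGroup V] [Module R V]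
    {ρ : Representation R (GL (Fin n) k) V}

/-- The vanishing of norms, unlike the definition of cuspidality by homomorphisms to induced
representations, is visibly inherited by subobjects and quotients and does not depend on the
coefficient ring. It is the form of cuspidality used from here on. -/
theorem CuspSum.of_injective {R' W : Type*} [CommRing R'] [AddCommGroup W] [Module R' W]
    {τ : Representation R' (GL (Fin n) k) W} (h : CuspSum ρ) (f : W →+ V)
    (hf : Function.Injective f) (hfτ : ∀ g w, f (τ g w) = ρ g (f w)) : CuspSum τ := by
  intro m h1 h2 w
  apply hf
  rw [f.map_finsum (Set.toFinite _), map_zero]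
  simp only [hfτ]
  exact h m h1 h2 _

theorem CuspSum.of_surjective {R' W : Type*} [CommRing R'] [AddCommGroup W] [Module R' W]
    {τ : Representation R' (GL (Fin n) k) W} (h : CuspSum ρ) (f : V →+ W)
    (hf : Function.Surjective f) (hfτ : ∀ g v, f (ρ g v) = τ g (f v)) : CuspSum τ := by
  intro m h1 h2 w
  obtain ⟨v, rfl⟩ := hf w
  simp only [← hfτ]
  rw [← f.map_finsum (Set.toFinite _), h m h1 h2, map_zero]

theorem CuspSum.toRepresentation (h : CuspSum ρ) (Y : Subrepresentation ρ) :
    CuspSum Y.toRepresentation :=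
  h.of_injective Y.toSubmodule.subtype.toAddMonoidHom Subtype.val_injective fun _ _ => rfl

theorem CuspSum.quotient (h : CuspSum ρ) (Y : Submodule R V) (hY : ∀ g, Y ≤ Y.comap (ρ g)) :
    CuspSum (ρ.quotient Y hY) :=
  h.of_surjective Y.mkQ.toAddMonoidHom (Submodule.mkQ_surjective _) fun _ _ => rfl

theorem CuspSum.modL {l : ℕ} [Fact l.Prime] {V : Type*} [AddCommGroup V] [Module (ZlBar l) V]
    {ρ : Representation (ZlBar l) (GL (Fin n) k) V} (h : CuspSum ρ) : CuspSum (modL l ρ) :=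
  h.of_surjective (TensorProduct.mk (ZlBar l) (FlBar l) V 1).toAddMonoidHom
    (fun y => let ⟨x, hx⟩ := exists_one_tmul l y; ⟨x, hx.symm⟩) fun _ _ => rfl

theorem CuspSum.integralRestrict {l : ℕ} [Fact l.Prime] {V : Type*} [AddCommGroup V]
    [Module (PadicAlgCl l) V] {ρ : Representation (PadicAlgCl l) (GL (Fin n) k) V}
    (h : CuspSum ρ) : CuspSum (integralRestrict l ρ) :=
  h.of_injective (AddMonoidHom.id V) Function.injective_id fun _ _ => rfl

/-- The norm of a fixed vector is that vector times the order of the radical, a power of `p`. -/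
theorem CuspSum.eq_zero_of_fixed (h : CuspSum ρ) {p : ℕ} [Fact p.Prime] [CharP k p]
    (hp : IsUnit (p : R)) {m : ℕ} (h1 : 1 ≤ m) (h2 : m < n) {v : V}
    (hv : ∀ u ∈ radGroup k n m, ρ u v = v) : v = 0 := by
  have hs := h m h1 h2 v
  rw [finsum_congr fun u : radGroup k n m => hv u u.2] at hs
  have := Fintype.ofFinite (radGroup k n m)
  rw [finsum_eq_sum_of_fintype, Finset.sum_const, Finset.card_univ, ← Nat.card_eq_fintype_card] at hs
  obtain ⟨a, ha⟩ := card_patternGroup (k := k) (p := p) (n := n)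
    (Ω := fun i j => (i : ℕ) < m ∧ m ≤ (j : ℕ)) (hΩ := fun _ _ _ h h' => ⟨h.1, h'.2⟩)
    fun i j h => Fin.lt_def.2 (h.1.trans_le h.2)
  rw [show Nat.card (radGroup k n m) = p ^ a from ha] at hs
  exact IndData.smul_cancel hp (hs.trans (smul_zero _).symm)

theorem conj_mem_radGroup {m : ℕ} {g : GL (Fin n) k} (hg : g ∈ parabolic k n m)
    {u : GL (Fin n) k} (hu : u ∈ radGroup k n m) : g * u * g⁻¹ ∈ radGroup k n m := by
  refine mem_patternGroup.2 fun i j hij => ?_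
  have e : ((g * u * g⁻¹ : GL (Fin n) k) : Matrix (Fin n) (Fin n) k) =
      1 + (g : Matrix (Fin n) (Fin n) k) * ((u : Matrix (Fin n) (Fin n) k) - 1) *
        ((g⁻¹ : GL (Fin n) k) : Matrix (Fin n) (Fin n) k) := by
    have h1 : (g : Matrix (Fin n) (Fin n) k) * ((g⁻¹ : GL (Fin n) k) : Matrix (Fin n) (Fin n) k) = 1 :=
      Units.mul_inv g
    rw [mul_sub, sub_mul, mul_one, h1, Units.val_mul, Units.val_mul]
    abel
  rw [e, Matrix.add_apply, add_eq_left, Matrix.mul_apply]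
  refine Finset.sum_eq_zero fun b _ => ?_
  rw [Matrix.mul_apply, Finset.sum_mul]
  refine Finset.sum_eq_zero fun a _ => ?_
  by_cases hab : (a : ℕ) < m ∧ m ≤ (b : ℕ)
  · rcases not_and_or.1 hij with h | h
    · rw [hg i a (not_lt.1 h) hab.1]; simp
    · rw [(parabolic k n m).inv_mem hg b j hab.2 (not_le.1 h)]; simp
  · rw [Matrix.sub_apply, mem_patternGroup.1 hu a b hab]; simp

/-- Cuspidal representations are killed by the norms of the unipotent radicals. -/
theorem IsCuspidal.cuspSum {V : Type u} [AddCommGroup V] [Module R V]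
    {ρ : Representation R (GL (Fin n) k) V} (h : IsCuspidal ρ) : CuspSum ρ := by
  intro m h1 h2 v
  have := Fintype.ofFinite (radGroup k n m)
  let E : V →ₗ[R] V := ∑ u : radGroup k n m, ρ u
  have hEu : ∀ u ∈ radGroup k n m, ∀ w, ρ u (E w) = E w := by
    intro u hu w
    simp only [E, LinearMap.sum_apply, map_sum, rep_apply_apply]
    exact Fintype.sum_equiv (Equiv.mulLeft (⟨u, hu⟩ : radGroup k n m)) _ _ fun _ => rfl
  have hEg : ∀ g ∈ parabolic k n m, ∀ w, ρ g (E w) = E (ρ g w) := by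
    intro g hg w
    simp only [E, LinearMap.sum_apply, map_sum, rep_apply_apply]
    refine Fintype.sum_bijective (fun u : radGroup k n m =>
      (⟨g * u * g⁻¹, conj_mem_radGroup hg u.2⟩ : radGroup k n m)) ?_ _ _ fun u => by simp
    refine Function.Injective.bijective_of_finite fun a b hab => Subtype.ext ?_
    simpa using congrArg Subtype.val hab
  -- The parabolic normalizes its unipotent radical, so it acts on the image of the norm `E`, with
  -- trivial action of the radical.
  let τ : Representation R (parabolic k n m) (LinearMap.range E) :=
    { toFun := fun g => (ρ g).restrict fun x hx => by
        obtain ⟨w, rfl⟩ := hx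
        exact ⟨ρ g w, (hEg g g.2 w).symm⟩
      map_one' := by ext; simp
      map_mul' := fun a b => by ext; simp }
  -- The homomorphism that corresponds to `E` under Frobenius reciprocity: its value at `1` is `E`,
  -- and cuspidality makes it zero.
  let Φ : ρ.IntertwiningMap (Representation.coind (parabolic k n m).subtype τ) :=
    { toFun := fun w => ⟨fun g => ⟨E (ρ g w), ρ g w, rfl⟩, fun g c => Subtype.ext (by
        change E (ρ (g * c) w) = ρ g (E (ρ c w))
        rw [hEg g g.2, rep_apply_apply])⟩
      map_add' := fun a b => Subtype.ext (funext fun g => Subtype.ext (by simp))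
      map_smul' := fun a b => Subtype.ext (funext fun g => Subtype.ext (by simp))
      isIntertwining' := fun g => LinearMap.ext fun w => Subtype.ext (funext fun c =>
        Subtype.ext (by
          change E (ρ c (ρ g w)) = E (ρ (c * g) w)
          rw [rep_apply_apply])) }
  have hΦ := h m h1 h2 (LinearMap.range E) τ (fun x hx => by
    ext ⟨w, w', rfl⟩
    exact hEu x hx w') Φ
  have h3 : E (ρ 1 v) = 0 := by
    have := congrArg (fun Ψ : ρ.IntertwiningMap
      (Representation.coind (parabolic k n m).subtype τ) => ((Ψ v).1 1 : V)) hΦ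
    exact this
  rw [finsum_eq_sum_of_fintype]
  simpa [E] using h3

/-- Every square matrix is equivalent to a diagonal matrix whose nonzero entries come first. -/
theorem exists_mul_mul_eq_diagonal (M : Matrix (Fin n) (Fin n) k) :
    ∃ (A B : GL (Fin n) k) (D : Fin n → k) (r : ℕ), (A : Matrix (Fin n) (Fin n) k) * M * B =
      Matrix.diagonal D ∧ ∀ i, D i ≠ 0 ↔ (i : ℕ) < r := by
  classical
  obtain ⟨L, L', D, h⟩ := Matrix.Pivot.exists_list_transvec_mul_mul_list_transvec_eq_diagonal M
  have hdet : ∀ L : List (Matrix.TransvectionStruct (Fin n) k),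
      IsUnit (L.map Matrix.TransvectionStruct.toMatrix).prod.det := fun L => by
    rw [Matrix.TransvectionStruct.det_toMatrix_prod]; exact isUnit_one
  let A := Matrix.GeneralLinearGroup.mk'' _ (hdet L)
  let B := Matrix.GeneralLinearGroup.mk'' _ (hdet L')
  let r := Fintype.card {i // D i ≠ 0}
  have hr : r ≤ n := (Fintype.card_subtype_le fun i : Fin n => D i ≠ 0).trans (by simp)
  have hcard : Fintype.card {i : Fin n // (i : ℕ) < r} = Fintype.card {i // D i ≠ 0} := by
    rw [Fintype.card_subtype]
    rw [Fin.card_filter_val_lt, min_eq_right hr]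
  -- A permutation that brings the nonzero diagonal entries to the first `r` places.
  let e := (Fintype.equivOfCardEq hcard).extendSubtype
  have he : ∀ i, D (e i) ≠ 0 ↔ (i : ℕ) < r := fun i => by
    constructor
    · intro h
      by_contra hc
      exact (Fintype.equivOfCardEq hcard).extendSubtype_not_mem i hc h
    · exact (Fintype.equivOfCardEq hcard).extendSubtype_mem i
  let Pe : GL (Fin n) k := Matrix.GeneralLinearGroup.mk'' (e.toPEquiv.toMatrix) (by
    rw [← Matrix.isUnit_iff_isUnit_det]
    refine IsUnit.of_mul_eq_one (e.symm.toPEquiv.toMatrix) ?_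
    rw [← PEquiv.toMatrix_trans, ← Equiv.toPEquiv_trans]; simp)
  let Pe' : GL (Fin n) k := Matrix.GeneralLinearGroup.mk'' (e.symm.toPEquiv.toMatrix) (by
    rw [← Matrix.isUnit_iff_isUnit_det]
    refine IsUnit.of_mul_eq_one (e.toPEquiv.toMatrix) ?_
    rw [← PEquiv.toMatrix_trans, ← Equiv.toPEquiv_trans]; simp)
  refine ⟨Pe * A, B * Pe', D ∘ e, r, ?_, he⟩
  have h' : (A : Matrix (Fin n) (Fin n) k) * M * B = Matrix.diagonal D := h
  calc ((Pe * A : GL (Fin n) k) : Matrix (Fin n) (Fin n) k) * M * ((B * Pe' : GL (Fin n) k) : _)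
      = (Pe : Matrix (Fin n) (Fin n) k) * ((A : Matrix (Fin n) (Fin n) k) * M * B) * Pe' := by
        simp only [Units.val_mul, Matrix.mul_assoc]
    _ = _ := by
        rw [h']
        change e.toPEquiv.toMatrix * Matrix.diagonal D * e.symm.toPEquiv.toMatrix = _
        rw [PEquiv.toMatrix_toPEquiv_mul, PEquiv.mul_toMatrix_toPEquiv]
        ext i j
        simp [Matrix.diagonal_apply]

/-- In a cuspidal representation, a vector fixed by all `1 + M Y` with `Y M = 0`, where `M` is
a nonzero singular matrix, is zero. -/
theorem CuspSum.eq_zero_of_singular (h : CuspSum ρ) {p : ℕ} [Fact p.Prime] [CharP k p]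
    (hp : IsUnit (p : R)) {M : Matrix (Fin n) (Fin n) k} (hM : M ≠ 0) (hdet : M.det = 0) {v : V}
    (hv : ∀ (Y : Matrix (Fin n) (Fin n) k) (u : GL (Fin n) k), Y * M = 0 →
      (u : Matrix (Fin n) (Fin n) k) = 1 + M * Y → ρ u v = v) : v = 0 := by
  obtain ⟨A, B, D, r, hABD, hD⟩ := exists_mul_mul_eq_diagonal M
  have hM' : M = ((A⁻¹ : GL (Fin n) k) : Matrix (Fin n) (Fin n) k) * Matrix.diagonal D *
      ((B⁻¹ : GL (Fin n) k) : Matrix (Fin n) (Fin n) k) := by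
    rw [← hABD]
    have h1 : ((A⁻¹ : GL (Fin n) k) : Matrix (Fin n) (Fin n) k) * A = 1 := Units.inv_mul A
    have h2 : (B : Matrix (Fin n) (Fin n) k) * ((B⁻¹ : GL (Fin n) k) : Matrix (Fin n) (Fin n) k) = 1 :=
      Units.mul_inv B
    calc M = (((A⁻¹ : GL (Fin n) k) : Matrix (Fin n) (Fin n) k) * A) * M * (B *
        ((B⁻¹ : GL (Fin n) k) : Matrix (Fin n) (Fin n) k)) := by rw [h1, h2, one_mul, mul_one]
      _ = _ := by simp only [Matrix.mul_assoc]
  have hr1 : 1 ≤ r := by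
    by_contra hc
    refine hM ?_
    have hD0 : D = 0 := funext fun i => by
      by_contra h; exact absurd ((hD i).1 h) (by omega)
    rw [hM', hD0]; simp
  have hr2 : r < n := by
    by_contra hc
    have : (Matrix.diagonal D).det = 0 := by
      rw [← hABD, Matrix.det_mul, Matrix.det_mul, hdet]; simp
    rw [Matrix.det_diagonal] at this
    exact Finset.prod_ne_zero_iff.2 (fun i _ => (hD i).2 (by omega)) this
  -- In coordinates where `M` is diagonal of rank `r`, with `0 < r < n`, the elements `1 + M Y` with
  -- `Y M = 0` contain the whole unipotent radical of `P_r`.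
  have hAv : ρ A v = 0 := by
    refine h.eq_zero_of_fixed hp hr1 hr2 fun u hu => ?_
    set N := (u : Matrix (Fin n) (Fin n) k) - 1 with hN
    have hN0 : ∀ i j : Fin n, ¬ ((i : ℕ) < r ∧ r ≤ (j : ℕ)) → N i j = 0 := fun i j hij => by
      rw [hN, Matrix.sub_apply, mem_patternGroup.1 hu i j hij, sub_self]
    have hND : N * Matrix.diagonal D = 0 := by
      ext i j
      rw [Matrix.mul_diagonal]
      by_cases hj : (j : ℕ) < r
      · rw [hN0 i j (by omega)]; simp
      · rw [not_not.1 (fun h => hj ((hD j).1 h))]; simp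
    have hDN : Matrix.diagonal D * (Matrix.diagonal (fun i => (D i)⁻¹) * N) = N := by
      ext i j
      rw [Matrix.diagonal_mul, Matrix.diagonal_mul]
      by_cases hi : (i : ℕ) < r
      · rw [mul_inv_cancel_left₀ ((hD i).2 hi)]
      · rw [hN0 i j (by omega)]; simp
    -- With `u = 1 + N`, the matrix `Y = B D⁻¹ N A` solves `M Y = A⁻¹ N A`, and `Y M = 0` because `N
    -- D = 0`. The entries of `D⁻¹` beyond place `r` are `0⁻¹ = 0`, where `N` has zero rows anyway.
    have key := hv ((B : Matrix (Fin n) (Fin n) k) *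
      (Matrix.diagonal (fun i => (D i)⁻¹) * N) * A) (A⁻¹ * u * A) ?_ ?_
    · rw [rep_apply_apply, show u * A = A * (A⁻¹ * u * A) by group, ← rep_apply_apply, key]
    · have h1 : (A : Matrix (Fin n) (Fin n) k) * ((A⁻¹ : GL (Fin n) k) : Matrix (Fin n) (Fin n) k)
        = 1 := Units.mul_inv A
      calc _ = (B : Matrix (Fin n) (Fin n) k) * (Matrix.diagonal (fun i => (D i)⁻¹) * (N *
            (((A : Matrix (Fin n) (Fin n) k) * ((A⁻¹ : GL (Fin n) k) : Matrix (Fin n) (Fin n) k)) *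
            Matrix.diagonal D))) * ((B⁻¹ : GL (Fin n) k) : Matrix (Fin n) (Fin n) k) := by
            rw [hM']; simp only [Matrix.mul_assoc]
        _ = 0 := by rw [h1, one_mul, hND]; simp
    · have h1 : ((A⁻¹ : GL (Fin n) k) : Matrix (Fin n) (Fin n) k) * A = 1 := Units.inv_mul A
      have h2 : ((B⁻¹ : GL (Fin n) k) : Matrix (Fin n) (Fin n) k) * B = 1 := Units.inv_mul B
      have h3 : M * ((B : Matrix (Fin n) (Fin n) k) *
          (Matrix.diagonal (fun i => (D i)⁻¹) * N) * A) =
          ((A⁻¹ : GL (Fin n) k) : Matrix (Fin n) (Fin n) k) * N * A := by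
        calc _ = ((A⁻¹ : GL (Fin n) k) : Matrix (Fin n) (Fin n) k) * (Matrix.diagonal D *
              (((B⁻¹ : GL (Fin n) k) : Matrix (Fin n) (Fin n) k) * B) *
              (Matrix.diagonal (fun i => (D i)⁻¹) * N)) * A := by
              rw [hM']; simp only [Matrix.mul_assoc]
          _ = _ := by rw [h2, mul_one, hDN]
      rw [h3, hN, mul_sub, sub_mul, mul_one, h1, Units.val_mul, Units.val_mul]
      abel
  have := congrArg (ρ A⁻¹) hAv
  rw [rep_apply_apply, inv_mul_cancel, map_one, map_zero] at this
  exact this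

end Cuspidality

/-! ## The lift as a compactly induced representation -/

section LocalField

open Filter Topology ValuativeRel

variable {n : ℕ} {K : Type*} [Field K] [ValuativeRel K] [TopologicalSpace K]
  [IsNonarchimedeanLocalField K] {ϖ : Kˣ}

theorem mem_integer_iff {x : K} : x ∈ 𝒪[K] ↔ valuation K x ≤ 1 := Iff.rfl

theorem residue_eq_zero_iff {x : 𝒪[K]} :
    IsLocalRing.residue 𝒪[K] x = 0 ↔ valuation K (x : K) < 1 := by
  rw [IsLocalRing.residue_eq_zero_iff, IsLocalRing.mem_maximalIdeal, mem_nonunits_iff,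
    (Valuation.integer.integers (valuation K)).isUnit_iff_valuation_eq_one]
  exact ⟨fun h => lt_of_le_of_ne x.2 h, fun h => h.ne⟩

theorem IsUniformizer.valuation_lt_one (h : IsUniformizer ϖ) : valuation K (ϖ : K) < 1 := by
  obtain ⟨x, hx, hxe⟩ := h
  rw [← hxe, ← residue_eq_zero_iff, IsLocalRing.residue_eq_zero_iff]
  exact hx.not_isUnit

theorem IsUniformizer.exists_eq_zpow_mul (h : IsUniformizer ϖ) (z : Kˣ) :
    ∃ (m : ℤ) (u : 𝒪[K]ˣ), z = ϖ ^ m * Units.map (𝒪[K]).subtype.toMonoidHom u := by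
  obtain ⟨x, hx, hxe⟩ := h
  have key : ∀ z : Kˣ, valuation K (z : K) ≤ 1 →
      ∃ (m : ℤ) (u : 𝒪[K]ˣ), z = ϖ ^ m * Units.map (𝒪[K]).subtype.toMonoidHom u := by
    intro z hz
    obtain ⟨m, u, hu⟩ := IsDiscreteValuationRing.eq_unit_mul_pow_irreducible
      (x := (⟨z, hz⟩ : 𝒪[K])) (by simp [Subtype.ext_iff]) hx
    refine ⟨m, u, Units.ext ?_⟩
    have := congrArg Subtype.val hu
    simpa [hxe, mul_comm] using this
  rcases le_total (valuation K (z : K)) 1 with hz | hz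
  · exact key z hz
  · obtain ⟨m, u, hu⟩ := key z⁻¹ (by simpa using inv_le_one_of_one_le₀ hz)
    refine ⟨-m, u⁻¹, ?_⟩
    rw [← inv_inv z, hu, mul_inv, zpow_neg, map_inv]

theorem exists_gl_of_residue (X : Matrix (Fin n) (Fin n) 𝒪[K])
    (h : (X.map (IsLocalRing.residue 𝒪[K])).det ≠ 0) :
    ∃ x : GL (Fin n) 𝒪[K], (x : Matrix (Fin n) (Fin n) 𝒪[K]) = X := by
  have hu : IsUnit X.det := by
    by_contra hc
    rw [← RingHom.mapMatrix_apply, ← RingHom.map_det] at h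
    exact h ((IsLocalRing.residue_eq_zero_iff _).2 hc)
  exact ⟨X.nonsingInvUnit hu, rfl⟩

theorem glRed_surjective : Function.Surjective (glRed n K) := fun g => by
  have hs : Function.Surjective (IsLocalRing.residue 𝒪[K]) := IsLocalRing.residue_surjective
  choose s hs using hs
  have h : (Matrix.of fun i j => s (g i j)).map (IsLocalRing.residue 𝒪[K]) =
      (g : Matrix (Fin n) (Fin n) 𝓀[K]) := by ext i j; simp [hs]
  obtain ⟨x, hx⟩ := exists_gl_of_residue (Matrix.of fun i j => s (g i j)) (by
    rw [h]; exact (Matrix.isUnit_iff_isUnit_det _).1 g.isUnit |>.ne_zero)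
  refine ⟨x, Units.ext ?_⟩
  rw [← h, ← hx]
  rfl

theorem glInt_injective : Function.Injective (glInt n K) := fun x y h => by
  ext i j
  exact congrArg (fun g : GL (Fin n) K => g i j) h

theorem scalar_mul_comm (z : Kˣ) (g : GL (Fin n) K) :
    Matrix.GeneralLinearGroup.scalar (Fin n) z * g = g * Matrix.GeneralLinearGroup.scalar (Fin n) z := by
  ext i j
  simp [Matrix.GeneralLinearGroup.scalar, mul_comm]

/-- The parametrization `(m, x) ↦ ϖ ^ m x` of `K^* GL_n(𝒪)`. -/
def glCenterInt (n : ℕ) (ϖ : Kˣ) : Multiplicative ℤ × GL (Fin n) 𝒪[K] →* GL (Fin n) K :=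
  MonoidHom.noncommCoprod
    ((Matrix.GeneralLinearGroup.scalar (Fin n)).comp (zpowersHom Kˣ ϖ)) (glInt n K)
    (fun _ _ => scalar_mul_comm _ _)

theorem glCenterInt_apply (m : ℤ) (x : GL (Fin n) 𝒪[K]) :
    glCenterInt n ϖ (Multiplicative.ofAdd m, x) =
      Matrix.GeneralLinearGroup.scalar (Fin n) (ϖ ^ m) * glInt n K x := rfl

theorem scalar_apply_self (z : Kˣ) (i : Fin n) :
    Matrix.GeneralLinearGroup.scalar (Fin n) z i i = (z : K) := by
  simp [Matrix.GeneralLinearGroup.scalar]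

theorem IsUniformizer.zpow_mem (h : IsUniformizer ϖ) {m : ℤ} :
    (ϖ : K) ^ m ∈ 𝒪[K] ↔ 0 ≤ m := by
  rw [mem_integer_iff, map_zpow₀]
  refine ⟨fun hm => ?_, fun hm => ?_⟩
  · by_contra hc
    have h0 : 0 < valuation K (ϖ : K) := (Valuation.pos_iff _).2 ϖ.ne_zero
    exact not_lt.2 hm (one_lt_zpow_of_neg₀ h0 h.valuation_lt_one (not_le.1 hc))
  · lift m to ℕ using hm
    rw [zpow_natCast]
    exact pow_le_one' h.valuation_lt_one.le m

/-- If a scalar `ϖ ^ m` lies in `GL_n(𝒪)`, it and its inverse are integral, so `m = 0`. The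
condition `1 ≤ n` provides a diagonal entry to look at. -/
theorem IsUniformizer.glCenterInt_injective (h : IsUniformizer ϖ) (hn : 1 ≤ n) :
    Function.Injective (glCenterInt n ϖ) := by
  have h1 : ∀ (m : ℤ) (x : GL (Fin n) 𝒪[K]),
      Matrix.GeneralLinearGroup.scalar (Fin n) (ϖ ^ m) = glInt n K x → 0 ≤ m := by
    intro m x hx
    rw [← h.zpow_mem, ← Units.val_zpow_eq_zpow_val, ← scalar_apply_self (ϖ ^ m) ⟨0, hn⟩, hx]
    exact (x ⟨0, hn⟩ ⟨0, hn⟩).2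
  rw [injective_iff_map_eq_one]
  rintro ⟨m, x⟩ hx
  obtain ⟨m, rfl⟩ := Multiplicative.ofAdd.surjective m
  rw [glCenterInt_apply] at hx
  have hm : m = 0 := by
    refine le_antisymm ?_ (h1 m x⁻¹ (by rw [map_inv, eq_inv_of_mul_eq_one_left hx]))
    have := h1 (-m) x (by rw [zpow_neg, map_inv, eq_inv_of_mul_eq_one_right hx])
    omega
  subst hm
  rw [zpow_zero, map_one, one_mul] at hx
  exact Prod.ext rfl (glInt_injective (hx.trans (map_one _).symm))

/-- The subgroup `K^* GL_n(𝒪)`. -/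
def centerInt (n : ℕ) (ϖ : Kˣ) : Subgroup (GL (Fin n) K) := (glCenterInt n ϖ).range

theorem mem_centerInt_of (m : ℤ) (x : GL (Fin n) 𝒪[K]) :
    Matrix.GeneralLinearGroup.scalar (Fin n) (ϖ ^ m) * glInt n K x ∈ centerInt n ϖ :=
  ⟨_, glCenterInt_apply m x⟩

theorem mem_centerInt {g : GL (Fin n) K} : g ∈ centerInt n ϖ ↔
    ∃ (m : ℤ) (x : GL (Fin n) 𝒪[K]),
      g = Matrix.GeneralLinearGroup.scalar (Fin n) (ϖ ^ m) * glInt n K x := by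
  refine ⟨?_, ?_⟩
  · rintro ⟨⟨m, x⟩, rfl⟩
    exact ⟨m.toAdd, x, glCenterInt_apply _ _⟩
  · rintro ⟨m, x, rfl⟩
    exact mem_centerInt_of m x

theorem glInt_mem_centerInt (x : GL (Fin n) 𝒪[K]) : glInt n K x ∈ centerInt n ϖ := by
  simpa using mem_centerInt_of (ϖ := ϖ) 0 x

theorem IsUniformizer.scalar_mem_centerInt (h : IsUniformizer ϖ) (z : Kˣ) :
    Matrix.GeneralLinearGroup.scalar (Fin n) z ∈ centerInt n ϖ := by
  obtain ⟨m, u, rfl⟩ := h.exists_eq_zpow_mul z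
  rw [mem_centerInt]
  refine ⟨m, Matrix.GeneralLinearGroup.scalar (Fin n) u, ?_⟩
  rw [map_mul]
  congr 1
  ext i j
  by_cases h : i = j <;> simp [glInt, Matrix.GeneralLinearGroup.scalar, h]

/-- The projection of `K^* GL_n(𝒪) = ϖ^ℤ × GL_n(𝒪)` to `GL_n` of the residue field. -/
def centerIntRed (h : IsUniformizer ϖ) (hn : 1 ≤ n) : centerInt n ϖ →* GL (Fin n) 𝓀[K] :=
  ((glRed n K).comp (MonoidHom.snd _ _)).comp
    (MonoidHom.ofInjective (h.glCenterInt_injective hn)).symm.toMonoidHom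

theorem centerIntRed_mk (h : IsUniformizer ϖ) (hn : 1 ≤ n) (m : ℤ) (x : GL (Fin n) 𝒪[K]) (hx) :
    centerIntRed h hn
      ⟨Matrix.GeneralLinearGroup.scalar (Fin n) (ϖ ^ m) * glInt n K x, hx⟩ = glRed n K x := by
  have e : (⟨Matrix.GeneralLinearGroup.scalar (Fin n) (ϖ ^ m) * glInt n K x, hx⟩ : centerInt n ϖ) =
      MonoidHom.ofInjective (h.glCenterInt_injective hn) (Multiplicative.ofAdd m, x) :=
    Subtype.ext (glCenterInt_apply m x).symm
  rw [e]
  change glRed n K ((MonoidHom.ofInjective (h.glCenterInt_injective hn)).symm _).2 = _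
  rw [MulEquiv.symm_apply_apply]

theorem centerIntRed_glInt (h : IsUniformizer ϖ) (hn : 1 ≤ n) (x : GL (Fin n) 𝒪[K]) (hx) :
    centerIntRed h hn ⟨glInt n K x, hx⟩ = glRed n K x := by
  have := centerIntRed_mk h hn 0 x (mem_centerInt_of 0 x)
  simpa using this

theorem centerIntRed_surjective (h : IsUniformizer ϖ) (hn : 1 ≤ n) :
    Function.Surjective (centerIntRed h hn) := fun g => by
  obtain ⟨x, rfl⟩ := glRed_surjective g
  exact ⟨⟨_, glInt_mem_centerInt x⟩, centerIntRed_glInt h hn x _⟩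

/-! ### Congruence subgroups -/

/-- The principal congruence subgroup of level `𝔪 ^ m`. -/
def congrSubgroup (n : ℕ) (K : Type*) [Field K] [ValuativeRel K] (m : ℕ) :
    Subgroup (GL (Fin n) 𝒪[K]) :=
  (Matrix.GeneralLinearGroup.map (n := Fin n) (Ideal.Quotient.mk (𝓂[K] ^ m))).ker

theorem mem_congrSubgroup {m : ℕ} {x : GL (Fin n) 𝒪[K]} : x ∈ congrSubgroup n K m ↔
    ∀ i j, x i j - (1 : Matrix (Fin n) (Fin n) 𝒪[K]) i j ∈ 𝓂[K] ^ m := by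
  rw [congrSubgroup, MonoidHom.mem_ker, Units.ext_iff, ← Matrix.ext_iff]
  refine forall₂_congr fun i j => ?_
  rw [← Ideal.Quotient.eq]
  have : (1 : Matrix (Fin n) (Fin n) (𝒪[K] ⧸ 𝓂[K] ^ m)) i j =
      Ideal.Quotient.mk (𝓂[K] ^ m) ((1 : Matrix (Fin n) (Fin n) 𝒪[K]) i j) := by
    simp only [Matrix.one_apply]; split_ifs <;> simp
  rw [Units.val_one, this]
  rfl

theorem congrSubgroup_one : congrSubgroup n K 1 = (glRed n K).ker := by
  ext x
  rw [mem_congrSubgroup, MonoidHom.mem_ker, Units.ext_iff, ← Matrix.ext_iff, pow_one]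
  refine forall₂_congr fun i j => ?_
  rw [← IsLocalRing.residue_eq_zero_iff, map_sub, sub_eq_zero]
  have : (1 : Matrix (Fin n) (Fin n) 𝓀[K]) i j =
      IsLocalRing.residue 𝒪[K] ((1 : Matrix (Fin n) (Fin n) 𝒪[K]) i j) := by
    simp only [Matrix.one_apply]; split_ifs <;> simp
  rw [Units.val_one, this]
  rfl

theorem setOf_valuation_lt_mem_nhds {γ : ValueGroupWithZero K} (hγ : γ ≠ 0) :
    {x : K | valuation K x < γ} ∈ 𝓝 0 :=
  (IsValuativeTopology.hasBasis_nhds_zero' K).mem_of_mem hγ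

/-- A matrix whose entries differ from those of the identity by valuation `< 1` is integral with
reduction `1`, so its determinant is a unit. -/
theorem glInt_congrSubgroup_one_mem_nhds :
    ((congrSubgroup n K 1).map (glInt n K) : Set (GL (Fin n) K)) ∈ 𝓝 1 := by
  have h1 : ∀ i j : Fin n, ∀ᶠ g : GL (Fin n) K in 𝓝 1,
      valuation K (g i j - (1 : Matrix (Fin n) (Fin n) K) i j) < 1 := fun i j => by
    have hc : Continuous fun g : GL (Fin n) K => g i j - (1 : Matrix (Fin n) (Fin n) K) i j := by
      refine Continuous.sub ?_ continuous_const
      exact (Units.continuous_val).matrix_elem i j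
    have := hc.tendsto 1
    simp only [Units.val_one, sub_self] at this
    exact this (setOf_valuation_lt_mem_nhds one_ne_zero)
  filter_upwards [eventually_all.2 fun i => eventually_all.2 (h1 i)] with g hg
  have hint : ∀ i j, g i j ∈ 𝒪[K] := fun i j => by
    have h2 : (1 : Matrix (Fin n) (Fin n) K) i j ∈ 𝒪[K] := by
      rw [Matrix.one_apply]; split_ifs
      exacts [one_mem _, zero_mem _]
    have := add_mem (show _ ∈ 𝒪[K] from (hg i j).le) h2
    rwa [sub_add_cancel] at this
  let X : Matrix (Fin n) (Fin n) 𝒪[K] := Matrix.of fun i j => ⟨g i j, hint i j⟩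
  have hX : ∀ i j, X i j - (1 : Matrix (Fin n) (Fin n) 𝒪[K]) i j ∈ 𝓂[K] := fun i j => by
    rw [← IsLocalRing.residue_eq_zero_iff, residue_eq_zero_iff]
    convert hg i j
    simp only [X, Matrix.of_apply, AddSubgroupClass.coe_sub, Matrix.one_apply]
    split_ifs <;> rfl
  obtain ⟨x, hx⟩ := exists_gl_of_residue X (by
    have : X.map (IsLocalRing.residue 𝒪[K]) = 1 := by
      ext i j
      have := (IsLocalRing.residue_eq_zero_iff _).2 (hX i j)
      rw [map_sub, sub_eq_zero] at this
      rw [Matrix.map_apply, this]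
      simp only [Matrix.one_apply]; split_ifs <;> simp
    rw [this, Matrix.det_one]
    exact one_ne_zero)
  refine ⟨x, mem_congrSubgroup.2 fun i j => ?_, ?_⟩
  · rw [hx, pow_one]; exact hX i j
  · ext i j
    change ((x i j : 𝒪[K]) : K) = _
    rw [hx]
    rfl

theorem isOpen_centerInt : IsOpen (centerInt n ϖ : Set (GL (Fin n) K)) := by
  refine Subgroup.isOpen_of_mem_nhds _ (mem_of_superset glInt_congrSubgroup_one_mem_nhds ?_)
  rintro _ ⟨x, -, rfl⟩
  exact glInt_mem_centerInt x

/-- `GL_n(K)` carries the topology of a group of units, so the entries of both `x` and `x⁻¹` must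
converge. The second convergence follows from the first, as the filter has a basis of subgroups. -/
theorem exists_congrSubgroup_subset {W : Set (GL (Fin n) K)} (hW : W ∈ 𝓝 1) :
    ∃ m, ∀ x ∈ congrSubgroup n K m, glInt n K x ∈ W := by
  obtain ⟨x₀, hx₀⟩ := IsDiscreteValuationRing.exists_irreducible 𝒪[K]
  have hx₁ : valuation K (x₀ : K) < 1 := by
    rw [← residue_eq_zero_iff, IsLocalRing.residue_eq_zero_iff]
    exact hx₀.not_isUnit
  have hanti : Antitone fun m => congrSubgroup n K m := fun m m' hm x hx =>
    mem_congrSubgroup.2 fun i j => Ideal.pow_le_pow_right hm (mem_congrSubgroup.1 hx i j)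
  let 𝓕 : Filter (GL (Fin n) 𝒪[K]) := ⨅ m, 𝓟 (congrSubgroup n K m)
  have hb : 𝓕.HasBasis (fun _ => True) fun m => (congrSubgroup n K m : Set (GL (Fin n) 𝒪[K])) :=
    hasBasis_iInf_principal (directed_of_isDirected_le fun m m' h => hanti h)
  have hent : ∀ i j, Tendsto (fun x : GL (Fin n) 𝒪[K] =>
      ((x i j : 𝒪[K]) : K)) 𝓕 (𝓝 ((1 : Matrix (Fin n) (Fin n) K) i j)) := fun i j => by
    rw [← tendsto_sub_nhds_zero_iff]
    refine ((IsValuativeTopology.hasBasis_nhds_zero' K).tendsto_right_iff).2 fun γ hγ => ?_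
    obtain ⟨m, hm⟩ : ∃ m : ℕ, valuation K (x₀ : K) ^ m < γ := exists_pow_lt₀ hx₁ (Units.mk0 γ hγ)
    refine hb.mem_iff.2 ⟨m, trivial, fun x hx => ?_⟩
    have h1 := mem_congrSubgroup.1 hx i j
    rw [hx₀.maximalIdeal_eq, Ideal.span_singleton_pow, Ideal.mem_span_singleton'] at h1
    obtain ⟨a, ha⟩ := h1
    have h2 : ((x i j : 𝒪[K]) : K) - (1 : Matrix (Fin n) (Fin n) K) i j = a * (x₀ : K) ^ m := by
      have := congrArg Subtype.val ha
      rw [AddSubgroupClass.coe_sub] at this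
      rw [show (1 : Matrix (Fin n) (Fin n) K) i j =
        ((1 : Matrix (Fin n) (Fin n) 𝒪[K]) i j : 𝒪[K]) by
          simp only [Matrix.one_apply]; split_ifs <;> rfl, ← this]
      simp
    change valuation K _ < γ
    rw [h2, map_mul, map_pow]
    exact lt_of_le_of_lt (mul_le_of_le_one_left zero_le a.2) hm
  have hval : Tendsto (fun x : GL (Fin n) 𝒪[K] => ((glInt n K x : GL (Fin n) K) :
      Matrix (Fin n) (Fin n) K)) 𝓕 (𝓝 1) :=
    tendsto_pi_nhds.2 fun i => tendsto_pi_nhds.2 fun j => hent i j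
  have hinv : Tendsto (fun x : GL (Fin n) 𝒪[K] => x⁻¹) 𝓕 𝓕 :=
    hb.tendsto_iff hb |>.2 fun m _ => ⟨m, trivial, fun x hx => inv_mem hx⟩
  have ht : Tendsto (glInt n K) 𝓕 (𝓝 1) := by
    rw [Units.isInducing_embedProduct.nhds_eq_comap, tendsto_comap_iff]
    refine Tendsto.prodMk_nhds hval ?_
    refine (MulOpposite.continuous_op.tendsto _).comp ?_
    have := hval.comp hinv
    simpa [Function.comp_def] using this
  obtain ⟨m, -, hm⟩ := hb.mem_iff.1 (ht hW)
  exact ⟨m, hm⟩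

end LocalField

section LocalFieldLift

open Filter Topology ValuativeRel

variable {n : ℕ} {K : Type*} [Field K] [ValuativeRel K] [TopologicalSpace K]
  [IsNonarchimedeanLocalField K] {ϖ : Kˣ} {R V : Type*} [CommRing R] [AddCommGroup V] [Module R V]
  {ρ : Representation R (GL (Fin n) 𝓀[K]) V}

theorem lift_apply (g x : GL (Fin n) K) (f : liftSpace ϖ ρ) : (lift ϖ ρ g f).1 x = f.1 (x * g) :=
  rfl

theorem liftSpace_apply_mul (h : IsUniformizer ϖ) (hn : 1 ≤ n) (f : liftSpace ϖ ρ)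
    (y : centerInt n ϖ) (g : GL (Fin n) K) :
    f.1 (y * g) = ρ (centerIntRed h hn y) (f.1 g) := by
  obtain ⟨y, hy⟩ := y
  obtain ⟨m, x, rfl⟩ := mem_centerInt.1 hy
  rw [centerIntRed_mk]
  exact f.2.1 m x g

open Classical in
/-- Extension by zero from `K^* GL_n(𝒪)`. -/
def extendZero (h : IsUniformizer ϖ) (hn : 1 ≤ n) (ρ : Representation R (GL (Fin n) 𝓀[K]) V) :
    V →ₗ[R] liftSpace ϖ ρ where
  toFun v := ⟨fun g => if hg : g ∈ centerInt n ϖ then ρ (centerIntRed h hn ⟨g, hg⟩) v else 0, by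
    refine ⟨fun m x g => ?_, ⟨(congrSubgroup n K 1).map (glInt n K), ?_, fun u hu g => ?_⟩,
      ⟨{1}, isCompact_singleton, fun g hg => ?_⟩⟩
    · have hm := mem_centerInt_of (ϖ := ϖ) m x
      beta_reduce
      by_cases hg : g ∈ centerInt n ϖ
      · rw [dif_pos hg, dif_pos (mul_mem hm hg), ← Module.End.mul_apply, ← map_mul,
          ← centerIntRed_mk h hn m x hm, ← map_mul]
        rfl
      · rw [dif_neg hg, dif_neg (fun hc => hg (((centerInt n ϖ).mul_mem_cancel_left hm).1 hc)),
          map_zero]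
    · exact Subgroup.isOpen_of_mem_nhds _ glInt_congrSubgroup_one_mem_nhds
    · obtain ⟨x, hx, rfl⟩ := hu
      have hm := glInt_mem_centerInt (ϖ := ϖ) x
      beta_reduce
      by_cases hg : g ∈ centerInt n ϖ
      · rw [dif_pos hg, dif_pos (mul_mem hg hm)]
        have : (⟨g * glInt n K x, mul_mem hg hm⟩ : centerInt n ϖ) = ⟨g, hg⟩ * ⟨_, hm⟩ := rfl
        rw [congrSubgroup_one] at hx
        rw [this, map_mul, centerIntRed_glInt, MonoidHom.mem_ker.1 hx, mul_one]
      · rw [dif_neg hg, dif_neg (fun hc => hg (((centerInt n ϖ).mul_mem_cancel_right hm).1 hc))]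
    · have hg' : g ∈ centerInt n ϖ := by
        by_contra hc
        exact hg (dif_neg hc)
      obtain ⟨m, x, rfl⟩ := mem_centerInt.1 hg'
      exact ⟨ϖ ^ m, x, 1, rfl, (mul_one _).symm⟩⟩
  map_add' v v' := by
    refine Subtype.ext (funext fun g => ?_)
    by_cases hg : g ∈ centerInt n ϖ
    · simp [hg]
    · simp [hg]
  map_smul' a v := by
    refine Subtype.ext (funext fun g => ?_)
    by_cases hg : g ∈ centerInt n ϖ
    · simp [hg]
    · simp [hg]

theorem extendZero_apply_of_mem (h : IsUniformizer ϖ) (hn : 1 ≤ n) (v : V) (g : centerInt n ϖ) :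
    (extendZero h hn ρ v).1 g = ρ (centerIntRed h hn g) v := dif_pos g.2

theorem extendZero_apply_of_notMem (h : IsUniformizer ϖ) (hn : 1 ≤ n) (v : V) {g : GL (Fin n) K}
    (hg : g ∉ centerInt n ϖ) : (extendZero h hn ρ v).1 g = 0 := dif_neg hg

/-- `K^* GL_n(𝒪)` is open, so a support that is compact modulo it meets finitely many cosets. -/
theorem liftSpace_exists_finite_support (h : IsUniformizer ϖ) (f : liftSpace ϖ ρ) :
    ∃ s : Finset (GL (Fin n) K), ∀ g, f.1 g ≠ 0 → ∃ c ∈ s, g * c⁻¹ ∈ centerInt n ϖ := by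
  obtain ⟨C, hC, hs⟩ := f.2.2.2
  obtain ⟨s, -, hCs⟩ := hC.elim_nhds_subcover (fun c => {g | g * c⁻¹ ∈ centerInt n ϖ})
    fun c _ => (isOpen_centerInt.preimage (continuous_mul_const c⁻¹)).mem_nhds (by simp [one_mem])
  refine ⟨s, fun g hg => ?_⟩
  obtain ⟨z, x, c, hc, rfl⟩ := hs g hg
  obtain ⟨c', hc', hcc⟩ := Set.mem_iUnion₂.1 (hCs hc)
  refine ⟨c', hc', ?_⟩
  rw [mul_assoc]
  exact mul_mem (mul_mem (h.scalar_mem_centerInt z) (glInt_mem_centerInt x)) hcc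

/-- The part of `f` on one coset is a translate of an extension by zero; subtracting it shrinks the
finite set of cosets that support `f`. -/
theorem liftSpace_mem_closure (h : IsUniformizer ϖ) (hn : 1 ≤ n) (f : liftSpace ϖ ρ) :
    f ∈ AddSubgroup.closure {y | ∃ g v, y = lift ϖ ρ g (extendZero h hn ρ v)} := by
  classical
  obtain ⟨s, hs⟩ := liftSpace_exists_finite_support h f
  induction s using Finset.induction_on generalizing f with
  | empty =>
    have : f = 0 := Subtype.ext (funext fun g => by
      by_contra hg
      obtain ⟨c, hc, -⟩ := hs g hg
      exact absurd hc (Finset.notMem_empty c))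
    rw [this]
    exact zero_mem _
  | insert c s hc ih =>
    set f₁ := lift ϖ ρ c⁻¹ (extendZero h hn ρ (f.1 c)) with hf₁
    have h1 : ∀ g, g * c⁻¹ ∈ centerInt n ϖ → f₁.1 g = f.1 g := fun g hg => by
      rw [hf₁, lift_apply, extendZero_apply_of_mem h hn _ ⟨_, hg⟩, ← liftSpace_apply_mul h hn f]
      simp
    have h2 : ∀ g, g * c⁻¹ ∉ centerInt n ϖ → f₁.1 g = 0 := fun g hg =>
      extendZero_apply_of_notMem h hn _ hg
    have h3 : f - f₁ ∈ AddSubgroup.closure {y | ∃ g v, y = lift ϖ ρ g (extendZero h hn ρ v)} := by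
      refine ih (f - f₁) fun g hg => ?_
      have hg' : f.1 g - f₁.1 g ≠ 0 := hg
      by_cases hgc : g * c⁻¹ ∈ centerInt n ϖ
      · exact absurd (sub_eq_zero.2 (h1 g hgc).symm) hg'
      · rw [h2 g hgc, sub_zero] at hg'
        obtain ⟨c', hc', hcc⟩ := hs g hg'
        rcases Finset.mem_insert.1 hc' with rfl | hc'
        · exact absurd hcc hgc
        · exact ⟨c', hc', hcc⟩
    rw [← sub_add_cancel f f₁]
    exact add_mem h3 (AddSubgroup.subset_closure ⟨_, _, rfl⟩)

/-- The lift is the compact induction from `K^* GL_n(𝒪)`. -/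
def liftIndData (h : IsUniformizer ϖ) (hn : 1 ≤ n) (ρ : Representation R (GL (Fin n) 𝓀[K]) V) :
    IndData (centerIntRed h hn) ρ (lift ϖ ρ) where
  ev :=
    { toFun := fun f => f.1 1
      map_add' := fun _ _ => rfl
      map_smul' := fun _ _ => rfl }
  sec := extendZero h hn ρ
  ev_apply y f := by
    change f.1 (1 * y) = _
    rw [one_mul, ← mul_one (y : GL (Fin n) K), liftSpace_apply_mul h hn]
    rfl
  sec_apply y v := by
    refine Subtype.ext (funext fun g => ?_)
    rw [lift_apply]
    by_cases hg : g ∈ centerInt n ϖ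
    · refine (extendZero_apply_of_mem (ρ := ρ) h hn v (⟨g, hg⟩ * y)).trans ?_
      rw [extendZero_apply_of_mem h hn _ ⟨g, hg⟩, map_mul, map_mul]
      rfl
    · rw [extendZero_apply_of_notMem h hn _ hg, extendZero_apply_of_notMem h hn _
        (fun hc => hg (((centerInt n ϖ).mul_mem_cancel_right y.2).1 hc))]
  ev_sec v := by
    change (extendZero h hn ρ v).1 (1 : centerInt n ϖ) = v
    rw [extendZero_apply_of_mem, map_one, map_one]
    rfl
  ev_apply_sec g hg v := by
    change (extendZero h hn ρ v).1 (1 * g) = 0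
    rw [one_mul, extendZero_apply_of_notMem h hn _ hg]
  mem_closure := liftSpace_mem_closure h hn

/-! ### Averaging over the first congruence subgroup -/

/-- In `y ^ p - 1 = (y - 1) (1 + y + ⋯ + y ^ (p - 1))` the second factor reduces to `p = 0` over the
residue field, so each `p`-th power gains one level. -/
theorem pow_mem_congrSubgroup {p : ℕ} [CharP 𝓀[K] p] {x : GL (Fin n) 𝒪[K]}
    (hx : x ∈ congrSubgroup n K 1) (m : ℕ) : x ^ p ^ m ∈ congrSubgroup n K m := by
  have key : ∀ (j : ℕ) (y : GL (Fin n) 𝒪[K]), y ∈ congrSubgroup n K 1 → y ∈ congrSubgroup n K j →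
      y ^ p ∈ congrSubgroup n K (j + 1) := by
    intro j y hy hyj
    have hS : ∀ a b, (∑ i ∈ Finset.range p, (y : Matrix (Fin n) (Fin n) 𝒪[K]) ^ i) a b ∈ 𝓂[K] := by
      have : (∑ i ∈ Finset.range p, (y : Matrix (Fin n) (Fin n) 𝒪[K]) ^ i).map
          (IsLocalRing.residue 𝒪[K]) = 0 := by
        have hy1 : (IsLocalRing.residue 𝒪[K]).mapMatrix (y : Matrix (Fin n) (Fin n) 𝒪[K]) = 1 := by
          rw [congrSubgroup_one, MonoidHom.mem_ker] at hy
          exact congrArg Units.val hy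
        rw [← RingHom.mapMatrix_apply, map_sum, Finset.sum_congr rfl fun i _ => by
          rw [map_pow, hy1, one_pow]]
        rw [Finset.sum_const, Finset.card_range]
        ext a b
        simp
      intro a b
      rw [← IsLocalRing.residue_eq_zero_iff]
      exact congrFun (congrFun this a) b
    refine mem_congrSubgroup.2 fun a b => ?_
    have e : ((y ^ p : GL (Fin n) 𝒪[K]) : Matrix (Fin n) (Fin n) 𝒪[K]) a b -
        (1 : Matrix (Fin n) (Fin n) 𝒪[K]) a b =
        (((y : Matrix (Fin n) (Fin n) 𝒪[K]) - 1) *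
          ∑ i ∈ Finset.range p, (y : Matrix (Fin n) (Fin n) 𝒪[K]) ^ i) a b := by
      rw [mul_geom_sum]; rfl
    rw [e, Matrix.mul_apply, pow_succ]
    exact Ideal.sum_mem _ fun c _ => Ideal.mul_mem_mul (mem_congrSubgroup.1 hyj a c) (hS c b)
  induction m with
  | zero => exact mem_congrSubgroup.2 fun i j => by simp
  | succ m ih =>
    rw [pow_succ, pow_mul]
    exact key m _ (pow_mem hx _) ih

/-- After scaling by a largest entry, `g` becomes an integral matrix `X` with nonzero reduction,
which is singular since `g ∉ K^* GL_n(𝒪)`. In `(1 + X Y) g' = g' (1 + Y X)` with `Y X` reducing to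
zero, the right factor is absorbed by invariance under `K₁` and the left one acts through `ρ`. So `f
g'` is fixed by all `1 + X Y` of this kind, and cuspidality kills it. -/
theorem liftSpace_apply_eq_zero (h : IsUniformizer ϖ) (hn : 1 ≤ n) {p : ℕ} [Fact p.Prime]
    [CharP 𝓀[K] p] (hp : IsUnit (p : R)) (hρ : CuspSum ρ) (f : liftSpace ϖ ρ)
    (hf : ∀ x ∈ congrSubgroup n K 1, ∀ g, f.1 (g * glInt n K x) = f.1 g) {g : GL (Fin n) K}
    (hg : g ∉ centerInt n ϖ) : f.1 g = 0 := by
  have : Nonempty (Fin n) := ⟨⟨0, hn⟩⟩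
  obtain ⟨⟨i₀, j₀⟩, hmax⟩ := Finite.exists_max fun q : Fin n × Fin n => valuation K (g q.1 q.2)
  have hz : g i₀ j₀ ≠ 0 := by
    intro h0
    have : (g : Matrix (Fin n) (Fin n) K) = 0 := by
      ext i j
      have := hmax (i, j)
      rw [h0, map_zero, le_zero_iff, map_eq_zero] at this
      exact this
    exact g.ne_zero this
  set z : Kˣ := Units.mk0 _ hz
  obtain ⟨m, u, hmu⟩ := h.exists_eq_zpow_mul z
  obtain ⟨g', hg'⟩ : ∃ g', g' = Matrix.GeneralLinearGroup.scalar (Fin n) z⁻¹ * g := ⟨_, rfl⟩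
  have hg'e : ∀ i j, g' i j = z⁻¹ * g i j := fun i j => by
    simp [hg', Matrix.GeneralLinearGroup.scalar]
  have hint : ∀ i j, g' i j ∈ 𝒪[K] := fun i j => by
    rw [mem_integer_iff, hg'e, map_mul]
    have h0 : valuation K (g i₀ j₀) ≠ 0 := (map_ne_zero _).2 hz
    have : valuation K ((z⁻¹ : Kˣ) : K) = (valuation K (g i₀ j₀))⁻¹ := by simp [z]
    change valuation K ((z⁻¹ : Kˣ) : K) * _ ≤ 1
    rw [this, mul_comm, ← div_eq_mul_inv]
    exact (div_le_one₀ (zero_lt_iff.2 h0)).2 (hmax (i, j))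
  let X : Matrix (Fin n) (Fin n) 𝒪[K] := Matrix.of fun i j => ⟨g' i j, hint i j⟩
  have hXe : ∀ i j, ((X i j : 𝒪[K]) : K) = g' i j := fun _ _ => rfl
  have hX0 : X.map (IsLocalRing.residue 𝒪[K]) ≠ 0 := by
    intro h0
    have h1 : X i₀ j₀ = 1 := Subtype.ext (by
      rw [hXe, hg'e]; exact inv_mul_cancel₀ hz)
    have h2 := congrFun (congrFun h0 i₀) j₀
    rw [Matrix.map_apply, h1, map_one] at h2
    exact one_ne_zero h2
  have hscal := h.scalar_mem_centerInt (n := n) z⁻¹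
  have hdet : (X.map (IsLocalRing.residue 𝒪[K])).det = 0 := by
    by_contra hd
    obtain ⟨x, hx⟩ := exists_gl_of_residue X hd
    refine hg (((centerInt n ϖ).mul_mem_cancel_left hscal).1 ?_)
    rw [← hg']
    have : g' = glInt n K x := by
      ext i j
      rw [← hXe, ← hx]; rfl
    rw [this]
    exact glInt_mem_centerInt x
  have hfg : f.1 g' = 0 := by
    refine hρ.eq_zero_of_singular hp hX0 hdet fun Ybar ub hY hub => ?_
    obtain ⟨s, hs⟩ := (IsLocalRing.residue_surjective (R := 𝒪[K])).hasRightInverse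
    let Y : Matrix (Fin n) (Fin n) 𝒪[K] := Ybar.map s
    have hYr : (IsLocalRing.residue 𝒪[K]).mapMatrix Y = Ybar := by
      ext i j; simp [Y, hs _]
    have hr : ((1 : Matrix (Fin n) (Fin n) 𝒪[K]) + X * Y).map (IsLocalRing.residue 𝒪[K]) = ub := by
      rw [hub, ← RingHom.mapMatrix_apply, map_add, map_mul, hYr, map_one]; rfl
    have hr' : ((1 : Matrix (Fin n) (Fin n) 𝒪[K]) + Y * X).map (IsLocalRing.residue 𝒪[K]) = 1 := by
      rw [← RingHom.mapMatrix_apply, map_add, map_mul, hYr, map_one, RingHom.mapMatrix_apply, hY,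
        add_zero]
    obtain ⟨a, ha⟩ := exists_gl_of_residue (1 + X * Y) (by
      rw [hr]; exact ((Matrix.isUnit_iff_isUnit_det _).1 ub.isUnit).ne_zero)
    obtain ⟨b, hb⟩ := exists_gl_of_residue (1 + Y * X) (by
      rw [hr', Matrix.det_one]; exact one_ne_zero)
    have hb1 : b ∈ congrSubgroup n K 1 := by
      rw [congrSubgroup_one, MonoidHom.mem_ker]
      refine Units.ext ?_
      rw [Units.val_one, ← hr', ← hb]; rfl
    have ha1 : glRed n K a = ub := by
      refine Units.ext ?_
      rw [← hr, ← ha]; rfl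
    have hab : glInt n K a * g' = g' * glInt n K b := by
      have hXg : (𝒪[K]).subtype.mapMatrix X = (g' : Matrix (Fin n) (Fin n) K) := by
        ext i j; rfl
      refine Units.ext ?_
      rw [Units.val_mul, Units.val_mul, ← hXg]
      change (𝒪[K]).subtype.mapMatrix (a : Matrix (Fin n) (Fin n) 𝒪[K]) * _ =
        _ * (𝒪[K]).subtype.mapMatrix (b : Matrix (Fin n) (Fin n) 𝒪[K])
      rw [← map_mul, ← map_mul, ha, hb]
      congr 1
      noncomm_ring
    have e1 := liftSpace_apply_mul h hn f ⟨_, glInt_mem_centerInt a⟩ g'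
    rw [centerIntRed_glInt, ha1] at e1
    rw [← e1]
    change f.1 (glInt n K a * g') = f.1 g'
    rw [hab, hf b hb1]
  have e2 := liftSpace_apply_mul h hn f ⟨_, hscal⟩⁻¹ g'
  rw [hfg, map_zero] at e2
  rw [← e2, hg']
  simp

/-- `f` is right invariant under a congruence subgroup of some level `m`, so its sum over
representatives of `K₁` modulo level `m`, a finite `p`-group, is `K₁`-invariant. This sum vanishes
outside `K^* GL_n(𝒪)`, and at `1` it is `p ^ a` times the value of `f`. -/
theorem liftIndData_hasAvg (h : IsUniformizer ϖ) (hn : 1 ≤ n) {p : ℕ} [Fact p.Prime]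
    [CharP 𝓀[K] p] (hp : IsUnit (p : R)) (hρ : CuspSum ρ) :
    (liftIndData h hn ρ).HasAvg p := fun f => by
  classical
  obtain ⟨U, hU, hUf⟩ := f.2.2.1
  obtain ⟨m, hm⟩ := exists_congrSubgroup_subset (hU.mem_nhds U.one_mem)
  have : Finite (𝒪[K] ⧸ 𝓂[K]) := inferInstanceAs (Finite 𝓀[K])
  have : Finite (𝒪[K] ⧸ 𝓂[K] ^ m) := Ideal.finite_quotient_pow (IsNoetherian.noetherian _) _
  let red := (Matrix.GeneralLinearGroup.map (n := Fin n) (Ideal.Quotient.mk (𝓂[K] ^ m)))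
  let Q : Subgroup (GL (Fin n) (𝒪[K] ⧸ 𝓂[K] ^ m)) := (congrSubgroup n K 1).map red
  have hQ : ∃ a, Nat.card Q = p ^ a := by
    refine IsPGroup.iff_card.1 fun q => ?_
    obtain ⟨_, x, hx, rfl⟩ := q
    refine ⟨m, Subtype.ext ?_⟩
    have := pow_mem_congrSubgroup (p := p) hx m
    rw [congrSubgroup, MonoidHom.mem_ker, map_pow] at this
    exact this
  obtain ⟨a, ha⟩ := hQ
  have : Fintype Q := Fintype.ofFinite Q
  have hrep : ∀ q : Q, ∃ x ∈ congrSubgroup n K 1, red x = q := fun q => q.2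
  choose r hr1 hr using hrep
  let y : Q → centerInt n ϖ := fun q => ⟨glInt n K (r q), glInt_mem_centerInt _⟩
  have hyinj : Function.Injective y := fun q q' hqq => by
    have : r q = r q' := glInt_injective (congrArg Subtype.val hqq)
    exact Subtype.ext (by rw [← hr q, ← hr q', this])
  have hθ : ∀ q, centerIntRed h hn (y q) = 1 := fun q => by
    have := hr1 q
    rw [congrSubgroup_one, MonoidHom.mem_ker] at this
    rw [centerIntRed_glInt, this]
  refine ⟨a, Finset.univ.image y, ?_, fun x hx => ?_, ?_⟩
  · rw [Finset.card_image_of_injective _ hyinj, Finset.card_univ, ← Nat.card_eq_fintype_card, ha]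
  · obtain ⟨q, -, rfl⟩ := Finset.mem_image.1 hx
    exact hθ q
  rw [Finset.sum_image fun q _ q' _ hq => hyinj hq]
  set f' := ∑ q, lift ϖ ρ (y q) f with hf'
  have hval : ∀ g, f'.1 g = ∑ q, f.1 (g * glInt n K (r q)) := fun g => by
    rw [hf', AddSubmonoidClass.coe_finsetSum, Finset.sum_apply]
    rfl
  have hinv : ∀ x ∈ congrSubgroup n K 1, ∀ g, f'.1 (g * glInt n K x) = f'.1 g := by
    intro x hx g
    rw [hval, hval]
    let x' : Q := ⟨red x, x, hx, rfl⟩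
    rw [← Equiv.sum_comp (Equiv.mulLeft x') fun q => f.1 (g * glInt n K (r q))]
    refine Finset.sum_congr rfl fun q _ => ?_
    -- Multiplication by `x` permutes the representatives up to elements of level `m`, which `f`
    -- does not see.
    have hk : (r (x' * q))⁻¹ * (x * r q) ∈ congrSubgroup n K m := by
      change (r (x' * q))⁻¹ * (x * r q) ∈ red.ker
      rw [MonoidHom.mem_ker, map_mul, map_inv, map_mul, hr, hr]
      exact inv_mul_cancel _
    rw [Equiv.coe_mulLeft, ← hUf _ (hm _ hk) (g * glInt n K (r (x' * q)))]
    simp only [map_mul, map_inv]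
    group
  refine Subtype.ext (funext fun g => ?_)
  by_cases hg : g ∈ centerInt n ϖ
  · have e1 := liftSpace_apply_mul h hn f' ⟨g, hg⟩ 1
    rw [mul_one] at e1
    change p ^ a • (extendZero h hn ρ (f.1 1)).1 g = f'.1 g
    rw [extendZero_apply_of_mem h hn _ ⟨g, hg⟩]
    change _ = f'.1 ((⟨g, hg⟩ : centerInt n ϖ) : GL (Fin n) K)
    rw [e1, ← map_nsmul]
    congr 1
    rw [hval, Finset.sum_congr rfl fun q _ => ?_, Finset.sum_const, Finset.card_univ,
      ← Nat.card_eq_fintype_card, ha]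
    have := liftSpace_apply_mul h hn f (y q) 1
    rw [hθ, map_one] at this
    rw [one_mul]
    rw [mul_one] at this
    exact this
  · rw [liftSpace_apply_eq_zero h hn hp hρ f' hinv hg]
    change p ^ a • (extendZero h hn ρ (f.1 1)).1 g = 0
    rw [extendZero_apply_of_notMem h hn _ hg, smul_zero]

end LocalFieldLift

/-! ## Whittaker vectors -/

section EqvSum

variable {R G V : Type*} [CommRing R] [Group G] [AddCommGroup V] [Module R V]

/-- The sum `∑ χ(u) u⁻¹` over a finite subgroup. -/
def eqvSum (ρ : Representation R G V) {N : Subgroup G} [Fintype N] (χ : N →* R) : V →ₗ[R] V :=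
  ∑ u : N, χ u • ρ (u⁻¹ : N)

variable {ρ : Representation R G V} {N : Subgroup G} [Fintype N] {χ : N →* R}

theorem eqvSum_apply (v : V) : eqvSum ρ χ v = ∑ u : N, χ u • ρ (u⁻¹ : N) v := by
  simp [eqvSum]

/-- `eqvSum` is the projector to the `χ`-eigenvectors of `N`, multiplied by the order of `N` so that
nothing is divided in `R`. -/
theorem rep_eqvSum (w : N) (v : V) : ρ w (eqvSum ρ χ v) = χ w • eqvSum ρ χ v := by
  rw [eqvSum_apply, map_sum, Finset.smul_sum, ← Equiv.sum_comp (Equiv.mulRight w)]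
  refine Finset.sum_congr rfl fun u _ => ?_
  rw [map_smul, rep_apply_apply, smul_smul, Equiv.coe_mulRight, map_mul, mul_comm (χ u)]
  congr 3
  simp

theorem eqvSum_of_eqv {v : V} (h : ∀ w : N, ρ w v = χ w • v) :
    eqvSum ρ χ v = Nat.card N • v := by
  rw [eqvSum_apply, Finset.sum_congr rfl fun u _ => by
    rw [h, smul_smul, ← map_mul, mul_inv_cancel, map_one, one_smul], Finset.sum_const,
    Finset.card_univ, Nat.card_eq_fintype_card]

theorem eqvSum_eqvSum (v : V) : eqvSum ρ χ (eqvSum ρ χ v) = Nat.card N • eqvSum ρ χ v :=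
  eqvSum_of_eqv fun w => rep_eqvSum w v

end EqvSum

section Whittaker

variable {k : Type*} [Field k] [Finite k] {n : ℕ} {R : Type*} [CommRing R]

/-- The character `u ↦ ψ (∑ W i j (u - 1) i j)` of a pattern group. -/
def patternChar {Ω : Fin n → Fin n → Prop} (hΩ : ∀ a b c, Ω a b → Ω b c → Ω a c)
    (W : Matrix (Fin n) (Fin n) k) (hW : ∀ i x j, Ω i x → Ω x j → W i j = 0) (ψ : AddChar k R) :
    patternGroup k Ω hΩ →* R where
  toFun u := ψ (∑ i, ∑ j, W i j * ((u : GL (Fin n) k) i j - (1 : Matrix (Fin n) (Fin n) k) i j))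
  map_one' := by
    simp
  map_mul' u v := by
    rw [← AddChar.map_add_eq_mul, ← Finset.sum_add_distrib]
    congr 1
    refine Finset.sum_congr rfl fun i _ => ?_
    rw [← Finset.sum_add_distrib]
    refine Finset.sum_congr rfl fun j _ => ?_
    set B := ((u : GL (Fin n) k) : Matrix (Fin n) (Fin n) k) - 1 with hB
    set C := ((v : GL (Fin n) k) : Matrix (Fin n) (Fin n) k) - 1 with hC
    have hB0 : ∀ i j : Fin n, ¬ Ω i j → B i j = 0 := fun i j h => by
      rw [hB, Matrix.sub_apply, mem_patternGroup.1 u.2 i j h, sub_self]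
    have hC0 : ∀ i j, ¬ Ω i j → C i j = 0 := fun i j h => by
      rw [hC, Matrix.sub_apply, mem_patternGroup.1 v.2 i j h, sub_self]
    -- The weight vanishes at every position that is a product of two positions of the pattern, so
    -- the quadratic term of `(1 + B) (1 + C)` does not contribute.
    have h0 : W i j * (B * C) i j = 0 := by
      rw [Matrix.mul_apply, Finset.mul_sum]
      refine Finset.sum_eq_zero fun x _ => ?_
      by_cases h1 : Ω i x
      · by_cases h2 : Ω x j
        · rw [hW i x j h1 h2, zero_mul]
        · rw [hC0 x j h2, mul_zero, mul_zero]
      · rw [hB0 i x h1, zero_mul, mul_zero]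
    have h1 : (((u * v : patternGroup k Ω hΩ) : GL (Fin n) k) : Matrix (Fin n) (Fin n) k) - 1 =
        B + C + B * C := by
      rw [hB, hC, Subgroup.coe_mul, Units.val_mul]
      noncomm_ring
    have h2 := congrFun (congrFun h1 i) j
    rw [Matrix.sub_apply, Matrix.add_apply, Matrix.add_apply] at h2
    rw [h2, mul_add, h0, add_zero, mul_add]
    rfl

theorem colRel_trans (m : ℕ) (a b c : Fin n) (h : a < b ∧ m ≤ (b : ℕ)) (h' : b < c ∧ m ≤ (c : ℕ)) :
    a < c ∧ m ≤ (c : ℕ) := ⟨h.1.trans h'.1, h'.2⟩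

/-- The group of upper unitriangular matrices whose first `m` columns are those of the identity. -/
def colGroup (k : Type*) [Field k] [Finite k] (n m : ℕ) : Subgroup (GL (Fin n) k) :=
  patternGroup k (fun i j => i < j ∧ m ≤ (j : ℕ)) (colRel_trans m)

theorem mem_colGroup {m : ℕ} {g : GL (Fin n) k} : g ∈ colGroup k n m ↔
    ∀ i j : Fin n, ¬ (i < j ∧ m ≤ (j : ℕ)) → g i j = (1 : Matrix (Fin n) (Fin n) k) i j := Iff.rfl

/-- The weight of the standard generic character: `1` on the superdiagonal. -/
def superWeight (k : Type*) [Field k] (n : ℕ) : Matrix (Fin n) (Fin n) k :=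
  Matrix.of fun i j => if (i : ℕ) + 1 = j then 1 else 0

theorem superWeight_eq_zero (m : ℕ) (i x j : Fin n) (h : i < x ∧ m ≤ (x : ℕ))
    (h' : x < j ∧ m ≤ (j : ℕ)) : superWeight k n i j = 0 := by
  rw [superWeight, Matrix.of_apply, if_neg]
  have h1 : (i : ℕ) < x := h.1
  have h2 : (x : ℕ) < j := h'.1
  omega

/-- The standard generic character. -/
def genericChar (m : ℕ) (ψ : AddChar k R) : colGroup k n m →* R :=
  patternChar (colRel_trans m) (superWeight k n) (superWeight_eq_zero m) ψ

theorem genericChar_apply {m : ℕ} {ψ : AddChar k R} (u : colGroup k n m) : genericChar m ψ u =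
    ψ (∑ i, ∑ j, superWeight k n i j *
      ((u : GL (Fin n) k) i j - (1 : Matrix (Fin n) (Fin n) k) i j)) := rfl

/-- The weight equal to `c` on the column `m` and to the standard weight on the later ones. -/
def colWeight (m : Fin n) (c : Fin n → k) : Matrix (Fin n) (Fin n) k :=
  Matrix.of fun i j => if j = m then c i else if (i : ℕ) + 1 = j ∧ m < j then 1 else 0

theorem colWeight_eq_zero (m : Fin n) (c : Fin n → k) (i x j : Fin n) (h : i < x ∧ (m : ℕ) ≤ x)
    (h' : x < j ∧ (m : ℕ) ≤ j) : colWeight m c i j = 0 := by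
  have h1 : (i : ℕ) < x := h.1
  have h2 : (x : ℕ) < j := h'.1
  rw [colWeight, Matrix.of_apply, if_neg (by rintro rfl; omega), if_neg (by omega)]

def colChar (m : Fin n) (c : Fin n → k) (ψ : AddChar k R) : colGroup k n m →* R :=
  patternChar (colRel_trans m) (colWeight m c) (colWeight_eq_zero m c) ψ

theorem colChar_apply {m : Fin n} {c : Fin n → k} {ψ : AddChar k R} (u : colGroup k n m) :
    colChar m c ψ u = ψ (∑ i, ∑ j, colWeight m c i j *
      ((u : GL (Fin n) k) i j - (1 : Matrix (Fin n) (Fin n) k) i j)) := rfl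

theorem sum_colWeight (m : Fin n) (c : Fin n → k) (B : Matrix (Fin n) (Fin n) k) :
    ∑ i, ∑ j, colWeight m c i j * B i j = ∑ i, c i * B i m + ∑ i, ∑ j, colWeight m 0 i j * B i j := by
  rw [← Finset.sum_add_distrib]
  refine Finset.sum_congr rfl fun i _ => ?_
  rw [← Finset.add_sum_erase _ _ (Finset.mem_univ m),
    ← Finset.add_sum_erase _ (fun j => colWeight m 0 i j * B i j) (Finset.mem_univ m)]
  have h1 : colWeight m c i m = c i := by simp [colWeight]
  have h2 : colWeight m (0 : Fin n → k) i m = 0 := by simp [colWeight]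
  rw [h1, h2, zero_mul, zero_add]
  congr 1
  refine Finset.sum_congr rfl fun j hj => ?_
  simp [colWeight, Finset.ne_of_mem_erase hj]

theorem colChar_eq (m : Fin n) (c : Fin n → k) (ψ : AddChar k R) (u : colGroup k n m) :
    colChar m c ψ u =
      ψ (∑ i, c i * ((u : GL (Fin n) k) i m - (1 : Matrix (Fin n) (Fin n) k) i m)) *
        colChar m 0 ψ u := by
  rw [colChar_apply, colChar_apply, ← AddChar.map_add_eq_mul]
  congr 1
  exact sum_colWeight m c (((u : GL (Fin n) k) : Matrix (Fin n) (Fin n) k) - 1)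

/-- For `b ≠ 0` the map `c ↦ ψ (c · b)` is a nontrivial additive character. -/
theorem sum_addChar_dotProduct [IsDomain R] [Fintype k] {ψ : AddChar k R} (hψ : ψ ≠ 1)
    {b : Fin n → k} (hb : b ≠ 0) : ∑ c : Fin n → k, ψ (∑ i, c i * b i) = 0 := by
  let f : (Fin n → k) →+ k :=
    { toFun := fun c => ∑ i, c i * b i
      map_zero' := by simp
      map_add' := fun c c' => by simp [add_mul, Finset.sum_add_distrib] }
  refine AddChar.sum_eq_zero_of_ne_one (ψ := ψ.compAddMonoidHom f) fun h => ?_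
  obtain ⟨x, hx⟩ := AddChar.ne_one_iff.1 hψ
  obtain ⟨i, hi⟩ := Function.ne_iff.1 hb
  refine hx ?_
  have := DFunLike.congr_fun h (Pi.single i (x * (b i)⁻¹))
  rw [AddChar.compAddMonoidHom_apply] at this
  have e : f (Pi.single i (x * (b i)⁻¹)) = x := by
    change ∑ j, Pi.single (M := fun _ => k) i (x * (b i)⁻¹) j * b j = x
    rw [Finset.sum_eq_single i (fun j _ hj => by simp [hj]) (by simp)]
    simp [mul_assoc, inv_mul_cancel₀ hi]
  rwa [e] at this

variable [IsDomain R] {V : Type*} [AddCommGroup V] [Module R V]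
  {ρ : Representation R (GL (Fin n) k) V} {p : ℕ} [Fact p.Prime] [CharP k p]

theorem colGroup_anti {m m' : ℕ} (h : m ≤ m') : colGroup k n m' ≤ colGroup k n m :=
  fun _ hg i j hij => hg i j fun h' => hij ⟨h'.1, h.trans h'.2⟩

/-- Fourier inversion in column `m`: the images of `y` under the `eqvSum` of all characters `colChar
m c` add up to a power of `p` times `y`, so one of them is nonzero. The entries of `c` on or below
the diagonal have no effect and only enlarge that power. -/
theorem exists_colChar_vector (hp : IsUnit (p : R)) {ψ : AddChar k R} (hψ : ψ ≠ 1) (m : Fin n)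
    {y : V} (hy0 : y ≠ 0) (hy : ∀ u : colGroup k n (m + 1), ρ u y = genericChar (m + 1) ψ u • y) :
    ∃ c : Fin n → k, ∃ z ≠ 0, ∀ u : colGroup k n m, ρ u z = colChar m c ψ u • z := by
  classical
  have := Fintype.ofFinite k
  have := Fintype.ofFinite (colGroup k n m)
  by_contra! hcon
  have h0 : ∀ c : Fin n → k, eqvSum ρ (colChar m c ψ) y = 0 := fun c => by
    by_contra hne
    obtain ⟨u, hu⟩ := hcon c _ hne
    exact hu (rep_eqvSum u y)
  have hle := colGroup_anti (k := k) (n := n) (Nat.le_succ (m : ℕ))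
  have hterm : ∀ u : colGroup k n m, (∑ c : Fin n → k, colChar m c ψ u) • ρ (u⁻¹ : colGroup k n m) y =
      if u ∈ (colGroup k n (m + 1)).subgroupOf (colGroup k n m) then
        Nat.card (Fin n → k) • y else 0 := by
    intro u
    rw [Finset.sum_congr rfl fun c _ => colChar_eq m c ψ u, ← Finset.sum_mul]
    split_ifs with hu
    · have hu' : (u : GL (Fin n) k) ∈ colGroup k n (m + 1) := hu
      have hcol : ∀ i, (u : GL (Fin n) k) i m - (1 : Matrix (Fin n) (Fin n) k) i m = 0 := fun i => by
        rw [mem_colGroup.1 hu' i m (by omega), sub_self]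
      have e1 : ∑ c : Fin n → k, ψ (∑ i, c i * ((u : GL (Fin n) k) i m -
          (1 : Matrix (Fin n) (Fin n) k) i m)) = (Nat.card (Fin n → k) : R) := by
        rw [Finset.sum_congr rfl fun c _ => by
          rw [Finset.sum_eq_zero fun i _ => by rw [hcol, mul_zero], AddChar.map_zero_eq_one]]
        simp
      have e2 : colChar m 0 ψ u = genericChar (m + 1) ψ (⟨u, hu'⟩ : colGroup k n (m + 1)) := by
        rw [colChar_apply, genericChar_apply]
        congr 1
        refine Finset.sum_congr rfl fun i _ => Finset.sum_congr rfl fun j _ => ?_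
        by_cases hj : i < j ∧ (m : ℕ) + 1 ≤ j
        · congr 1
          have : m < j := Fin.lt_def.2 (by omega)
          simp [colWeight, superWeight, this.ne', this]
        · rw [mem_colGroup.1 hu' i j hj, sub_self, mul_zero, mul_zero]
      have e3 : ρ (u⁻¹ : colGroup k n m) y = _ := hy ⟨(u : GL (Fin n) k), hu'⟩⁻¹
      rw [e3, e1, e2, smul_smul, mul_assoc,
        ← map_mul, mul_inv_cancel, map_one, mul_one, Nat.cast_smul_eq_nsmul]
    · have hb : (fun i => (u : GL (Fin n) k) i m - (1 : Matrix (Fin n) (Fin n) k) i m) ≠ 0 := by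
        intro hb
        refine hu (mem_colGroup.2 fun i j hij => ?_)
        by_cases hjm : j = m
        · subst hjm
          exact sub_eq_zero.1 (congrFun hb i)
        · refine mem_colGroup.1 u.2 i j fun h => hij ⟨h.1, ?_⟩
          have : (j : ℕ) ≠ m := fun h => hjm (Fin.ext h)
          omega
      rw [sum_addChar_dotProduct hψ hb, zero_mul, zero_smul]
  have hsum : ∑ u : colGroup k n m, (∑ c : Fin n → k, colChar m c ψ u) •
      ρ (u⁻¹ : colGroup k n m) y = 0 := by
    simp_rw [Finset.sum_smul]
    rw [Finset.sum_comm]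
    exact Finset.sum_eq_zero fun c _ => by rw [← eqvSum_apply, h0]
  rw [Finset.sum_congr rfl fun u _ => hterm u, ← Finset.sum_filter, Finset.sum_const] at hsum
  obtain ⟨a, ha⟩ := card_patternGroup (k := k) (p := p) (n := n)
    (Ω := fun i j => i < j ∧ (m : ℕ) + 1 ≤ (j : ℕ)) (hΩ := colRel_trans _) fun i j h => h.1
  have hc1 : (Finset.univ.filter fun u : colGroup k n m =>
      u ∈ (colGroup k n (m + 1)).subgroupOf (colGroup k n m)).card = p ^ a := by
    rw [← ha, ← Fintype.card_subtype, ← Nat.card_eq_fintype_card]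
    exact Nat.card_congr (Subgroup.subgroupOfEquivOfLe hle).toEquiv
  obtain ⟨f, -, hf⟩ := FiniteField.card k p
  have hc2 : Nat.card (Fin n → k) = p ^ ((f : ℕ) * n) := by
    rw [Nat.card_eq_fintype_card, Fintype.card_fun, hf, Fintype.card_fin, pow_mul]
  rw [hc1, hc2] at hsum
  have h1 := IndData.smul_cancel hp (hsum.trans (smul_zero _).symm)
  exact hy0 (IndData.smul_cancel hp (h1.trans (smul_zero _).symm))

/-- A matrix of `GL_m ⊂ GL_n` whose last row is a given nonzero vector. -/
theorem exists_gl_row {m : Fin n} {r : Fin n} (hr : (r : ℕ) + 1 = m) {c : Fin n → k} {a : Fin n}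
    (ha : a < m) (hc : c a ≠ 0) : ∃ H : GL (Fin n) k,
      (∀ i j, ¬ (i < m ∧ j < m) → H i j = (1 : Matrix (Fin n) (Fin n) k) i j) ∧
      ∀ j, j < m → H r j = c j := by
  let d : Fin n → k := fun j => if j < m then c j else 0
  let X : Matrix (Fin n) (Fin n) k := (1 : Matrix (Fin n) (Fin n) k).updateRow a d
  have hX : X.det = c a := by
    have e : d = ∑ j, d j • (1 : Matrix (Fin n) (Fin n) k) j := by
      ext x
      simp [Matrix.one_apply, Finset.sum_apply]
    have : X.det = d a • (1 : Matrix (Fin n) (Fin n) k).det := by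
      change ((1 : Matrix (Fin n) (Fin n) k).updateRow a d).det = _
      conv_lhs => rw [e]
      exact Matrix.det_updateRow_sum _ a d
    rw [this]; simp [d, ha]
  -- The identity with row `a` replaced by `c` and then exchanged with row `r`; its determinant is
  -- `± c a`.
  let P : Matrix (Fin n) (Fin n) k := X.submatrix (Equiv.swap a r) id
  have hP : IsUnit P.det := by
    rw [Matrix.det_permute, hX, isUnit_iff_ne_zero]
    refine mul_ne_zero ?_ hc
    rcases Int.units_eq_one_or (Equiv.Perm.sign (Equiv.swap a r)) with h | h <;> simp [h]
  have hrm : r < m := Fin.lt_def.2 (by omega)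
  refine ⟨P.nonsingInvUnit hP, fun i j hij => ?_, fun j hj => ?_⟩
  · change X (Equiv.swap a r i) j = _
    by_cases hi : i < m
    · have hj : ¬ j < m := fun h => hij ⟨hi, h⟩
      have hs : Equiv.swap a r i < m := by
        rw [Equiv.swap_apply_def]; split_ifs <;> assumption
      rw [Matrix.one_apply_ne (fun h : i = j => hj (h ▸ hi))]
      by_cases hs' : Equiv.swap a r i = a
      · rw [hs']; simp [X, d, hj]
      · exact (congrFun (Matrix.updateRow_ne hs') j).trans
          (Matrix.one_apply_ne fun h : _ = j => hj (h ▸ hs))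
    · have h1 : i ≠ a := fun h => hi (h ▸ ha)
      have h2 : i ≠ r := fun h => hi (h ▸ hrm)
      rw [Equiv.swap_apply_of_ne_of_ne h1 h2]
      exact congrFun (Matrix.updateRow_ne h1) j
  · change X (Equiv.swap a r r) j = _
    rw [Equiv.swap_apply_right]
    simp [X, d, hj]

/-- Fourier analysis gives a vector with some weight `c` in column `m` and the standard weights to
the right. If `c` is nonzero above the diagonal, conjugation by an element of `GL_m` makes it
standard without disturbing the later columns. Otherwise the character is trivial on the radical of
`P_m`, and cuspidality excludes such a vector. -/
theorem CuspSum.exists_generic_step (h : CuspSum ρ) (hp : IsUnit (p : R)) {ψ : AddChar k R}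
    (hψ : ψ ≠ 1) {m : ℕ} (h1 : 1 ≤ m) (h2 : m < n)
    (hy : ∃ y ≠ 0, ∀ u : colGroup k n (m + 1), ρ u y = genericChar (m + 1) ψ u • y) :
    ∃ y ≠ 0, ∀ u : colGroup k n m, ρ u y = genericChar m ψ u • y := by
  obtain ⟨y, hy0, hy⟩ := hy
  obtain ⟨c, z, hz0, hz⟩ := exists_colChar_vector hp hψ ⟨m, h2⟩ hy0 hy
  set mm : Fin n := ⟨m, h2⟩ with hmm
  by_cases hc : ∃ a, a < mm ∧ c a ≠ 0
  · obtain ⟨a, ha, hca⟩ := hc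
    let r : Fin n := ⟨m - 1, by omega⟩
    have hr : (r : ℕ) + 1 = mm := Nat.sub_add_cancel h1
    obtain ⟨H, hH, hHr⟩ := exists_gl_row hr ha hca
    refine ⟨ρ H z, fun h0 => hz0 ?_, fun u => ?_⟩
    · have := congrArg (ρ H⁻¹) h0
      rwa [map_zero, rep_apply_apply, inv_mul_cancel, map_one] at this
    set B := ((u : GL (Fin n) k) : Matrix (Fin n) (Fin n) k) - 1 with hB
    have hB0 : ∀ i j : Fin n, ¬ (i < j ∧ m ≤ (j : ℕ)) → B i j = 0 := fun i j h => by
      rw [hB, Matrix.sub_apply, mem_colGroup.1 u.2 i j h, sub_self]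
    set u' := H⁻¹ * (u : GL (Fin n) k) * H with hu'
    set B' := (u' : Matrix (Fin n) (Fin n) k) - 1 with hB'
    have hBH : B * (H : Matrix (Fin n) (Fin n) k) = B := by
      ext i j
      rw [Matrix.mul_apply, Finset.sum_eq_single j]
      · by_cases hj : j < mm
        · rw [hB0 i j (fun h => absurd h.2 (not_le.2 hj)), zero_mul]
        · rw [hH j j (fun h => hj h.2), Matrix.one_apply_eq, mul_one]
      · intro x _ hx
        by_cases hxm : x < mm
        · rw [hB0 i x (fun h => absurd h.2 (not_le.2 hxm)), zero_mul]
        · rw [hH x j (fun h => hxm h.1), Matrix.one_apply_ne hx, mul_zero]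
      · simp
    have hHinv : ((H⁻¹ : GL (Fin n) k) : Matrix (Fin n) (Fin n) k) * H = 1 := Units.inv_mul H
    have hHinv' : (H : Matrix (Fin n) (Fin n) k) * ((H⁻¹ : GL (Fin n) k) : Matrix (Fin n) (Fin n) k) = 1 :=
      Units.mul_inv H
    have hB'e : B' = ((H⁻¹ : GL (Fin n) k) : Matrix (Fin n) (Fin n) k) * B := by
      rw [← hBH, hB', hu', Units.val_mul, Units.val_mul, hB, sub_mul, one_mul, mul_sub, mul_assoc, hHinv]
    have hHB' : (H : Matrix (Fin n) (Fin n) k) * B' = B := by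
      rw [hB'e, ← mul_assoc, hHinv', one_mul]
    have hBge : ∀ i j, ¬ i < mm → B' i j = B i j := fun i j hi => by
      rw [← hHB', Matrix.mul_apply, Finset.sum_eq_single i (fun x _ hx => by
        rw [hH i x (fun h => hi h.1), Matrix.one_apply_ne hx.symm, zero_mul]) (by simp),
        hH i i (fun h => hi h.1), Matrix.one_apply_eq, one_mul]
    have hB'0 : ∀ i j : Fin n, ¬ (i < j ∧ m ≤ (j : ℕ)) → B' i j = 0 := fun i j hij => by
      by_cases hj : m ≤ (j : ℕ)
      · have hi : ¬ i < mm := fun h => hij ⟨h.trans_le hj, hj⟩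
        rw [hBge i j hi, hB0 i j hij]
      · rw [hB'e, Matrix.mul_apply]
        exact Finset.sum_eq_zero fun x _ => by rw [hB0 x j (fun h => hj h.2), mul_zero]
    have hu'm : u' ∈ colGroup k n m := mem_colGroup.2 fun i j hij => sub_eq_zero.1 (hB'0 i j hij)
    have hchar : colChar mm c ψ ⟨u', hu'm⟩ = genericChar m ψ u := by
      rw [colChar_apply, genericChar_apply]
      congr 1
      change ∑ i, ∑ j, colWeight mm c i j * B' i j = ∑ i, ∑ j, superWeight k n i j * B i j
      have e1 : ∑ i, c i * B' i mm = B r mm := by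
        rw [← hHB', Matrix.mul_apply]
        refine Finset.sum_congr rfl fun x _ => ?_
        by_cases hx : x < mm
        · rw [hHr x hx]
        · rw [hB'0 x mm (fun h => hx h.1), mul_zero, mul_zero]
      have e2 : ∀ M : Matrix (Fin n) (Fin n) k, (∀ i j : Fin n, ¬ (i < j ∧ m ≤ (j : ℕ)) → M i j = 0) →
          ∑ i, ∑ j, superWeight k n i j * M i j =
            ∑ i, ∑ j, colWeight mm (Pi.single r 1) i j * M i j := fun M hM => by
        refine Finset.sum_congr rfl fun i _ => Finset.sum_congr rfl fun j _ => ?_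
        by_cases hj : i < j ∧ m ≤ (j : ℕ)
        · congr 1
          rw [superWeight, colWeight, Matrix.of_apply, Matrix.of_apply]
          by_cases hjm : j = mm
          · subst hjm
            rw [if_pos rfl, Pi.single_apply]
            refine if_congr ⟨fun h => Fin.ext ?_, fun h => ?_⟩ rfl rfl
            · change (i : ℕ) = m - 1; change (i : ℕ) + 1 = m at h; omega
            · rw [h]; exact hr
          · rw [if_neg hjm]
            have : mm < j := lt_of_le_of_ne hj.2 (Ne.symm hjm)
            simp [this]
        · rw [hM i j hj, mul_zero, mul_zero]
      rw [e2 B hB0, sum_colWeight, sum_colWeight mm (Pi.single r 1), e1]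
      congr 1
      · rw [Finset.sum_eq_single r (fun x _ hx => by simp [hx]) (by simp)]; simp
      · refine Finset.sum_congr rfl fun i _ => Finset.sum_congr rfl fun j _ => ?_
        by_cases hi : i < mm
        · have : colWeight mm (0 : Fin n → k) i j = 0 := by
            rw [colWeight, Matrix.of_apply]
            split_ifs with h3 h4
            · rfl
            · have h5 : (i : ℕ) < m := hi
              have h6 : m < (j : ℕ) := h4.2
              omega
            · rfl
          rw [this, zero_mul, zero_mul]
        · rw [hBge i j hi]
    have hue : (u : GL (Fin n) k) * H = H * u' := by rw [hu']; group
    rw [rep_apply_apply, hue, ← rep_apply_apply, hz ⟨u', hu'm⟩, hchar, map_smul]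
  · push Not at hc
    refine absurd (h.eq_zero_of_fixed hp h1 h2 fun u hu => ?_) hz0
    have hum : u ∈ colGroup k n mm := mem_colGroup.2 fun i j hij => by
      refine mem_patternGroup.1 hu i j fun h => hij ⟨Fin.lt_def.2 (h.1.trans_le h.2), h.2⟩
    have : colChar mm c ψ ⟨u, hum⟩ = 1 := by
      rw [colChar_apply, Finset.sum_eq_zero, AddChar.map_zero_eq_one]
      refine fun i _ => Finset.sum_eq_zero fun j _ => ?_
      by_cases hij : (i : ℕ) < m ∧ m ≤ (j : ℕ)
      · have : colWeight mm c i j = 0 := by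
          rw [colWeight, Matrix.of_apply]
          split_ifs with h3 h4
          · exact hc i hij.1
          · have h6 : m < (j : ℕ) := h4.2
            omega
          · rfl
        rw [this, zero_mul]
      · have := mem_patternGroup.1 hu i j hij
        simp only [this, sub_self, mul_zero]
    have := hz ⟨u, hum⟩
    rwa [‹colChar mm c ψ ⟨u, hum⟩ = 1›, one_smul] at this

/-- A nonzero cuspidal representation has a Whittaker vector. -/
theorem CuspSum.exists_generic (h : CuspSum ρ) (hp : IsUnit (p : R)) {ψ : AddChar k R}
    (hψ : ψ ≠ 1) [Nontrivial V] :
    ∃ y ≠ 0, ∀ u : colGroup k n 0, ρ u y = genericChar 0 ψ u • y := by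
  have key : ∀ d m : ℕ, 1 ≤ m → m + d = n →
      ∃ y ≠ 0, ∀ u : colGroup k n m, ρ u y = genericChar m ψ u • y := by
    intro d
    induction d with
    | zero =>
      intro m _ hm
      obtain ⟨y, hy⟩ := exists_ne (0 : V)
      refine ⟨y, hy, fun u => ?_⟩
      have : u = 1 := Subtype.ext (Units.ext (by
        ext i j
        exact mem_colGroup.1 u.2 i j (by omega)))
      rw [this]
      simp
    | succ d ih =>
      intro m h1 hm
      exact h.exists_generic_step hp hψ h1 (by omega) (ih (m + 1) (by omega) (by omega))
  have h10 : colGroup k n 0 ≤ colGroup k n 1 := fun g hg i j hij => hg i j fun h => hij ⟨h.1, by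
    have h' : (i : ℕ) < j := h.1
    omega⟩
  have h01 : ∀ y : V, (∀ u : colGroup k n 1, ρ u y = genericChar 1 ψ u • y) →
      ∀ u : colGroup k n 0, ρ u y = genericChar 0 ψ u • y := fun y hy u => hy ⟨u, h10 u.2⟩
  rcases Nat.eq_zero_or_pos n with rfl | hn
  · obtain ⟨y, hy⟩ := exists_ne (0 : V)
    refine ⟨y, hy, fun u => ?_⟩
    rw [Subsingleton.elim u 1]
    simp
  · obtain ⟨y, hy0, hy⟩ := key (n - 1) 1 le_rfl (by omega)
    exact ⟨y, hy0, h01 y hy⟩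

end Whittaker

/-! ## Uniqueness of Whittaker models -/

section Layered

variable {n : ℕ} {α : Type*}

/-- Consecutive values either ascend or drop by exactly one. This forces every inverted pair to lie
within one descending run, on a common antidiagonal. The induction on the distance compares a pair
with those shortened by one at either end; an ascent at both ends is contradictory. -/
theorem layered_inversion {r : Fin n → Fin n} (hr : Function.Injective r) {t : Fin n → α}
    (hstep : ∀ j j' : Fin n, (j : ℕ) + 1 = j' → r j < r j' ∨ ((r j' : ℕ) + 1 = r j ∧ t j = t j')) :
    ∀ (d : ℕ) (j j' : Fin n), (j : ℕ) + d = j' → 1 ≤ d → r j' < r j →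
      (r j : ℕ) + j = r j' + j' ∧ t j = t j' := by
  have hne : ∀ a b : Fin n, (a : ℕ) ≠ b → (r a : ℕ) ≠ r b := fun a b hab h =>
    hab (congrArg Fin.val (hr (Fin.ext h)))
  intro d
  induction d using Nat.strong_induction_on with
  | _ d ih =>
    intro j j' hd h1 hlt
    have hlt' : (r j' : ℕ) < r j := hlt
    have hj' := j'.2
    rcases Nat.lt_or_ge 1 d with hd1 | hd1
    · let a : Fin n := ⟨j + 1, by omega⟩
      let b : Fin n := ⟨j' - 1, by omega⟩
      have ha : (a : ℕ) = j + 1 := rfl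
      have hb : (b : ℕ) = j' - 1 := rfl
      have hnea := hne a j' (by omega)
      have hneb := hne j b (by omega)
      rcases hstep j a rfl with hs | ⟨hs, hst⟩
      · have hs' : (r j : ℕ) < r a := hs
        obtain ⟨e1, -⟩ := ih (d - 1) (by omega) a j' (by omega) (by omega)
          (Fin.lt_def.2 (by omega))
        rcases hstep b j' (by omega) with hs2 | ⟨hs2, hst2⟩
        · have hs2' : (r b : ℕ) < r j' := hs2
          obtain ⟨e2, -⟩ := ih (d - 1) (by omega) j b (by omega) (by omega)
            (Fin.lt_def.2 (by omega))
          rcases Nat.lt_or_ge 2 d with hd2 | hd2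
          · obtain ⟨e3, -⟩ := ih (d - 2) (by omega) a b (by omega) (by omega)
              (Fin.lt_def.2 (by omega))
            omega
          · have : a = b := Fin.ext (by omega)
            rw [this] at hs'
            omega
        · obtain ⟨e2, e2t⟩ := ih (d - 1) (by omega) j b (by omega) (by omega)
            (Fin.lt_def.2 (by omega))
          exact ⟨by omega, e2t.trans hst2⟩
      · obtain ⟨e1, e1t⟩ := ih (d - 1) (by omega) a j' (by omega) (by omega)
          (Fin.lt_def.2 (by omega))
        exact ⟨by omega, hst.trans e1t⟩
    · rcases hstep j j' (by omega) with hs | ⟨hs, hst⟩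
      · exact absurd hs (not_lt.2 hlt.le)
      · exact ⟨by omega, hst⟩

/-- Pigeonhole: as `j` goes up, some `j' > j` comes down to a place `≤ j`. The pair `(j, j')` is
inverted, so it lies on an antidiagonal, and comparison with `r j` leaves only `r (r j) = j`. -/
theorem layered_apply_apply_of_lt {r : Equiv.Perm (Fin n)}
    (hinv : ∀ j j', j < j' → r j' < r j → (r j : ℕ) + j = r j' + j') {j : Fin n} (hj : j < r j) :
    r (r j) = j := by
  obtain ⟨j', hjj', hrj'⟩ : ∃ j', j ≤ j' ∧ r j' ≤ j := by
    by_contra! hcon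
    have hsub : (Finset.Iic j).map r.symm.toEmbedding ⊆ Finset.Iio j := fun x hx => by
      obtain ⟨y, hy, rfl⟩ := Finset.mem_map.1 hx
      rw [Finset.mem_Iio]
      by_contra hc
      have := hcon (r.symm y) (not_lt.1 hc)
      rw [Equiv.apply_symm_apply] at this
      exact absurd (Finset.mem_Iic.1 hy) (not_le.2 this)
    have := Finset.card_le_card hsub
    rw [Finset.card_map, Fin.card_Iic, Fin.card_Iio] at this
    omega
  have hlt : j < j' := lt_of_le_of_ne hjj' (by rintro rfl; exact absurd hj (not_lt.2 hrj'))
  have e1 := hinv j j' hlt (hrj'.trans_lt hj)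
  have hj1 : (j : ℕ) < r j := hj
  have hj2 : (r j' : ℕ) ≤ j := hrj'
  rcases lt_trichotomy (r j) j' with h | h | h
  · have h' : (r j : ℕ) < j' := h
    rcases lt_or_ge (r (r j)) (r j) with h2 | h2
    · have := hinv j (r j) hj h2
      exact Fin.ext (by omega)
    · have h3 : (r j : ℕ) ≤ r (r j) := h2
      have := hinv (r j) j' h (Fin.lt_def.2 (by omega))
      exact Fin.ext (by omega)
  · rw [h]
    have h' : (r j : ℕ) = j' := congrArg Fin.val h
    exact Fin.ext (by omega)
  · have h' : (j' : ℕ) < r j := h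
    omega

/-- The points that go down go up under the inverse permutation, which satisfies the same
hypothesis. -/
theorem layered_involutive {r : Equiv.Perm (Fin n)}
    (hinv : ∀ j j', j < j' → r j' < r j → (r j : ℕ) + j = r j' + j') (j : Fin n) :
    r (r j) = j := by
  rcases lt_trichotomy j (r j) with h | h | h
  · exact layered_apply_apply_of_lt hinv h
  · rw [← h, ← h]
  · have hinv' : ∀ x x', x < x' → r.symm x' < r.symm x →
        (r.symm x : ℕ) + x = r.symm x' + x' := fun x x' hx hx' => by
      have := hinv (r.symm x') (r.symm x) hx' (by simpa using hx)
      simp only [Equiv.apply_symm_apply] at this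
      omega
    have := layered_apply_apply_of_lt hinv' (j := r j) (by simpa using h)
    rw [Equiv.symm_apply_apply, Equiv.symm_apply_eq] at this
    exact this.symm

end Layered

/-! ### Bruhat decomposition and transposition along the antidiagonal. -/

section Bruhat

variable {k : Type*} [Field k] [Finite k] {n : ℕ}

theorem exists_mem_colGroup (A : Matrix (Fin n) (Fin n) k)
    (h : ∀ i j, ¬ i < j → A i j = (1 : Matrix (Fin n) (Fin n) k) i j) :
    ∃ u ∈ colGroup k n 0, (u : Matrix (Fin n) (Fin n) k) = A := by
  have hd : A.det = 1 := by
    rw [Matrix.det_of_isUpperTriangular]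
    · exact Finset.prod_eq_one fun i _ => by rw [h i i (lt_irrefl i), Matrix.one_apply_eq]
    · intro i j hij
      have hij' : j < i := hij
      rw [h i j hij'.not_gt, Matrix.one_apply_ne hij'.ne']
  refine ⟨A.nonsingInvUnit (by rw [hd]; exact isUnit_one), mem_colGroup.2 fun i j hij => ?_, rfl⟩
  exact h i j fun h => hij ⟨h, Nat.zero_le _⟩

/-- `M` has at most one nonzero entry in each row and column meeting the columns `< c`. -/
def MonomialBefore (c : ℕ) (M : Matrix (Fin n) (Fin n) k) : Prop :=
  ∀ j : Fin n, (j : ℕ) < c → ∀ i, M i j ≠ 0 →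
    (∀ j', j' ≠ j → M i j' = 0) ∧ ∀ i', i' ≠ i → M i' j = 0

/-- The pivot is the lowest nonzero entry of column `c`. Its row vanishes to the left, so the
entries above it and to its right are cleared by upper unitriangular row and column operations. -/
theorem MonomialBefore.exists_step {c : Fin n} {M : Matrix (Fin n) (Fin n) k}
    (h : MonomialBefore c M) : ∃ u ∈ colGroup k n 0, ∃ u' ∈ colGroup k n 0,
      MonomialBefore (c + 1) ((u : Matrix (Fin n) (Fin n) k) * M * (u' : Matrix (Fin n) (Fin n) k)) := by
  classical
  by_cases hz : ∀ i, M i c = 0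
  · refine ⟨1, one_mem _, 1, one_mem _, ?_⟩
    rw [Units.val_one, one_mul, mul_one]
    intro j hj i hij
    rcases Nat.lt_succ_iff_lt_or_eq.1 hj with hj | hj
    · exact h j hj i hij
    · rw [Fin.ext hj] at hij
      exact absurd (hz i) hij
  push Not at hz
  obtain ⟨i₀, hi₀⟩ := hz
  obtain ⟨i, hi, himax⟩ := (Finset.univ.filter fun i => M i c ≠ 0).exists_max_image id
    ⟨i₀, by simpa using hi₀⟩
  simp only [Finset.mem_filter, Finset.mem_univ, true_and, id] at hi himax
  have hbelow : ∀ a, i < a → M a c = 0 := fun a ha => by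
    by_contra hc
    exact absurd (himax a hc) (not_le.2 ha)
  have hleft : ∀ b, b < c → M i b = 0 := fun b hb => by
    by_contra hc
    exact hi ((h b hb i hc).1 c (ne_of_gt hb))
  let v : Fin n → k := fun a => if a < i then M a c / M i c else 0
  let w : Fin n → k := fun b => if c < b then M i b / M i c else 0
  obtain ⟨u, hu, hue⟩ := exists_mem_colGroup
    ((1 : Matrix (Fin n) (Fin n) k) - Matrix.of fun a b => if b = i then v a else 0)
    fun a b hab => by
      rw [Matrix.sub_apply, Matrix.of_apply, sub_eq_self]
      split_ifs with hb
      · subst hb; exact if_neg hab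
      · rfl
  obtain ⟨u', hu', hue'⟩ := exists_mem_colGroup
    ((1 : Matrix (Fin n) (Fin n) k) - Matrix.of fun a b => if a = c then w b else 0)
    fun a b hab => by
      rw [Matrix.sub_apply, Matrix.of_apply, sub_eq_self]
      split_ifs with hb
      · subst hb; exact if_neg hab
      · rfl
  refine ⟨u, hu, u', hu', ?_⟩
  set N := (u : Matrix (Fin n) (Fin n) k) * M * (u' : Matrix (Fin n) (Fin n) k) with hN
  have hL : ∀ a b, ((u : Matrix (Fin n) (Fin n) k) * M) a b = M a b - v a * M i b := fun a b => by
    rw [hue, sub_mul, one_mul, Matrix.sub_apply, Matrix.mul_apply]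
    simp
  have hvc : ∀ a, M a c - v a * M i c = if a = i then M i c else 0 := fun a => by
    rcases lt_trichotomy a i with ha | ha | ha
    · simp [v, ha, ha.ne, hi]
    · simp [v, ha]
    · simp [v, ha.ne', ha.not_gt, hbelow a ha]
  have hNe : ∀ a b, N a b = M a b - v a * M i b - (if a = i then M i c else 0) * w b := fun a b => by
    rw [hN, hue', mul_sub, mul_one, Matrix.sub_apply, hL, ← hvc, ← hL a c, Matrix.mul_apply
      (N := Matrix.of _)]
    simp
  have hNi : ∀ b, b ≠ c → N i b = 0 := fun b hb => by
    rw [hNe, if_pos rfl]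
    rcases lt_or_gt_of_ne hb with hb | hb
    · simp [hleft b hb, w, hb.not_gt]
    · simp [v, w, hb, mul_div_cancel₀ _ hi]
  have hNc : ∀ a, a ≠ i → N a c = 0 := fun a ha => by
    rw [hNe, if_neg ha, hvc, if_neg ha]; simp
  have hNl : ∀ a b, b < c → N a b = M a b := fun a b hb => by
    rw [hNe, hleft b hb]; simp [w, hb.not_gt]
  intro j hj a haj
  rcases Nat.lt_succ_iff_lt_or_eq.1 hj with hj | hj
  · have hjc : j < c := hj
    rw [hNl a j hjc] at haj
    obtain ⟨h1, h2⟩ := h j hj a haj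
    have hai : a ≠ i := by rintro rfl; exact haj (hleft j hjc)
    refine ⟨fun j' hj' => ?_, fun a' ha' => by rw [hNl a' j hjc, h2 a' ha']⟩
    rw [hNe, if_neg hai, h1 j' hj']
    have : v a = 0 := by simp [v, h1 c (ne_of_gt hjc)]
    simp [this]
  · have hjc : j = c := Fin.ext hj
    subst hjc
    have hai : a = i := by
      by_contra hc
      exact haj (hNc a hc)
    subst hai
    exact ⟨hNi, hNc⟩

theorem exists_unipotent_mul_mul_monomial (M : Matrix (Fin n) (Fin n) k) :
    ∃ u ∈ colGroup k n 0, ∃ u' ∈ colGroup k n 0,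
      MonomialBefore n ((u : Matrix (Fin n) (Fin n) k) * M * (u' : Matrix (Fin n) (Fin n) k)) := by
  have key : ∀ c ≤ n, ∃ u ∈ colGroup k n 0, ∃ u' ∈ colGroup k n 0,
      MonomialBefore c ((u : Matrix (Fin n) (Fin n) k) * M * (u' : Matrix (Fin n) (Fin n) k)) := by
    intro c
    induction c with
    | zero => exact fun _ => ⟨1, one_mem _, 1, one_mem _, fun j hj => absurd hj (Nat.not_lt_zero _)⟩
    | succ c ih =>
      intro hc
      obtain ⟨u, hu, u', hu', h⟩ := ih (by omega)
      obtain ⟨v, hv, v', hv', h'⟩ := MonomialBefore.exists_step (c := ⟨c, hc⟩) h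
      refine ⟨v * u, mul_mem hv hu, u' * v', mul_mem hu' hv', ?_⟩
      simpa only [Units.val_mul, mul_assoc] using h'
  exact key n le_rfl

theorem exists_perm_of_monomial {g : GL (Fin n) k}
    (h : MonomialBefore n (g : Matrix (Fin n) (Fin n) k)) :
    ∃ (s : Equiv.Perm (Fin n)) (t : Fin n → k), (∀ j, t j ≠ 0) ∧
      ∀ i j, g i j = if i = s j then t j else 0 := by
  have hex : ∀ j, ∃ i, g i j ≠ 0 := fun j => by
    by_contra! hc
    exact ((Matrix.isUnit_iff_isUnit_det _).1 g.isUnit).ne_zero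
      (Matrix.det_eq_zero_of_column_eq_zero j hc)
  choose s hs using hex
  have hinj : Function.Injective s := fun j j' hjj => by
    by_contra hne
    exact hs j' (hjj ▸ (h j j.2 (s j) (hs j)).1 j' (Ne.symm hne))
  refine ⟨Equiv.ofBijective s (Finite.injective_iff_bijective.1 hinj), fun j => g (s j) j, hs,
    fun i j => ?_⟩
  rw [Equiv.ofBijective_apply]
  split_ifs with hi
  · rw [hi]
  · exact (h j j.2 (s j) (hs j)).2 i hi

/-- The anti-involution `g ↦ w gᵀ w` of `GL_n`, the transposition along the antidiagonal. -/
def antiTranspose (k : Type*) [Field k] (n : ℕ) : GL (Fin n) k →* (GL (Fin n) k)ᵐᵒᵖ where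
  toFun g := MulOpposite.op
    { val := ((g : Matrix (Fin n) (Fin n) k).submatrix Fin.revPerm Fin.revPerm).transpose
      inv := (((g⁻¹ : GL (Fin n) k) : Matrix (Fin n) (Fin n) k).submatrix
        Fin.revPerm Fin.revPerm).transpose
      val_inv := by
        rw [← Matrix.transpose_mul, Matrix.submatrix_mul_equiv, ← Units.val_mul, inv_mul_cancel]
        simp
      inv_val := by
        rw [← Matrix.transpose_mul, Matrix.submatrix_mul_equiv, ← Units.val_mul, mul_inv_cancel]
        simp }
  map_one' := by
    refine MulOpposite.unop_injective (Units.ext ?_)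
    simp
  map_mul' g h := by
    refine MulOpposite.unop_injective (Units.ext ?_)
    change ((((g * h : GL (Fin n) k) : Matrix (Fin n) (Fin n) k)).submatrix _ _).transpose =
      (_ : Matrix (Fin n) (Fin n) k).transpose * (_ : Matrix (Fin n) (Fin n) k).transpose
    rw [← Matrix.transpose_mul, Matrix.submatrix_mul_equiv, Units.val_mul]

theorem antiTranspose_apply (g : GL (Fin n) k) (i j : Fin n) :
    (antiTranspose k n g).unop i j = g j.rev i.rev := rfl

theorem antiTranspose_mem {g : GL (Fin n) k} (hg : g ∈ colGroup k n 0) :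
    (antiTranspose k n g).unop ∈ colGroup k n 0 := mem_colGroup.2 fun i j hij => by
  rw [antiTranspose_apply, mem_colGroup.1 hg _ _ fun h => hij ⟨Fin.rev_lt_rev.1 h.1, Nat.zero_le _⟩,
    Matrix.one_apply, Matrix.one_apply]
  refine if_congr ⟨fun h => (Fin.rev_injective h).symm, fun h => by rw [h]⟩ rfl rfl

theorem genericChar_antiTranspose {R : Type*} [CommRing R] (ψ : AddChar k R) (u : colGroup k n 0) :
    genericChar 0 ψ ⟨_, antiTranspose_mem u.2⟩ = genericChar 0 ψ u := by
  rw [genericChar_apply, genericChar_apply, Finset.sum_comm]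
  congr 1
  rw [← Equiv.sum_comp Fin.revPerm]
  refine Finset.sum_congr rfl fun i _ => ?_
  rw [← Equiv.sum_comp Fin.revPerm]
  refine Finset.sum_congr rfl fun j _ => ?_
  simp only [Fin.revPerm_apply]
  rw [antiTranspose_apply, Fin.rev_rev, Fin.rev_rev]
  congr 1
  · rw [superWeight, Matrix.of_apply, Matrix.of_apply]
    refine if_congr ?_ rfl rfl
    simp only [Fin.val_rev]
    omega
  · congr 1
    rw [Matrix.one_apply, Matrix.one_apply]
    exact if_congr ⟨fun h => (Fin.rev_injective h).symm, fun h => by rw [h]⟩ rfl rfl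

end Bruhat

/-! ### Gelfand's trick for the generic character. -/

section Uniqueness

variable {k : Type*} [Field k] [Finite k] {n : ℕ} {C : Type*} [Field C]

open MonoidAlgebra (single)

section

variable {G : Type*} [Group G] {N : Subgroup G} [Fintype N] (χ : N →* C)

/-- The element `∑ χ(u) u⁻¹` of the group algebra. -/
def eqvElem : MonoidAlgebra C G := ∑ u : N, single ((u⁻¹ : N) : G) (χ u)

theorem eqvElem_mul_single (w : N) : eqvElem χ * single (w : G) 1 = χ w • eqvElem χ := by
  rw [eqvElem, Finset.sum_mul, Finset.smul_sum, ← Equiv.sum_comp (Equiv.mulLeft w)]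
  refine Finset.sum_congr rfl fun u _ => ?_
  rw [MonoidAlgebra.single_mul_single, MonoidAlgebra.smul_single, Equiv.coe_mulLeft, map_mul,
    mul_one, smul_eq_mul]
  congr 1
  simp

theorem single_mul_eqvElem (w : N) : single (w : G) 1 * eqvElem χ = χ w • eqvElem χ := by
  rw [eqvElem, Finset.mul_sum, Finset.smul_sum, ← Equiv.sum_comp (Equiv.mulRight w)]
  refine Finset.sum_congr rfl fun u _ => ?_
  rw [MonoidAlgebra.single_mul_single, MonoidAlgebra.smul_single, Equiv.coe_mulRight, map_mul,
    one_mul, smul_eq_mul, mul_comm]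
  congr 1
  simp

theorem asAlgebraHom_eqvElem {V : Type*} [AddCommGroup V] [Module C V] (ρ : Representation C G V) :
    ρ.asAlgebraHom (eqvElem χ) = eqvSum ρ χ := by
  rw [eqvElem, map_sum, eqvSum]
  exact Finset.sum_congr rfl fun u _ => Representation.asAlgebraHom_single _ _ _

end

variable {ψ : AddChar k C}

/-- A monomial matrix supporting a bi-equivariant function is symmetric along the antidiagonal. -/
theorem antiTranspose_eq_of_monomial [Fintype (colGroup k n 0)] (hψ : ψ ≠ 1) {g : GL (Fin n) k}
    (hg : MonomialBefore n (g : Matrix (Fin n) (Fin n) k))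
    (h : eqvElem (genericChar 0 ψ) * single g 1 * eqvElem (genericChar (k := k) (n := n) 0 ψ) ≠ 0) :
    (antiTranspose k n g).unop = g := by
  obtain ⟨s, t, ht, hst⟩ := exists_perm_of_monomial hg
  set E : MonoidAlgebra C (GL (Fin n) k) := eqvElem (genericChar 0 ψ)
  -- Since `x' g = g x`, the element `E x' g E = E g x E` is `E g E` multiplied by either of the two
  -- character values, and `E g E` is not zero.
  have hcomm : ∀ x x' : colGroup k n 0, (x' : GL (Fin n) k) * g = g * x →
      genericChar 0 ψ x = genericChar 0 ψ x' := by
    intro x x' hx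
    have e1 : E * single g 1 * (single (x : GL (Fin n) k) 1 * E) =
        E * single (x' : GL (Fin n) k) 1 * (single g 1 * E) := by
      have : single (x' : GL (Fin n) k) (1 : C) * single g 1 =
          single g 1 * single (x : GL (Fin n) k) 1 := by
        rw [MonoidAlgebra.single_mul_single, MonoidAlgebra.single_mul_single, hx]
      rw [mul_assoc E (single g 1) (_ * E), ← mul_assoc (single g 1) _ E, ← this]
      simp only [mul_assoc]
    rw [single_mul_eqvElem, eqvElem_mul_single, mul_smul_comm, smul_mul_assoc, ← mul_assoc] at e1
    exact smul_left_injective C h e1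
  -- Tested on elementary matrices of the superdiagonal, where the character is nontrivial, `hcomm`
  -- shows that wherever `s` ascends it ascends by one, with equal entries `t`.
  have hstep : ∀ j j' : Fin n, (j : ℕ) + 1 = j' →
      (s j).rev < (s j').rev ∨ (((s j').rev : ℕ) + 1 = (s j).rev ∧ t j = t j') := by
    intro j j' hjj
    have hjlt : j < j' := Fin.lt_def.2 (by omega)
    rcases lt_or_ge (s j') (s j) with hlt | hge
    · exact Or.inl (Fin.rev_lt_rev.2 hlt)
    have hlt : s j < s j' := lt_of_le_of_ne hge fun h => hjlt.ne (s.injective h)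
    refine Or.inr ?_
    have hone : ∀ (a b : Fin n) (y : k), a < b → ∀ i i', ¬ i < i' →
        ((1 : Matrix (Fin n) (Fin n) k) + Matrix.single a b y) i i' =
          (1 : Matrix (Fin n) (Fin n) k) i i' := fun a b y hab i i' hii => by
      rw [Matrix.add_apply, Matrix.single_apply_of_ne, add_zero]
      rintro ⟨rfl, rfl⟩
      exact hii hab
    have hval : ∀ (a b : Fin n) (y : k), a < b → ∀ (x : colGroup k n 0),
        ((x : GL (Fin n) k) : Matrix (Fin n) (Fin n) k) = 1 + Matrix.single a b y →
        genericChar 0 ψ x = ψ (superWeight k n a b * y) := fun a b y hab x hx => by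
      rw [genericChar_apply]
      congr 1
      rw [Finset.sum_eq_single a _ (by simp), Finset.sum_eq_single b _ (by simp)]
      · rw [hx]; simp
      · intro i _ hi
        rw [hx]; simp [hi.symm]
      · intro i _ hi
        refine Finset.sum_eq_zero fun i' _ => ?_
        rw [hx]; simp [hi.symm]
    have hall : ∀ y : k, ψ (superWeight k n j j' * y) =
        ψ (superWeight k n (s j) (s j') * (y * (t j / t j'))) := by
      intro y
      obtain ⟨x, hx, hxe⟩ := exists_mem_colGroup _ (hone j j' y hjlt)
      obtain ⟨x', hx', hxe'⟩ := exists_mem_colGroup _ (hone (s j) (s j') (y * (t j / t j')) hlt)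
      have := hcomm ⟨x, hx⟩ ⟨x', hx'⟩ (Units.ext (by
        rw [Units.val_mul, Units.val_mul]
        change (x' : Matrix (Fin n) (Fin n) k) * _ = _ * (x : Matrix (Fin n) (Fin n) k)
        rw [hxe, hxe', add_mul, mul_add, one_mul, mul_one]
        congr 1
        ext a b
        by_cases hb : b = j'
        · subst hb
          rw [Matrix.mul_single_apply_same, hst]
          by_cases ha : a = s j
          · rw [ha, Matrix.single_mul_apply_same, hst, if_pos rfl, if_pos rfl]
            have := ht b
            field_simp
          · rw [Matrix.single_mul_apply_of_ne _ _ _ _ _ ha, if_neg ha, zero_mul]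
        · rw [Matrix.mul_single_apply_of_ne _ _ _ _ _ hb]
          by_cases ha : a = s j
          · rw [ha, Matrix.single_mul_apply_same, hst, if_neg fun h => hb (s.injective h).symm,
              mul_zero]
          · rw [Matrix.single_mul_apply_of_ne _ _ _ _ _ ha]))
      rwa [hval j j' y hjlt ⟨x, hx⟩ hxe, hval _ _ _ hlt ⟨x', hx'⟩ hxe'] at this
    have hw1 : superWeight k n j j' = 1 := by rw [superWeight, Matrix.of_apply, if_pos hjj]
    have hsucc : (s j : ℕ) + 1 = s j' := by
      by_contra hc
      have hw2 : superWeight k n (s j) (s j') = 0 := by rw [superWeight, Matrix.of_apply, if_neg hc]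
      refine hψ (DFunLike.ext _ _ fun y => ?_)
      have := hall y
      rwa [hw1, hw2, one_mul, zero_mul, AddChar.map_zero_eq_one] at this
    have hw2 : superWeight k n (s j) (s j') = 1 := by
      rw [superWeight, Matrix.of_apply, if_pos hsucc]
    refine ⟨by simp only [Fin.val_rev]; omega, ?_⟩
    by_contra hne
    -- If this were invertible, `ψ` would be trivial on all its multiples, that is, everywhere.
    have hd : 1 - t j / t j' ≠ 0 := by
      rw [Ne, sub_eq_zero, eq_comm, div_eq_one_iff_eq (ht j')]
      exact hne
    refine hψ (DFunLike.ext _ _ fun y => ?_)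
    have := hall (y / (1 - t j / t j'))
    rw [hw1, hw2, one_mul, one_mul] at this
    have e : y = y / (1 - t j / t j') - y / (1 - t j / t j') * (t j / t j') := by
      field_simp
    conv_lhs => rw [e]
    rw [sub_eq_add_neg, AddChar.map_add_eq_mul, this, ← AddChar.map_add_eq_mul, add_neg_cancel,
      AddChar.map_zero_eq_one]
    rfl
  let r : Equiv.Perm (Fin n) := s.trans Fin.revPerm
  have hinv := layered_inversion (r := r) r.injective hstep
  have hr2 := layered_involutive (r := r) fun j j' hj hlt =>
    (hinv (j' - j) j j' (by have : (j : ℕ) < j' := hj; omega)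
      (by have : (j : ℕ) < j' := hj; omega) hlt).1
  have htr : ∀ j, t (r j) = t j := fun j => by
    rcases lt_trichotomy j (r j) with h | h | h
    · have h' : (j : ℕ) < r j := h
      exact (hinv (r j - j) j (r j) (by omega) (by omega) (by rw [hr2]; exact h)).2.symm
    · rw [← h]
    · have h' : (r j : ℕ) < j := h
      exact (hinv (j - r j) (r j) j (by omega) (by omega) (by rw [hr2]; exact h)).2
  have hsr : ∀ j, s (r j) = j.rev := fun j => by
    have h1 : (s (r j)).rev = j := hr2 j
    rw [← h1, Fin.rev_rev, h1]
  ext i j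
  rw [antiTranspose_apply, hst, hst]
  by_cases hi : i = s j
  · rw [if_pos hi, hi]
    have : (s j).rev = r j := rfl
    rw [this, hsr, if_pos rfl, htr]
  · rw [if_neg hi, if_neg]
    intro hc
    rw [← hsr] at hc
    have h1 : r j = i.rev := s.injective hc
    have h2 : (s j).rev = i.rev := h1
    exact hi (Fin.rev_injective h2).symm

/-- If an anti-automorphism fixes every element of `E A E`, with `A` the group algebra, these
elements commute. Transposition along the antidiagonal fixes `E`, and by the Bruhat decomposition it
is enough to look at monomial `g`, for which `E g E` is zero or `g` is its own transpose. -/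
theorem eqvElem_comm [Fintype (colGroup k n 0)] (hψ : ψ ≠ 1) (g h : GL (Fin n) k) :
    let E : MonoidAlgebra C (GL (Fin n) k) := eqvElem (genericChar 0 ψ)
    (E * single g 1 * E) * (E * single h 1 * E) = (E * single h 1 * E) * (E * single g 1 * E) := by
  intro E
  let τ : MonoidAlgebra C (GL (Fin n) k) →ₐ[C] (MonoidAlgebra C (GL (Fin n) k))ᵐᵒᵖ :=
    MonoidAlgebra.lift C _ _
      ((MonoidHom.op (MonoidAlgebra.of C (GL (Fin n) k))).comp (antiTranspose k n))
  have hτs : ∀ (g : GL (Fin n) k) (a : C),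
      τ (single g a) = MulOpposite.op (single (antiTranspose k n g).unop a) := fun g a => by
    rw [MonoidAlgebra.lift_single]
    refine MulOpposite.unop_injective ?_
    change a • single (antiTranspose k n g).unop (1 : C) = _
    rw [MonoidAlgebra.smul_single, smul_eq_mul, mul_one]
    rfl
  let inv : colGroup k n 0 → colGroup k n 0 := fun u => ⟨_, antiTranspose_mem u.2⟩
  have hinv : Function.Involutive inv := fun u => by
    refine Subtype.ext (Units.ext ?_)
    ext i j
    change (antiTranspose k n (antiTranspose k n (u : GL (Fin n) k)).unop).unop i j = _
    rw [antiTranspose_apply, antiTranspose_apply, Fin.rev_rev, Fin.rev_rev]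
  have hτE : τ E = MulOpposite.op E := by
    change τ (∑ u, _) = MulOpposite.op (∑ u, _)
    rw [map_sum, Finset.op_sum, ← Equiv.sum_comp hinv.toPerm]
    refine Finset.sum_congr rfl fun u _ => ?_
    rw [hτs]
    congr 2
    · have : ((inv u)⁻¹ : colGroup k n 0) = inv u⁻¹ := Subtype.ext (by
        change ((antiTranspose k n (u : GL (Fin n) k)).unop)⁻¹ =
          (antiTranspose k n ((u : GL (Fin n) k)⁻¹)).unop
        rw [map_inv, MulOpposite.unop_inv])
      change (inv ((inv u)⁻¹) : GL (Fin n) k) = _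
      rw [this, hinv]
    · exact genericChar_antiTranspose ψ u
  have hτg : ∀ g, τ (E * single g 1 * E) = MulOpposite.op (E * single (antiTranspose k n g).unop 1 * E) := by
    intro g
    rw [map_mul, map_mul, hτE, hτs, ← MulOpposite.op_mul, ← MulOpposite.op_mul, mul_assoc]
  have hfix : ∀ g, τ (E * single g 1 * E) = MulOpposite.op (E * single g 1 * E) := by
    intro g
    obtain ⟨u, hu, u', hu', hm⟩ := exists_unipotent_mul_mul_monomial (g : Matrix (Fin n) (Fin n) k)
    have hfm : τ (E * single (u * g * u') 1 * E) = MulOpposite.op (E * single (u * g * u') 1 * E) := by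
      by_cases h0 : E * single (u * g * u') 1 * E = 0
      · rw [h0, map_zero, MulOpposite.op_zero]
      · rw [hτg, antiTranspose_eq_of_monomial hψ hm h0]
    have e : E * single (u * g * u') 1 * E =
        (genericChar 0 ψ ⟨u, hu⟩ * genericChar 0 ψ ⟨u', hu'⟩) • (E * single g 1 * E) := by
      have : single (u * g * u') (1 : C) = single u 1 * single g 1 * single u' 1 := by
        rw [MonoidAlgebra.single_mul_single, MonoidAlgebra.single_mul_single, one_mul, one_mul]
      rw [this, mul_assoc, mul_assoc, single_mul_eqvElem _ (⟨u', hu'⟩ : colGroup k n 0), ← mul_assoc,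
        ← mul_assoc, eqvElem_mul_single _ (⟨u, hu⟩ : colGroup k n 0)]
      simp only [smul_mul_assoc, mul_smul_comm, smul_smul, mul_comm]
      rfl
    rw [e, map_smul, MulOpposite.op_smul] at hfm
    refine smul_right_injective _ ?_ hfm
    refine mul_ne_zero ?_ ?_
    · exact ((Group.isUnit (⟨u, hu⟩ : colGroup k n 0)).map (genericChar 0 ψ)).ne_zero
    · exact ((Group.isUnit (⟨u', hu'⟩ : colGroup k n 0)).map (genericChar 0 ψ)).ne_zero
  have hfixA : ∀ a, τ (E * a * E) = MulOpposite.op (E * a * E) := fun a => by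
    induction a using MonoidAlgebra.induction_on with
    | of g => exact hfix g
    | add x y hx hy => rw [mul_add, add_mul, map_add, hx, hy, MulOpposite.op_add]
    | smul r x hx => rw [mul_smul_comm, smul_mul_assoc, map_smul, hx, MulOpposite.op_smul]
  refine MulOpposite.op_injective ?_
  have h1 : E * single g 1 * E * (E * single h 1 * E) =
      E * (single g 1 * E * (E * single h 1)) * E := by simp only [mul_assoc]
  rw [h1, ← hfixA, ← h1, map_mul, hfix, hfix, ← MulOpposite.op_mul]

theorem mem_span_orbit {G V : Type*} [Group G] [AddCommGroup V] [Module C V]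
    (ρ : Representation C G V) [ρ.IsIrreducible] (v : V) (hv : v ≠ 0) (y : V) :
    y ∈ Submodule.span C (Set.range fun g => ρ g v) := by
  let Y : Subrepresentation ρ :=
    { toSubmodule := Submodule.span C (Set.range fun g => ρ g v)
      apply_mem_toSubmodule := fun g x hx => by
        have : Submodule.span C (Set.range fun g => ρ g v) ≤
            (Submodule.span C (Set.range fun g => ρ g v)).comap (ρ g) :=
          Submodule.span_le.2 (by
            rintro _ ⟨h, rfl⟩
            refine Submodule.subset_span ⟨g * h, ?_⟩
            exact (rep_apply_apply ρ g h v).symm)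
        exact this hx }
  have hvY : v ∈ Y := Submodule.subset_span ⟨1, by simp⟩
  have hY : Y = ⊤ := (eq_bot_or_eq_top Y).resolve_left fun h => hv (by
    rw [h] at hvY; exact hvY)
  have : y ∈ Y := by rw [hY]; trivial
  exact this

theorem finiteDimensional_of_isIrreducible {G V : Type*} [Group G] [Finite G] [AddCommGroup V]
    [Module C V] (ρ : Representation C G V) [ρ.IsIrreducible] : FiniteDimensional C V := by
  by_cases h : ∃ v : V, v ≠ 0
  · obtain ⟨v, hv⟩ := h
    exact ⟨⟨(Set.finite_range fun g => ρ g v).toFinset, by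
      rw [Set.Finite.coe_toFinset, eq_top_iff]
      exact fun y _ => mem_span_orbit ρ v hv y⟩⟩
  · push Not at h
    have : Subsingleton V := ⟨fun a b => (h a).trans (h b).symm⟩
    infer_instance

/-- The Whittaker vectors of an irreducible representation form at most a line. -/
theorem exists_eqvSum_eq_smul [IsAlgClosed C] [CharZero C] [Fintype (colGroup k n 0)] (hψ : ψ ≠ 1)
    {V : Type*} [AddCommGroup V] [Module C V] [FiniteDimensional C V]
    (ρ : Representation C (GL (Fin n) k) V) [ρ.IsIrreducible] :
    ∃ w : V, ∀ v, ∃ c : C, eqvSum ρ (genericChar (k := k) (n := n) 0 ψ) v = c • w := by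
  set e : V →ₗ[C] V := eqvSum ρ (genericChar (k := k) (n := n) 0 ψ) with he
  by_cases h0 : ∃ v, e v ≠ 0
  swap
  · push Not at h0
    exact ⟨0, fun v => ⟨0, by rw [h0, smul_zero]⟩⟩
  obtain ⟨v₀, hv₀⟩ := h0
  have hcomm : ∀ g h v, e (ρ g (e (e (ρ h (e v))))) = e (ρ h (e (e (ρ g (e v))))) := fun g h v => by
    have := congrArg (fun a => ρ.asAlgebraHom a v) (eqvElem_comm hψ g h)
    simpa only [map_mul, asAlgebraHom_eqvElem, Representation.asAlgebraHom_single, one_smul,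
      Module.End.mul_apply] using this
  have hN : (Nat.card (colGroup k n 0) : C) ≠ 0 := Nat.cast_ne_zero.2 Nat.card_pos.ne'
  have hee : ∀ v, e (e v) = (Nat.card (colGroup k n 0) : C) • e v := fun v => by
    rw [Nat.cast_smul_eq_nsmul]; exact eqvSum_eqvSum v
  have hspan := mem_span_orbit ρ
  let X : GL (Fin n) k → Module.End C (LinearMap.range e) := fun g =>
    (e ∘ₗ ρ g).restrict fun x _ => ⟨ρ g x, rfl⟩
  have : Nontrivial (LinearMap.range e) := ⟨⟨e v₀, v₀, rfl⟩, 0, fun h => hv₀ (congrArg Subtype.val h)⟩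
  -- The operators `e ρ(g) e` commute with each other, and an eigenvector `e v₁` of one of them
  -- generates the whole representation; so each is a scalar on the image of `e`.
  have hscal : ∀ g, ∃ μ : C, ∀ v, e (ρ g (e v)) = μ • e v := fun g => by
    obtain ⟨μ, hμ⟩ := Module.End.exists_eigenvalue (X g)
    obtain ⟨⟨_, v₁, rfl⟩, hx⟩ := hμ.exists_hasEigenvector
    have hx0 : e v₁ ≠ 0 := fun h => hx.2 (Subtype.ext h)
    have hxe : e (ρ g (e v₁)) = μ • e v₁ := congrArg Subtype.val hx.apply_eq_smul
    refine ⟨μ, fun v => ?_⟩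
    have key : ∀ y ∈ Submodule.span C (Set.range fun h => ρ h (e v₁)), e (ρ g (e y)) = μ • e y := by
      intro y hy
      induction hy using Submodule.span_induction with
      | mem y hy =>
        obtain ⟨h, rfl⟩ := hy
        have h1 := hcomm g h v₁
        rw [hee, hee, map_smul, map_smul, map_smul, map_smul] at h1
        rw [smul_right_injective V hN h1, hxe, map_smul, map_smul]
      | zero => simp
      | add x y _ _ hx hy => rw [map_add, map_add, map_add, hx, hy, smul_add]
      | smul a x _ hx => rw [map_smul, map_smul, map_smul, hx, smul_comm]
    exact key v (hspan _ hx0 v)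
  choose μ hμ using hscal
  refine ⟨e v₀, fun v => ?_⟩
  have key : ∀ y ∈ Submodule.span C (Set.range fun h => ρ h (e v₀)), ∃ c : C, e y = c • e v₀ := by
    intro y hy
    induction hy using Submodule.span_induction with
    | mem y hy =>
      obtain ⟨h, rfl⟩ := hy
      exact ⟨_, hμ h v₀⟩
    | zero => exact ⟨0, by simp⟩
    | add x y _ _ hx hy =>
      obtain ⟨a, ha⟩ := hx
      obtain ⟨b, hb⟩ := hy
      exact ⟨a + b, by rw [map_add, ha, hb, add_smul]⟩
    | smul a x _ hx =>
      obtain ⟨b, hb⟩ := hx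
      exact ⟨a * b, by rw [map_smul, hb, smul_smul]⟩
  exact key v (hspan _ hv₀ v)

end Uniqueness

/-! ## Reductions of cuspidal representations -/

section Residue

variable (l : ℕ) [Fact l.Prime]

/-- A monic polynomial lifts to a monic one over `ℤ̄_ℓ`. Its root in `ℚ̄_ℓ` is integral, hence lies
in `ℤ̄_ℓ` and can be reduced. -/
instance isAlgClosed_FlBar : IsAlgClosed (FlBar l) := by
  refine IsAlgClosed.of_exists_root _ fun f hf hirr => ?_
  have hl : f ∈ Polynomial.lifts (IsLocalRing.residue (ZlBar l)) := by
    rw [Polynomial.lifts_iff_coeff_lifts]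
    exact fun n => IsLocalRing.residue_surjective _
  obtain ⟨q, hq, hqd, hqm⟩ := Polynomial.lifts_and_natDegree_eq_and_monic hl hf
  have hdeg : (q.map (algebraMap (ZlBar l) (PadicAlgCl l))).degree ≠ 0 := by
    rw [hqm.degree_map, Polynomial.degree_eq_natDegree hqm.ne_zero, hqd]
    exact_mod_cast hirr.natDegree_pos.ne'
  obtain ⟨x, hx⟩ := IsAlgClosed.exists_root _ hdeg
  rw [Polynomial.IsRoot, Polynomial.eval_map_algebraMap] at hx
  obtain ⟨y, rfl⟩ := IsIntegrallyClosed.isIntegral_iff.1 (⟨q, hqm, hx⟩ : IsIntegral (ZlBar l) x)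
  refine ⟨IsLocalRing.residue _ y, ?_⟩
  rw [Polynomial.aeval_algebraMap_apply] at hx
  have hy : q.eval y = 0 :=
    FaithfulSMul.algebraMap_injective (ZlBar l) (PadicAlgCl l) (by rw [map_zero]; exact hx)
  rw [← hq, Polynomial.eval_map, Polynomial.eval₂_hom, hy, map_zero]

/-- A character of a finite field with values in `ℤ̄_ℓ` that is nontrivial modulo `𝔩`. -/
theorem exists_addChar (k : Type*) [Field k] [Finite k] (p : ℕ) [Fact p.Prime] [CharP k p]
    (hlp : l ≠ p) : ∃ ψ : AddChar k (ZlBar l),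
      (IsLocalRing.residue (ZlBar l) : ZlBar l →* FlBar l).compAddChar ψ ≠ 1 := by
  have hp : p.Prime := Fact.out
  obtain ⟨ζ, hζ⟩ := HasEnoughRootsOfUnity.exists_primitiveRoot (PadicAlgCl l) p
  have hζi : ζ ∈ ZlBar l := by
    rw [mem_ZlBar_iff_isIntegral]
    exact IsIntegral.of_pow hp.pos (by rw [hζ.pow_eq_one]; exact isIntegral_one)
  let z : ZlBar l := ⟨ζ, hζi⟩
  have hz : z ^ p = 1 := Subtype.ext hζ.pow_eq_one
  -- Otherwise `1 + ζ + ⋯ + ζ ^ (p - 1) = 0` would reduce to `p = 0`, while `p` is invertible modulo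
  -- `𝔩`.
  have hz1 : IsLocalRing.residue (ZlBar l) z ≠ 1 := fun h => by
    have h1 : ∑ i ∈ Finset.range p, z ^ i = 0 := Subtype.ext (by
      push_cast
      exact hζ.geom_sum_eq_zero hp.one_lt)
    have h2 := congrArg (IsLocalRing.residue (ZlBar l)) h1
    rw [map_sum, map_zero, Finset.sum_congr rfl fun i _ => by rw [map_pow, h, one_pow]] at h2
    rw [Finset.sum_const, Finset.card_range, nsmul_one] at h2
    exact (isUnit_natCast_FlBar l hp hlp).ne_zero h2
  let _ : Algebra (ZMod p) k := ZMod.algebra k p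
  obtain ⟨f, hf⟩ : ∃ f : Module.Dual (ZMod p) k, f 1 ≠ 0 := by
    by_contra! hc
    exact one_ne_zero ((Module.forall_dual_apply_eq_zero_iff (ZMod p) (1 : k)).1 hc)
  refine ⟨(AddChar.zmodChar p hz).compAddMonoidHom f.toAddMonoidHom, AddChar.ne_one_iff.2
    ⟨(f 1)⁻¹ • 1, ?_⟩⟩
  have h1 : f ((f 1)⁻¹ • 1) = 1 := by rw [map_smul, smul_eq_mul, inv_mul_cancel₀ hf]
  change IsLocalRing.residue (ZlBar l) (AddChar.zmodChar p hz (f ((f 1)⁻¹ • 1))) ≠ 1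
  rw [h1, AddChar.zmodChar_apply, ZMod.val_one, pow_one]
  exact hz1

end Residue

section Lattices

variable {l : ℕ} [Fact l.Prime] {G V : Type*} [Group G] [AddCommGroup V] [Module (PadicAlgCl l) V]
  {π : Representation (PadicAlgCl l) G V}

/-- A basis over `ℤ̄_ℓ` remains independent over the fraction field. -/
theorem IsLattice.finite [FiniteDimensional (PadicAlgCl l) V]
    {L : Subrepresentation (integralRestrict l π)} (h : IsLattice l L) :
    Module.Finite (ZlBar l) L.toSubmodule := by
  have := h.1
  let b := Module.Free.chooseBasis (ZlBar l) L.toSubmodule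
  have h1 : LinearIndependent (ZlBar l) fun i => (b i : V) :=
    b.linearIndependent.map' L.toSubmodule.subtype (Submodule.ker_subtype _)
  have h2 : LinearIndependent (PadicAlgCl l) fun i => (b i : V) :=
    (LinearIndependent.iff_fractionRing (ZlBar l) (PadicAlgCl l)).1 h1
  have := h2.finite
  exact Module.Finite.of_basis b

/-- The vectors `π(g) T^i b_j` are finitely many, as `G` is finite and `T ^ r = 1`, and `T` maps
them among themselves because `T π(h) = π(φ h) T`. -/
theorem exists_isLattice_of_twist [Finite G] [FiniteDimensional (PadicAlgCl l) V]
    (π : Representation (PadicAlgCl l) G V) {φ : G →* G} {T : V →ₗ[PadicAlgCl l] V} {r : ℕ}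
    (hr : 0 < r) (hT : IsTwistOperator φ r π T) :
    ∃ L : Subrepresentation (integralRestrict l π), IsLattice l L ∧ ∀ x ∈ L, T x ∈ L := by
  let b := Module.finBasis (PadicAlgCl l) V
  let F : G × Fin r × Fin (Module.finrank (PadicAlgCl l) V) → V := fun q =>
    π q.1 ((T ^ (q.2.1 : ℕ)) (b q.2.2))
  have hmem : ∀ g (i : ℕ) j, π g ((T ^ i) (b j)) ∈ Submodule.span (ZlBar l) (Set.range F) := by
    intro g i j
    refine Submodule.subset_span ⟨(g, ⟨i % r, Nat.mod_lt _ hr⟩, j), ?_⟩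
    change π g ((T ^ (i % r)) (b j)) = _
    rw [pow_eq_pow_mod i hT.2]
  let L : Subrepresentation (integralRestrict l π) :=
    { toSubmodule := Submodule.span (ZlBar l) (Set.range F)
      apply_mem_toSubmodule := fun g x hx => by
        have : Submodule.span (ZlBar l) (Set.range F) ≤
            (Submodule.span (ZlBar l) (Set.range F)).comap (integralRestrict l π g) :=
          Submodule.span_le.2 (by
            rintro _ ⟨⟨h, i, j⟩, rfl⟩
            have := hmem (g * h) i j
            rw [← rep_apply_apply] at this
            exact this)
        exact this hx }
  refine ⟨L, ⟨free_of_fg ⟨(Set.finite_range F).toFinset, by simp [L]⟩, ?_⟩, fun x hx => ?_⟩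
  · rw [eq_top_iff, ← b.span_eq]
    refine Submodule.span_mono ?_
    rintro _ ⟨j, rfl⟩
    have := hmem 1 0 j
    rwa [map_one, pow_zero] at this
  · have : Submodule.span (ZlBar l) (Set.range F) ≤
        (Submodule.span (ZlBar l) (Set.range F)).comap (T.restrictScalars (ZlBar l)) :=
      Submodule.span_le.2 (by
        rintro _ ⟨⟨h, i, j⟩, rfl⟩
        change T (π h ((T ^ (i : ℕ)) (b j))) ∈ Submodule.span (ZlBar l) (Set.range F)
        rw [hT.1, ← Module.End.mul_apply T, ← pow_succ']
        exact hmem _ _ j)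
    exact this hx

theorem exists_isLattice [Finite G] [FiniteDimensional (PadicAlgCl l) V]
    (π : Representation (PadicAlgCl l) G V) :
    ∃ L : Subrepresentation (integralRestrict l π), IsLattice l L := by
  obtain ⟨L, hL, -⟩ := exists_isLattice_of_twist π (φ := MonoidHom.id G) (T := 1) one_pos
    ⟨fun _ _ => rfl, pow_one _⟩
  exact ⟨L, hL⟩

theorem one_tmul_eq_zero_iff {M ι : Type*} [AddCommGroup M] [Module (ZlBar l) M]
    (b : Module.Basis ι (ZlBar l) M) {x : M} :
    (1 : FlBar l) ⊗ₜ[ZlBar l] x = 0 ↔ ∀ i, IsLocalRing.residue (ZlBar l) (b.repr x i) = 0 := by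
  have key : ∀ i, (b.baseChange (FlBar l)).repr (1 ⊗ₜ x) i =
      IsLocalRing.residue (ZlBar l) (b.repr x i) := fun i => by
    rw [Module.Basis.baseChange_repr_tmul, Algebra.smul_def, mul_one]
    rfl
  rw [← (b.baseChange (FlBar l)).repr.map_eq_zero_iff, Finsupp.ext_iff]
  exact forall_congr' fun i => by rw [key]; rfl

theorem IsLattice.nontrivial_modL [Nontrivial V] {L : Subrepresentation (integralRestrict l π)}
    (h : IsLattice l L) : Nontrivial (FlBar l ⊗[ZlBar l] L.toSubmodule) := by
  have := h.1
  let b := Module.Free.chooseBasis (ZlBar l) L.toSubmodule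
  have hne : Nonempty (Module.Free.ChooseBasisIndex (ZlBar l) L.toSubmodule) := by
    by_contra hc
    rw [not_nonempty_iff] at hc
    have h0 : ∀ x ∈ L.toSubmodule, x = 0 := fun x hx => by
      have : (⟨x, hx⟩ : L.toSubmodule) = 0 := b.repr.injective (Subsingleton.elim _ _)
      exact congrArg Subtype.val this
    have h1 : Submodule.span (PadicAlgCl l) (L.toSubmodule : Set V) ≤ ⊥ :=
      Submodule.span_le.2 fun x hx => h0 x hx
    rw [h.2] at h1
    exact top_ne_bot (le_bot_iff.1 h1)
  obtain ⟨i⟩ := hne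
  refine ⟨1 ⊗ₜ b i, 0, fun h => ?_⟩
  have := (one_tmul_eq_zero_iff b).1 h i
  simp at this

theorem zlBar_dvd_or (a b : PadicAlgCl l) : ∃ c : ZlBar l, a = c * b ∨ b = c * a := by
  rcases le_total (Valued.v a : NNReal) (Valued.v b) with h | h
  · by_cases hb : b = 0
    · subst hb
      rw [map_zero, le_zero_iff, map_eq_zero] at h
      exact ⟨0, Or.inl (by simp [h])⟩
    · refine ⟨⟨a / b, ?_⟩, Or.inl (div_mul_cancel₀ a hb).symm⟩
      rw [Valuation.mem_integer_iff, map_div₀]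
      exact div_le_one_of_le₀ h zero_le
  · by_cases ha : a = 0
    · subst ha
      rw [map_zero, le_zero_iff, map_eq_zero] at h
      exact ⟨0, Or.inl (by simp [h])⟩
    · refine ⟨⟨b / a, ?_⟩, Or.inr (div_mul_cancel₀ b ha).symm⟩
      rw [Valuation.mem_integer_iff, map_div₀]
      exact div_le_one_of_le₀ h zero_le

/-- Two lattices with irreducible reduction are homothetic. -/
theorem IsLattice.exists_homothety [Nontrivial V] [FiniteDimensional (PadicAlgCl l) V]
    {L L' : Subrepresentation (integralRestrict l π)} (hL : IsLattice l L) (hL' : IsLattice l L')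
    [hirr : (modL l L.toRepresentation).IsIrreducible] :
    ∃ c : PadicAlgCl l, c ≠ 0 ∧ ∀ x, x ∈ L ↔ c • x ∈ L' := by
  have := hL.1
  have := hL'.1
  have := hL.finite
  have := hL'.finite
  let b := Module.Free.chooseBasis (ZlBar l) L.toSubmodule
  let b' := Module.Free.chooseBasis (ZlBar l) L'.toSubmodule
  have hli : LinearIndependent (PadicAlgCl l) fun i => (b i : V) :=
    (LinearIndependent.iff_fractionRing (ZlBar l) (PadicAlgCl l)).1
      (b.linearIndependent.map' L.toSubmodule.subtype (Submodule.ker_subtype _))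
  have hsp : ⊤ ≤ Submodule.span (PadicAlgCl l) (Set.range fun i => (b i : V)) := by
    rw [← hL.2, Submodule.span_le]
    intro x hx
    have hx' : _ = x := congrArg Subtype.val (b.sum_repr ⟨x, hx⟩)
    rw [AddSubmonoidClass.coe_finsetSum] at hx'
    rw [← hx']
    refine Submodule.sum_mem _ fun i _ => ?_
    exact Submodule.smul_mem _ ((b.repr ⟨x, hx⟩ i : ZlBar l) : PadicAlgCl l)
      (Submodule.subset_span ⟨i, rfl⟩)
  let B := Module.Basis.mk hli hsp
  have hBb : ∀ i, B i = b i := fun i => Module.Basis.mk_apply hli hsp i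
  have hmemL : ∀ x : V, (∀ i, B.repr x i ∈ ZlBar l) → x ∈ L := fun x hx => by
    rw [← B.sum_repr x]
    refine Submodule.sum_mem L.toSubmodule fun i _ => ?_
    rw [hBb]
    exact L.toSubmodule.smul_mem (⟨_, hx i⟩ : ZlBar l) (b i).2
  have hrepr : ∀ (x : L.toSubmodule) i, B.repr (x : V) i = b.repr x i := fun x i => by
    conv_lhs => rw [← b.sum_repr x]
    simp only [AddSubmonoidClass.coe_finsetSum, map_sum, Finsupp.coe_finsetSum, Finset.sum_apply]
    rw [Finset.sum_eq_single i]
    · have : ((b.repr x i • b i : L.toSubmodule) : V) =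
          ((b.repr x i : ZlBar l) : PadicAlgCl l) • B i := by rw [hBb]; rfl
      rw [this, map_smul, Finsupp.smul_apply, Module.Basis.repr_self, Finsupp.single_eq_same,
        smul_eq_mul, mul_one]
    · intro j _ hj
      have : ((b.repr x j • b j : L.toSubmodule) : V) =
          ((b.repr x j : ZlBar l) : PadicAlgCl l) • B j := by rw [hBb]; rfl
      rw [this, map_smul, Finsupp.smul_apply, Module.Basis.repr_self, Finsupp.single_eq_of_ne hj.symm,
        smul_zero]
    · simp
  obtain ⟨v, hv⟩ := exists_ne (0 : V)
  have hne' : ∃ j, (b' j : V) ≠ 0 := by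
    by_contra! hc
    have h1 : Submodule.span (PadicAlgCl l) (L'.toSubmodule : Set V) ≤ ⊥ := by
      refine Submodule.span_le.2 fun x hx => ?_
      have hx' : _ = x := congrArg Subtype.val (b'.sum_repr ⟨x, hx⟩)
      rw [AddSubmonoidClass.coe_finsetSum] at hx'
      rw [← hx']
      refine Submodule.sum_mem _ fun i _ => ?_
      have : ((b'.repr ⟨x, hx⟩ i • b' i : L'.toSubmodule) : V) = b'.repr ⟨x, hx⟩ i • (b' i : V) := rfl
      rw [this, hc, smul_zero]
      exact zero_mem _
    rw [hL'.2] at h1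
    exact top_ne_bot (le_bot_iff.1 h1)
  obtain ⟨j₁, hj₁⟩ := hne'
  have : Nonempty (Module.Free.ChooseBasisIndex (ZlBar l) L'.toSubmodule ×
      Module.Free.ChooseBasisIndex (ZlBar l) L.toSubmodule) := by
    refine ⟨j₁, Classical.choice ?_⟩
    by_contra hc
    rw [not_nonempty_iff] at hc
    exact hj₁ (B.repr.injective (Subsingleton.elim _ _))
  -- The largest coordinate of a basis of `L'` with respect to a basis of `L`: dividing by it puts
  -- `L'` inside `L` but not inside `𝔩 L`.
  obtain ⟨⟨j₀, i₀⟩, hmax⟩ := Finite.exists_max fun q :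
    Module.Free.ChooseBasisIndex (ZlBar l) L'.toSubmodule ×
      Module.Free.ChooseBasisIndex (ZlBar l) L.toSubmodule =>
        (Valued.v (B.repr (b' q.1 : V) q.2) : NNReal)
  set c := B.repr (b' j₀ : V) i₀ with hc
  have hc0 : c ≠ 0 := fun h0 => hj₁ (B.repr.injective (Finsupp.ext fun i => by
    have := hmax (j₁, i)
    simp only [h0, map_zero, le_zero_iff, map_eq_zero] at this
    rw [this, map_zero]
    rfl))
  have hsub : ∀ x ∈ L', c⁻¹ • x ∈ L := fun x hx => by
    have hx' := congrArg Subtype.val (b'.sum_repr ⟨x, hx⟩)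
    simp only [AddSubmonoidClass.coe_finsetSum] at hx'
    rw [← hx', Finset.smul_sum]
    refine Submodule.sum_mem L.toSubmodule fun j _ => ?_
    have : c⁻¹ • ((b'.repr ⟨x, hx⟩ j • b' j : L'.toSubmodule) : V) =
        b'.repr ⟨x, hx⟩ j • (c⁻¹ • (b' j : V)) := smul_comm c⁻¹ (b'.repr ⟨x, hx⟩ j) (b' j : V)
    rw [this]
    refine L.toSubmodule.smul_mem _ (hmemL _ fun i => ?_)
    rw [map_smul, Finsupp.smul_apply, smul_eq_mul, Valuation.mem_integer_iff, map_mul, map_inv₀,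
      mul_comm, ← div_eq_mul_inv]
    exact div_le_one_of_le₀ (hmax (j, i)) zero_le
  -- The image of `c⁻¹ L'` in `L / 𝔩 L`. It is a nonzero subrepresentation, hence everything, and
  -- Nakayama's lemma gives `c⁻¹ L' = L`.
  let Y : Subrepresentation (modL l L.toRepresentation) :=
    { toSubmodule :=
        { carrier := {y | ∃ x : L.toSubmodule, c • (x : V) ∈ L' ∧ y = 1 ⊗ₜ x}
          zero_mem' := ⟨0, by rw [Submodule.coe_zero, smul_zero]; exact L'.toSubmodule.zero_mem,
            (TensorProduct.tmul_zero _ _).symm⟩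
          add_mem' := by
            rintro _ _ ⟨x, hx, rfl⟩ ⟨y, hy, rfl⟩
            refine ⟨x + y, ?_, (TensorProduct.tmul_add _ _ _).symm⟩
            rw [Submodule.coe_add, smul_add]
            exact L'.toSubmodule.add_mem hx hy
          smul_mem' := by
            rintro a _ ⟨x, hx, rfl⟩
            obtain ⟨a, rfl⟩ := IsLocalRing.residue_surjective a
            refine ⟨a • x, ?_, ?_⟩
            · have : c • ((a • x : L.toSubmodule) : V) = a • (c • (x : V)) := smul_comm c a (x : V)
              rw [this]
              exact L'.toSubmodule.smul_mem a hx
            · rw [TensorProduct.tmul_smul]; rfl }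
      apply_mem_toSubmodule := by
        rintro g _ ⟨x, hx, rfl⟩
        refine ⟨L.toRepresentation g x, ?_, rfl⟩
        have : c • ((L.toRepresentation g x : L.toSubmodule) : V) = π g (c • (x : V)) :=
          ((π g).map_smul c (x : V)).symm
        rw [this]
        exact L'.apply_mem_toSubmodule g hx }
  have hYtop : Y = ⊤ := by
    refine (eq_bot_or_eq_top Y).resolve_left fun hbot => ?_
    let x₀ : L.toSubmodule := ⟨c⁻¹ • (b' j₀ : V), hsub _ (b' j₀).2⟩
    have hx₀ : (1 : FlBar l) ⊗ₜ[ZlBar l] x₀ ∈ Y :=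
      ⟨x₀, by rw [smul_inv_smul₀ hc0]; exact (b' j₀).2, rfl⟩
    rw [hbot] at hx₀
    have h1 := (one_tmul_eq_zero_iff b).1 hx₀ i₀
    have h2 : b.repr x₀ i₀ = 1 := Subtype.ext (by
      rw [← hrepr, map_smul, Finsupp.smul_apply, smul_eq_mul]
      exact inv_mul_cancel₀ hc0)
    rw [h2, map_one] at h1
    exact one_ne_zero h1
  let N : Submodule (ZlBar l) L.toSubmodule :=
    L'.toSubmodule.comap (((LinearMap.lsmul (PadicAlgCl l) V c).restrictScalars (ZlBar l)) ∘ₗ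
      L.toSubmodule.subtype)
  have hN : (⊤ : Submodule (ZlBar l) L.toSubmodule) ≤ N := by
    refine Submodule.le_of_le_smul_of_le_jacobson_bot (I := IsLocalRing.maximalIdeal (ZlBar l))
      Module.Finite.fg_top (IsLocalRing.maximalIdeal_le_jacobson _) fun x _ => ?_
    have hx : (1 : FlBar l) ⊗ₜ[ZlBar l] x ∈ Y := by rw [hYtop]; trivial
    obtain ⟨y, hy, hxy⟩ := hx
    rw [← sub_eq_zero, ← TensorProduct.tmul_sub, one_tmul_eq_zero_iff b] at hxy
    rw [← add_sub_cancel y x]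
    refine Submodule.add_mem_sup hy ?_
    rw [← b.sum_repr (x - y)]
    refine Submodule.sum_mem _ fun i _ => Submodule.smul_mem_smul ?_ trivial
    exact (IsLocalRing.residue_eq_zero_iff _).1 (hxy i)
  refine ⟨c, hc0, fun x => ⟨fun hx => hN (x := ⟨x, hx⟩) trivial, fun hx => ?_⟩⟩
  have := hsub _ hx
  rwa [inv_smul_smul₀ hc0] at this

end Lattices

section Reduction

variable {k : Type*} [Field k] [Finite k] {n : ℕ} {l : ℕ} [Fact l.Prime] {p : ℕ} [Fact p.Prime]
  [CharP k p]

theorem nontrivial_of_isIrreducible {C G V : Type*} [Field C] [Group G] [AddCommGroup V] [Module C V]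
    (ρ : Representation C G V) [hρ : ρ.IsIrreducible] : Nontrivial V := by
  by_contra hc
  rw [not_nontrivial_iff_subsingleton] at hc
  refine bot_ne_top (α := Subrepresentation ρ) (Subrepresentation.toSubmodule_injective ?_)
  exact Subsingleton.elim (α := Submodule C V) _ _

/-- The reduction of an irreducible cuspidal representation is irreducible. -/
theorem IsLattice.modL_isIrreducible (hlp : l ≠ p) {V : Type*} [AddCommGroup V]
    [Module (PadicAlgCl l) V] {π : Representation (PadicAlgCl l) (GL (Fin n) k) V}
    [hirr : π.IsIrreducible] (hπ : CuspSum π)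
    {L : Subrepresentation (integralRestrict l π)} (hL : IsLattice l L) :
    (modL l L.toRepresentation).IsIrreducible := by
  have := Fintype.ofFinite (colGroup k n 0)
  have hfin := finiteDimensional_of_isIrreducible π
  have hVn := nontrivial_of_isIrreducible π
  have hMn := hL.nontrivial_modL
  obtain ⟨ψ, hψ⟩ := exists_addChar l k p hlp
  set ψF := (IsLocalRing.residue (ZlBar l) : ZlBar l →* FlBar l).compAddChar ψ with hψF
  set ψC := ((algebraMap (ZlBar l) (PadicAlgCl l) : ZlBar l →+* PadicAlgCl l) :
    ZlBar l →* PadicAlgCl l).compAddChar ψ with hψC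
  have hψC1 : ψC ≠ 1 := fun h => hψ (DFunLike.ext _ _ fun x => by
    have h1 : ((ψ x : ZlBar l) : PadicAlgCl l) = 1 := DFunLike.congr_fun h x
    have h2 : ψ x = 1 := Subtype.ext h1
    change IsLocalRing.residue (ZlBar l) (ψ x) = 1
    rw [h2, map_one])
  have hcM : CuspSum (modL l L.toRepresentation) := (hπ.integralRestrict.toRepresentation L).modL
  have hpF := isUnit_natCast_FlBar l (Fact.out : p.Prime) hlp
  set eL := eqvSum L.toRepresentation (genericChar (k := k) (n := n) 0 ψ) with heL
  have heV : ∀ x : L.toSubmodule, (eL x : V) = eqvSum π (genericChar 0 ψC) (x : V) := fun x => by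
    rw [heL, eqvSum_apply, eqvSum_apply, AddSubmonoidClass.coe_finsetSum]
    rfl
  have heM : ∀ x : L.toSubmodule, eqvSum (modL l L.toRepresentation) (genericChar 0 ψF) (1 ⊗ₜ x) =
      (1 : FlBar l) ⊗ₜ[ZlBar l] eL x := fun x => by
    rw [heL, eqvSum_apply, eqvSum_apply, TensorProduct.tmul_sum]
    refine Finset.sum_congr rfl fun u _ => ?_
    rw [TensorProduct.tmul_smul]
    rfl
  obtain ⟨w, hw⟩ := exists_eqvSum_eq_smul hψC1 π
  -- Over `ℚ̄_ℓ` the image of the Whittaker projector is at most a line, and of two scalars one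
  -- divides the other over the valuation ring `ℤ̄_ℓ`.
  have hprop : ∀ x y : L.toSubmodule, ∃ c : ZlBar l, eL x = c • eL y ∨ eL y = c • eL x := by
    intro x y
    obtain ⟨a, ha⟩ := hw x
    obtain ⟨b, hb⟩ := hw y
    obtain ⟨c, hc | hc⟩ := zlBar_dvd_or a b
    · refine ⟨c, Or.inl (Subtype.ext ?_)⟩
      rw [heV, ha, hc, mul_smul, ← hb, ← heV]
      rfl
    · refine ⟨c, Or.inr (Subtype.ext ?_)⟩
      rw [heV, hb, hc, mul_smul, ← ha, ← heV]
      rfl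
  obtain ⟨a, ha⟩ := card_patternGroup (k := k) (p := p) (n := n)
    (Ω := fun i j => i < j ∧ 0 ≤ (j : ℕ)) (hΩ := colRel_trans _) fun i j h => h.1
  have hcard : (Nat.card (colGroup k n 0) : FlBar l) ≠ 0 := by
    have : Nat.card (colGroup k n 0) = p ^ a := ha
    rw [this, Nat.cast_pow]
    exact pow_ne_zero _ hpF.ne_zero
  refine { eq_bot_or_eq_top := fun Y => ?_, exists_pair_ne := ⟨⊥, ⊤, fun h => ?_⟩ }
  · obtain ⟨y, hy⟩ := exists_ne (0 : FlBar l ⊗[ZlBar l] L.toSubmodule)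
    have : y ∈ (⊤ : Subrepresentation (modL l L.toRepresentation)) := trivial
    rw [← h] at this
    exact hy this
  by_contra! hY
  obtain ⟨hY0, hY1⟩ := hY
  have hYn : Nontrivial Y.toSubmodule := by
    rw [Submodule.nontrivial_iff_ne_bot]
    exact fun h => hY0 (Subrepresentation.toSubmodule_injective h)
  have hQn : Nontrivial ((FlBar l ⊗[ZlBar l] L.toSubmodule) ⧸ Y.toSubmodule) := by
    rw [Submodule.Quotient.nontrivial_iff]
    exact fun h => hY1 (Subrepresentation.toSubmodule_injective h)
  -- A proper nonzero `Y` and its quotient are both cuspidal and have Whittaker vectors. Their lifts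
  -- to `L`, projected by `eL`, are multiples of each other in one direction, yet one reduces to a
  -- nonzero element of `Y` and the other reduces outside `Y`: a contradiction either way.
  obtain ⟨⟨y, hyY⟩, hy0, hy⟩ := (hcM.toRepresentation Y).exists_generic hpF hψ
  obtain ⟨q, hq0, hq⟩ := (hcM.quotient Y.toSubmodule
    (fun g _ hx => Y.apply_mem_toSubmodule g hx)).exists_generic hpF hψ
  obtain ⟨z, rfl⟩ := Submodule.mkQ_surjective _ q
  obtain ⟨x, rfl⟩ := exists_one_tmul l y
  obtain ⟨x', rfl⟩ := exists_one_tmul l z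
  have h1 : (1 : FlBar l) ⊗ₜ[ZlBar l] eL x = (Nat.card (colGroup k n 0) : FlBar l) • 1 ⊗ₜ x := by
    rw [← heM, Nat.cast_smul_eq_nsmul]
    exact eqvSum_of_eqv fun u => congrArg Subtype.val (hy u)
  have h1Y : (1 : FlBar l) ⊗ₜ[ZlBar l] eL x ∈ Y.toSubmodule := by
    rw [h1]; exact Y.toSubmodule.smul_mem _ hyY
  have h10 : (1 : FlBar l) ⊗ₜ[ZlBar l] eL x ≠ 0 := by
    rw [h1]
    exact smul_ne_zero hcard fun h => hy0 (Subtype.ext h)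
  have h2 : (1 : FlBar l) ⊗ₜ[ZlBar l] eL x' ∉ Y.toSubmodule := by
    intro hc
    rw [← heM] at hc
    have e1 := (Submodule.Quotient.mk_eq_zero _).2 hc
    have e2 := eqvSum_of_eqv (χ := genericChar 0 ψF) hq
    have e3 : Y.toSubmodule.mkQ (eqvSum (modL l L.toRepresentation) (genericChar 0 ψF) (1 ⊗ₜ x')) =
        Nat.card (colGroup k n 0) • Y.toSubmodule.mkQ (1 ⊗ₜ x') := by
      rw [← e2, eqvSum_apply, eqvSum_apply, map_sum]
      exact Finset.sum_congr rfl fun u _ => map_smul _ _ _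
    have e4 : Y.toSubmodule.mkQ (eqvSum (modL l L.toRepresentation) (genericChar 0 ψF) (1 ⊗ₜ x')) = 0 := e1
    rw [e4, ← Nat.cast_smul_eq_nsmul (FlBar l)] at e3
    exact smul_ne_zero hcard hq0 e3.symm
  have hres : ∀ (c : ZlBar l) (x : L.toSubmodule), (1 : FlBar l) ⊗ₜ[ZlBar l] (c • x) =
      IsLocalRing.residue (ZlBar l) c • (1 : FlBar l) ⊗ₜ[ZlBar l] x := fun c x => by
    rw [TensorProduct.tmul_smul]; rfl
  obtain ⟨c, hc | hc⟩ := hprop x x'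
  · rw [hc, hres] at h1Y h10
    have hc0 : IsLocalRing.residue (ZlBar l) c ≠ 0 := fun h => h10 (by rw [h, zero_smul])
    have := Y.toSubmodule.smul_mem (IsLocalRing.residue (ZlBar l) c)⁻¹ h1Y
    rw [inv_smul_smul₀ hc0] at this
    exact h2 this
  · rw [hc, hres] at h2
    exact h2 (Y.toSubmodule.smul_mem _ h1Y)

end Reduction

/-! ### Uniqueness of the operators realizing a twist. -/

section TwistUnique

variable {C : Type*} [Field C] [IsAlgClosed C] {G V : Type*} [Group G] [AddCommGroup V]
  [Module C V] [FiniteDimensional C V] {ρ : Representation C G V} [ρ.IsIrreducible]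

/-- Schur's lemma. -/
theorem exists_eq_smul_of_commute {S : V →ₗ[C] V} (hS : ∀ g v, S (ρ g v) = ρ g (S v)) :
    ∃ c : C, ∀ v, S v = c • v := by
  obtain ⟨c, hc⟩ := (Representation.IsIrreducible.algebraMap_intertwiningMap_bijective_of_isAlgClosed
    (ρ := ρ)).2 ⟨S, fun g => LinearMap.ext fun v => hS g v⟩
  refine ⟨c, fun v => ?_⟩
  have := congrArg (fun f : ρ.IntertwiningMap ρ => f v) hc
  exact this.symm

/-- `T⁻¹ = T ^ (r - 1)`, and `T⁻¹ T'` commutes with the group, so Schur's lemma applies. -/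
theorem exists_twist_eq_smul {φ : G →* G} {r : ℕ} (hr : 0 < r) {T T' : V →ₗ[C] V}
    (hT : IsTwistOperator φ r ρ T) (hT' : ∀ g v, T' (ρ g v) = ρ (φ g) (T' v)) :
    ∃ c : C, ∀ v, T' v = c • T v := by
  have hTT : T * T ^ (r - 1) = 1 := by rw [← pow_succ', Nat.sub_add_cancel hr, hT.2]
  have hTT' : T ^ (r - 1) * T = 1 := by rw [← pow_succ, Nat.sub_add_cancel hr, hT.2]
  have hinv : ∀ g v, (T ^ (r - 1)) (ρ (φ g) v) = ρ g ((T ^ (r - 1)) v) := fun g v => by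
    have h1 := hT.1 g ((T ^ (r - 1)) v)
    rw [← Module.End.mul_apply T (T ^ (r - 1)), hTT, Module.End.one_apply] at h1
    rw [← h1, ← Module.End.mul_apply, hTT', Module.End.one_apply]
  obtain ⟨c, hc⟩ := exists_eq_smul_of_commute (ρ := ρ) (S := T ^ (r - 1) * T') fun g v => by
    rw [Module.End.mul_apply, hT', hinv, Module.End.mul_apply]
  refine ⟨c, fun v => ?_⟩
  rw [← map_smul, ← hc, ← Module.End.mul_apply, ← mul_assoc, hTT, one_mul]

/-- The scalar between the two operators is an `l`-th root of unity, and in characteristic `l` the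
only one is `1`. This is why no compatibility of operators need be imposed on reductions. -/
theorem twist_unique {l : ℕ} [Fact l.Prime] [CharP C l] {φ : G →* G} {T T' : V →ₗ[C] V}
    (hT : IsTwistOperator φ l ρ T) (hT' : IsTwistOperator φ l ρ T') : T = T' := by
  have hl : l.Prime := Fact.out
  obtain ⟨c, hc⟩ := exists_twist_eq_smul hl.pos hT hT'.1
  have hT'c : T' = c • T := LinearMap.ext hc
  by_cases hV : ∃ v : V, v ≠ 0
  · obtain ⟨v, hv⟩ := hV
    have h1 : c ^ l = 1 := by
      have := hT'.2
      rw [hT'c, smul_pow, hT.2] at this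
      have h2 := LinearMap.congr_fun this v
      rw [LinearMap.smul_apply, Module.End.one_apply] at h2
      exact smul_left_injective C hv (by simpa using h2)
    have h2 : c = 1 := frobenius_inj C l (by rw [frobenius_def, frobenius_def, h1, one_pow])
    rw [hT'c, h2, one_smul]
  · push Not at hV
    exact LinearMap.ext fun v => by rw [hV v, map_zero, map_zero]

end TwistUnique

/-! ## Unramified extensions of prime degree -/

section Unramified

open ValuativeRel

theorem isAdicComplete_integer (K : Type*) [Field K] [ValuativeRel K] [TopologicalSpace K]
    [IsNonarchimedeanLocalField K] : IsAdicComplete 𝓂[K] 𝒪[K] :=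
  letI := IsTopologicalAddGroup.rightUniformSpace K
  haveI := isUniformAddGroup_of_addCommGroup (G := K)
  inferInstance

variable {E F : Type*} [Field E] [ValuativeRel E] [TopologicalSpace E]
  [IsNonarchimedeanLocalField E] [Field F] [ValuativeRel F] [TopologicalSpace F]
  [IsNonarchimedeanLocalField F] [Algebra E F] [ValuativeExtension E F] {l n : ℕ} {σ : F ≃ₐ[E] F}

theorem residueFrob_apply (x : 𝓀[F]) : residueFrob E F x = x ^ Nat.card 𝓀[E] := by
  let := Fintype.ofFinite 𝓀[E]
  change x ^ Fintype.card _ = _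
  rw [Nat.card_eq_fintype_card]

theorem residueFrob_algebraMap (x : 𝓀[E]) :
    residueFrob E F (algebraMap 𝓀[E] 𝓀[F] x) = algebraMap 𝓀[E] 𝓀[F] x := by
  let := Fintype.ofFinite 𝓀[E]
  exact AlgHom.commutes _ x

/-- The equation `x ^ q = x`, with `q` the order of `𝓀[E]`, has at most `q` solutions, and `𝓀[E]`
supplies them all. -/
theorem exists_of_residueFrob_eq {x : 𝓀[F]} (hx : residueFrob E F x = x) :
    ∃ y, algebraMap 𝓀[E] 𝓀[F] y = x := by
  classical
  let := Fintype.ofFinite 𝓀[E]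
  by_contra hc
  let f : Polynomial 𝓀[F] := Polynomial.X ^ Fintype.card 𝓀[E] - Polynomial.X
  have hf : f ≠ 0 := FiniteField.X_pow_card_sub_X_ne_zero _ Fintype.one_lt_card
  have hroot : ∀ y : 𝓀[F], residueFrob E F y = y → y ∈ f.roots.toFinset := fun y hy => by
    rw [residueFrob_apply, Nat.card_eq_fintype_card] at hy
    rw [Multiset.mem_toFinset, Polynomial.mem_roots hf]
    simp [f, hy]
  have hinj : Function.Injective (algebraMap 𝓀[E] 𝓀[F]) := (algebraMap 𝓀[E] 𝓀[F]).injective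
  have hx' : x ∉ Finset.univ.image (algebraMap 𝓀[E] 𝓀[F]) := by
    simpa using fun y hy => hc ⟨y, hy⟩
  have h1 : insert x (Finset.univ.image (algebraMap 𝓀[E] 𝓀[F])) ⊆ f.roots.toFinset := by
    intro y hy
    rcases Finset.mem_insert.1 hy with rfl | hy
    · exact hroot _ hx
    · obtain ⟨z, -, rfl⟩ := Finset.mem_image.1 hy
      exact hroot _ (residueFrob_algebraMap z)
  have h2 := Finset.card_le_card h1
  rw [Finset.card_insert_of_notMem hx', Finset.card_image_of_injective _ hinj,
    Finset.card_univ] at h2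
  have h3 := f.roots.toFinset_card_le
  have h4 := Polynomial.card_roots' f
  rw [FiniteField.X_pow_card_sub_X_natDegree_eq _ Fintype.one_lt_card] at h4
  omega

theorem valuation_algebraMap_le_one_iff {x : E} :
    valuation F (algebraMap E F x) ≤ 1 ↔ valuation E x ≤ 1 :=
  Valuation.HasExtension.val_map_le_one_iff (valuation E) (valuation F) x

theorem IsUniformizer.unitIncl (hF : Ideal.map (algebraMap 𝒪[E] 𝒪[F]) 𝓂[E] = 𝓂[F]) {ϖ : Eˣ}
    (h : IsUniformizer ϖ) : IsUniformizer (unitIncl E F ϖ) := by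
  obtain ⟨x, hx, hxe⟩ := h
  refine ⟨algebraMap 𝒪[E] 𝒪[F] x, ?_, ?_⟩
  · rw [hx.maximalIdeal_eq, Ideal.map_span, Set.image_singleton] at hF
    refine (IsDiscreteValuationRing.irreducible_iff_uniformizer _).2 hF.symm
  · change algebraMap E F x = algebraMap E F ϖ
    rw [hxe]

/-- The hypothesis makes the residue fields coincide. As `𝓂[E]` generates `𝓂[F]` and the rings are
complete, successive approximation makes `𝒪[E] → 𝒪[F]` surjective. -/
theorem surjective_algebraMap_of_residueFrob
    (hF : Ideal.map (algebraMap 𝒪[E] 𝒪[F]) 𝓂[E] = 𝓂[F]) (h : ∀ x, residueFrob E F x = x) :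
    Function.Surjective (algebraMap E F) := by
  have := isAdicComplete_integer E
  have := isAdicComplete_integer F
  have : IsHausdorff (Ideal.map (algebraMap 𝒪[E] 𝒪[F]) 𝓂[E]) 𝒪[F] := by
    rw [hF]; infer_instance
  have hs : Function.Surjective (algebraMap 𝒪[E] 𝒪[F]) := by
    refine surjective_of_mk_map_comp_surjective (I := 𝓂[E]) _ fun y => ?_
    obtain ⟨y, rfl⟩ := Ideal.Quotient.mk_surjective y
    obtain ⟨z, hz⟩ := exists_of_residueFrob_eq (h (IsLocalRing.residue 𝒪[F] y))
    obtain ⟨z, rfl⟩ := IsLocalRing.residue_surjective z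
    refine ⟨z, (Ideal.Quotient.eq).2 ?_⟩
    rw [hF, ← IsLocalRing.residue_eq_zero_iff, map_sub, sub_eq_zero]
    exact hz
  have hint : ∀ y : F, valuation F y ≤ 1 → ∃ x, algebraMap E F x = y := fun y hy => by
    obtain ⟨x, hx⟩ := hs ⟨y, hy⟩
    exact ⟨x, congrArg Subtype.val hx⟩
  intro y
  rcases le_total (valuation F y) 1 with hy | hy
  · exact hint y hy
  · obtain ⟨x, hx⟩ := hint y⁻¹ (by rw [map_inv₀]; exact inv_le_one_of_one_le₀ hy)
    exact ⟨x⁻¹, by rw [map_inv₀, hx, inv_inv]⟩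

theorem exists_residueFrob_ne (hl : l.Prime) (h : IsUnramifiedOfDegree E F l) :
    ∃ x, residueFrob E F x ≠ x := by
  by_contra! hc
  have hs := surjective_algebraMap_of_residueFrob h.2 hc
  have h1 : (⊥ : IntermediateField E F) = ⊤ := by
    refine eq_top_iff.2 fun y _ => IntermediateField.mem_bot.2 (hs y)
  rw [IntermediateField.bot_eq_top_iff_finrank_eq_one, h.1] at h1
  exact hl.one_lt.ne' h1

namespace IsArithFrobenius

theorem mem_integer (hσ : IsArithFrobenius σ) {x : F} (hx : x ∈ 𝒪[F]) : σ x ∈ 𝒪[F] := by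
  have h1 : σ x - x ^ Nat.card 𝓀[E] ∈ 𝒪[F] := (hσ ⟨x, hx⟩).le
  have := add_mem h1 (pow_mem hx (Nat.card 𝓀[E]))
  rwa [sub_add_cancel] at this

/-- The restriction of the Frobenius to the ring of integers. -/
def integerMap (hσ : IsArithFrobenius σ) : 𝒪[F] →+* 𝒪[F] :=
  (σ : F →+* F).restrict 𝒪[F] 𝒪[F] fun _ hx => hσ.mem_integer hx

theorem coe_integerMap (hσ : IsArithFrobenius σ) (x : 𝒪[F]) :
    ((hσ.integerMap x : 𝒪[F]) : F) = σ x := rfl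

theorem residue_integerMap (hσ : IsArithFrobenius σ) (x : 𝒪[F]) :
    IsLocalRing.residue 𝒪[F] (hσ.integerMap x) = residueFrob E F (IsLocalRing.residue 𝒪[F] x) := by
  rw [residueFrob_apply, ← map_pow, ← sub_eq_zero, ← map_sub, residue_eq_zero_iff]
  exact hσ x

theorem ne_one (hσ : IsArithFrobenius σ) (hl : l.Prime) (h : IsUnramifiedOfDegree E F l) :
    σ ≠ 1 := by
  rintro rfl
  obtain ⟨x, hx⟩ := exists_residueFrob_ne hl h
  obtain ⟨x, rfl⟩ := IsLocalRing.residue_surjective x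
  exact hx (hσ.residue_integerMap x).symm

/-- An extension of prime degree has no proper intermediate fields, and `σ` is nontrivial already on
the residue field. -/
theorem fixedField_zpowers (hσ : IsArithFrobenius σ) (hl : l.Prime)
    (h : IsUnramifiedOfDegree E F l) :
    IntermediateField.fixedField (Subgroup.zpowers σ) = ⊥ := by
  have := IntermediateField.isSimpleOrder_of_finrank_prime E F (h.1.symm ▸ hl)
  refine (eq_bot_or_eq_top _).resolve_right fun ht => hσ.ne_one hl h ?_
  ext x
  have : x ∈ IntermediateField.fixedField (Subgroup.zpowers σ) := ht ▸ IntermediateField.mem_top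
  exact (IntermediateField.mem_fixedField_iff _ _).1 this σ (Subgroup.mem_zpowers σ)

theorem exists_of_fixed (hσ : IsArithFrobenius σ) (hl : l.Prime) (h : IsUnramifiedOfDegree E F l)
    {x : F} (hx : σ x = x) : ∃ y, algebraMap E F y = x := by
  rw [← Set.mem_range, ← RingHom.coe_range] 
  refine IntermediateField.mem_bot.1 ?_
  rw [← hσ.fixedField_zpowers hl h, IntermediateField.mem_fixedField_iff]
  intro f hf
  have : Subgroup.zpowers σ ≤ MulAction.stabilizer _ x := by
    rw [Subgroup.zpowers_le]; exact hx
  exact this hf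

/-- By Artin's theorem the degree over the fixed field equals the order of `σ`. -/
theorem pow_eq_one (hσ : IsArithFrobenius σ) (hl : l.Prime) (h : IsUnramifiedOfDegree E F l) :
    σ ^ l = 1 := by
  have : FiniteDimensional E F := .of_finrank_pos (h.1.symm ▸ hl.pos)
  have h1 := IntermediateField.finrank_fixedField_eq_card (Subgroup.zpowers σ)
  rw [hσ.fixedField_zpowers hl h, IntermediateField.finrank_bot', h.1, Nat.card_zpowers] at h1
  rw [h1, pow_orderOf_eq_one]

theorem iterate_apply (hσ : IsArithFrobenius σ) (hl : l.Prime) (h : IsUnramifiedOfDegree E F l)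
    (x : F) : σ^[l] x = x := by
  rw [← AlgEquiv.coe_pow, hσ.pow_eq_one hl h]
  rfl

theorem residueFrob_pow (hσ : IsArithFrobenius σ) (hl : l.Prime) (h : IsUnramifiedOfDegree E F l)
    (x : 𝓀[F]) : (residueFrob E F)^[l] x = x := by
  obtain ⟨x, rfl⟩ := IsLocalRing.residue_surjective x
  have key : ∀ i, (residueFrob E F)^[i] (IsLocalRing.residue 𝒪[F] x) =
      IsLocalRing.residue 𝒪[F] (hσ.integerMap^[i] x) ∧ (hσ.integerMap^[i] x : F) = σ^[i] x := by
    intro i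
    induction i with
    | zero => exact ⟨rfl, rfl⟩
    | succ i ih =>
      rw [Function.iterate_succ_apply', Function.iterate_succ_apply',
        Function.iterate_succ_apply', ih.1, hσ.residue_integerMap, hσ.coe_integerMap, ih.2]
      exact ⟨rfl, rfl⟩
  rw [(key l).1, Subtype.ext ((key l).2.trans (hσ.iterate_apply hl h x))]

end IsArithFrobenius
end Unramified

/-! ### Galois descent for the cosets of `F^* GL_n(𝒪_F)`. -/

section Descent

open ValuativeRel

variable {E F : Type*} [Field E] [ValuativeRel E] [TopologicalSpace E]
  [IsNonarchimedeanLocalField E] [Field F] [ValuativeRel F] [TopologicalSpace F]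
  [IsNonarchimedeanLocalField F] [Algebra E F] [ValuativeExtension E F] {l n : ℕ} {σ : F ≃ₐ[E] F}

theorem exists_glInt {K : Type*} [Field K] [ValuativeRel K] {g : GL (Fin n) K}
    (h : ∀ i j : Fin n, g i j ∈ 𝒪[K]) (h' : ∀ i j : Fin n, g⁻¹ i j ∈ 𝒪[K]) :
    ∃ x, glInt n K x = g := by
  let A : Matrix (Fin n) (Fin n) 𝒪[K] := Matrix.of fun i j => ⟨g i j, h i j⟩
  let B : Matrix (Fin n) (Fin n) 𝒪[K] := Matrix.of fun i j => ⟨g⁻¹ i j, h' i j⟩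
  have hinj : Function.Injective ((𝒪[K]).subtype.mapMatrix (m := Fin n)) := fun X Y hXY => by
    ext i j
    exact congrFun (congrFun hXY i) j
  have hA : (𝒪[K]).subtype.mapMatrix A = g := by ext; rfl
  have hB : (𝒪[K]).subtype.mapMatrix B = (g⁻¹ : GL (Fin n) K) := by ext; rfl
  refine ⟨⟨A, B, hinj ?_, hinj ?_⟩, ?_⟩
  · rw [map_mul, hA, hB, map_one, ← Units.val_mul, mul_inv_cancel, Units.val_one]
  · rw [map_mul, hA, hB, map_one, ← Units.val_mul, inv_mul_cancel, Units.val_one]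
  · ext i j; rfl

theorem exists_map_eq {A B : Type*} [CommRing A] [CommRing B] {f : A →+* B}
    (hf : Function.Injective f) {g : GL (Fin n) B} (h : ∀ i j : Fin n, ∃ a, f a = g i j)
    (h' : ∀ i j : Fin n, ∃ a, f a = g⁻¹ i j) :
    ∃ x, Matrix.GeneralLinearGroup.map f x = g := by
  choose a ha using h
  choose b hb using h'
  have hinj : Function.Injective (f.mapMatrix (m := Fin n)) := fun X Y hXY => by
    ext i j
    exact hf (congrFun (congrFun hXY i) j)
  have hA : f.mapMatrix (Matrix.of a) = g := by ext i j; exact ha i j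
  have hB : f.mapMatrix (Matrix.of b) = (g⁻¹ : GL (Fin n) B) := by ext i j; exact hb i j
  refine ⟨⟨Matrix.of a, Matrix.of b, hinj ?_, hinj ?_⟩, ?_⟩
  · rw [map_mul, hA, hB, map_one, ← Units.val_mul, mul_inv_cancel, Units.val_one]
  · rw [map_mul, hA, hB, map_one, ← Units.val_mul, inv_mul_cancel, Units.val_one]
  · ext i j; exact ha i j

theorem glIncl_scalar (ϖ : Eˣ) (m : ℤ) :
    glIncl E F n (Matrix.GeneralLinearGroup.scalar (Fin n) (ϖ ^ m)) =
      Matrix.GeneralLinearGroup.scalar (Fin n) (unitIncl E F ϖ ^ m) := by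
  rw [unitIncl, ← map_zpow]
  ext i j
  by_cases h : i = j <;> simp [glIncl, Matrix.GeneralLinearGroup.scalar, h]

theorem glIncl_glInt (x : GL (Fin n) 𝒪[E]) : glIncl E F n (glInt n E x) =
    glInt n F (Matrix.GeneralLinearGroup.map (algebraMap 𝒪[E] 𝒪[F]) x) := rfl

theorem glRed_map_algebraMap (x : GL (Fin n) 𝒪[E]) :
    glRed n F (Matrix.GeneralLinearGroup.map (algebraMap 𝒪[E] 𝒪[F]) x) =
      glResidueIncl E F n (glRed n E x) := rfl

theorem glFrob_glIncl (g : GL (Fin n) E) : glFrob n σ (glIncl E F n g) = glIncl E F n g := by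
  ext i j
  exact σ.commutes (g i j)

theorem glFrob_scalar (ϖ : Eˣ) (m : ℤ) :
    glFrob n σ (Matrix.GeneralLinearGroup.scalar (Fin n) (unitIncl E F ϖ ^ m)) =
      Matrix.GeneralLinearGroup.scalar (Fin n) (unitIncl E F ϖ ^ m) := by
  rw [← glIncl_scalar, glFrob_glIncl]

theorem glFrob_iterate_apply (g : GL (Fin n) F) (m : ℕ) (i j : Fin n) :
    ((glFrob n σ)^[m] g) i j = σ^[m] (g i j) := by
  induction m with
  | zero => rfl
  | succ m ih => rw [Function.iterate_succ_apply', Function.iterate_succ_apply', ← ih]; rfl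

namespace IsArithFrobenius

theorem glFrob_glInt (hσ : IsArithFrobenius σ) (x : GL (Fin n) 𝒪[F]) :
    glFrob n σ (glInt n F x) =
      glInt n F (Matrix.GeneralLinearGroup.map hσ.integerMap x) := rfl

theorem glRed_map (hσ : IsArithFrobenius σ) (x : GL (Fin n) 𝒪[F]) :
    glRed n F (Matrix.GeneralLinearGroup.map hσ.integerMap x) =
      glResidueFrob E F n (glRed n F x) := by
  ext i j
  exact hσ.residue_integerMap (x i j)

theorem orderOf_residueFrob (hσ : IsArithFrobenius σ) (hl : l.Prime)
    (h : IsUnramifiedOfDegree E F l) : orderOf (residueFrob E F) = l := by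
  have := Fact.mk hl
  refine orderOf_eq_prime (RingHom.ext fun x => ?_) fun h1 => ?_
  · rw [RingHom.coe_pow]; exact hσ.residueFrob_pow hl h x
  · obtain ⟨x, hx⟩ := exists_residueFrob_ne hl h
    exact hx (by rw [h1]; rfl)

/-- The powers of the Frobenius of the residue field are linearly independent. -/
theorem eq_zero_of_sum_eq_zero (hσ : IsArithFrobenius σ) (hl : l.Prime)
    (h : IsUnramifiedOfDegree E F l) (a : Fin l → 𝓀[F])
    (ha : ∀ t, ∑ i : Fin l, (residueFrob E F)^[i] t * a i = 0) (i : Fin l) : a i = 0 := by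
  let f : Fin l → (𝓀[F] →* 𝓀[F]) := fun i => (residueFrob E F ^ (i : ℕ) : 𝓀[F] →+* 𝓀[F])
  have hf : Function.Injective f := fun i j hij => by
    refine Fin.ext (pow_injOn_Iio_orderOf (x := residueFrob E F) ?_ ?_ ?_)
    · rw [hσ.orderOf_residueFrob hl h]; exact i.2
    · rw [hσ.orderOf_residueFrob hl h]; exact j.2
    · ext x; exact DFunLike.congr_fun hij x
  have hli := (linearIndependent_monoidHom 𝓀[F] 𝓀[F]).comp f hf
  refine Fintype.linearIndependent_iff.1 hli a (funext fun t => ?_) i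
  rw [Finset.sum_apply]
  refine (Finset.sum_congr rfl fun i _ => ?_).trans (ha t)
  change a i * (residueFrob E F ^ (i : ℕ)) t = _
  rw [RingHom.coe_pow, mul_comm]

/-- A twisted trace of the residue field with invertible value. -/
theorem exists_det_ne_zero (hσ : IsArithFrobenius σ) (hl : l.Prime)
    (h : IsUnramifiedOfDegree E F l) (X : Fin l → Matrix (Fin n) (Fin n) 𝓀[F])
    (hX : ∃ i, X i = 1) : ∃ B : Matrix (Fin n) (Fin n) 𝓀[F],
      (∑ i : Fin l, B.map (residueFrob E F)^[i] * X i).det ≠ 0 := by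
  let b : (Fin n → 𝓀[F]) → (Fin n → 𝓀[F]) := fun v =>
    ∑ i : Fin l, Matrix.vecMul (fun j => (residueFrob E F)^[i] (v j)) (X i)
  -- A linear form that vanishes on all values of `b` is killed by every `X i`, by independence of
  -- the powers of Frobenius; one of the `X i` is `1`, so the form is zero. Thus `n` independent
  -- values of `b` exist, and they are the rows of an invertible matrix.
  have hspan : Submodule.span 𝓀[F] (Set.range b) = ⊤ := by
    by_contra hne
    obtain ⟨f, hf, hle⟩ := Submodule.exists_le_ker_of_lt_top _ (lt_top_iff_ne_top.2 hne)
    refine hf (LinearMap.pi_ext' fun j => LinearMap.ext_ring ?_)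
    have hfe : ∀ w : Fin n → 𝓀[F], f w = ∑ j, w j * f (Pi.single j 1) := fun w => by
      conv_lhs => rw [← Finset.univ_sum_single w, map_sum]
      refine Finset.sum_congr rfl fun j _ => ?_
      rw [← smul_eq_mul, ← map_smul]
      congr 1
      ext j'
      by_cases hj : j' = j <;> simp [hj]
    have hz : ∀ i : Fin l, ∑ j', X i j j' * f (Pi.single j' 1) = 0 := by
      refine hσ.eq_zero_of_sum_eq_zero hl h _ fun t => ?_
      have h1 : f (b (Pi.single j t)) = 0 := hle (Submodule.subset_span ⟨_, rfl⟩)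
      rw [map_sum] at h1
      rw [← h1]
      refine Finset.sum_congr rfl fun i _ => ?_
      have h2 : (fun j' => (residueFrob E F)^[i] ((Pi.single j t : Fin n → 𝓀[F]) j')) =
          Pi.single j ((residueFrob E F)^[i] t) := by
        ext j'
        by_cases hj : j' = j
        · subst hj; simp
        · rw [Pi.single_eq_of_ne hj, Pi.single_eq_of_ne hj, ← RingHom.coe_pow, map_zero]
      rw [h2, Matrix.single_vecMul, hfe, Finset.mul_sum]
      refine Finset.sum_congr rfl fun j' _ => ?_
      simp [mul_assoc]
    obtain ⟨i, hi⟩ := hX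
    have := hz i
    rw [hi, Finset.sum_eq_single_of_mem j (Finset.mem_univ _)] at this
    · simpa using this
    · intro j' _ hj
      rw [Matrix.one_apply_ne hj.symm, zero_mul]
  obtain ⟨w, hw, -, hwi⟩ := Submodule.exists_fun_fin_finrank_span_eq 𝓀[F] (Set.range b)
  have hd : n = Module.finrank 𝓀[F] (Submodule.span 𝓀[F] (Set.range b)) := by
    rw [hspan, finrank_top, Module.finrank_fin_fun]
  choose v hv using hw
  refine ⟨Matrix.of (v ∘ finCongr hd), ?_⟩
  have hb : (∑ i : Fin l, (Matrix.of (v ∘ finCongr hd)).map (residueFrob E F)^[i] * X i) =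
      Matrix.of (w ∘ finCongr hd) := by
    ext r c
    rw [Matrix.sum_apply, Matrix.of_apply, Function.comp_apply, ← hv]
    exact (Finset.sum_apply c Finset.univ _).symm
  rw [hb]
  exact ((Matrix.isUnit_iff_isUnit_det _).1
    (Matrix.linearIndependent_rows_iff_isUnit.1 (hwi.comp _ (finCongr hd).injective))).ne_zero

/-- Hilbert 90 for `GL_n(𝒪_F)`. For an integral `B` the matrix `b = ∑ σ^i(B) c_i` satisfies `b g = ∑
σ^i(B g)`, a trace, which is fixed by `σ`. By `exists_det_ne_zero`, `B` can be chosen with `b`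
invertible on reduction, hence invertible. -/
theorem exists_glInt_fixed (hσ : IsArithFrobenius σ) (hl : l.Prime)
    (h : IsUnramifiedOfDegree E F l) {g : GL (Fin n) F} (c : ℕ → GL (Fin n) 𝒪[F])
    (hc : ∀ i, (glFrob n σ)^[i] g = glInt n F (c i) * g) :
    ∃ (b : GL (Fin n) 𝒪[F]) (a : GL (Fin n) E), glInt n F b * g = glIncl E F n a := by
  obtain ⟨Bbar, hB⟩ := hσ.exists_det_ne_zero hl h (fun i : Fin l => (glRed n F (c i)).1)
    ⟨⟨0, hl.pos⟩, by
      have : c 0 = 1 := glInt_injective (by simpa using (hc 0).symm)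
      simp [this]⟩
  choose s hs using IsLocalRing.residue_surjective (R := 𝒪[F])
  let B : Matrix (Fin n) (Fin n) 𝒪[F] := Bbar.map s
  have hres : ∀ (i : ℕ) (x : 𝒪[F]), IsLocalRing.residue 𝒪[F] (hσ.integerMap^[i] x) =
      (residueFrob E F)^[i] (IsLocalRing.residue 𝒪[F] x) := by
    intro i x
    induction i with
    | zero => rfl
    | succ i ih =>
      rw [Function.iterate_succ_apply', Function.iterate_succ_apply', hσ.residue_integerMap, ih]
  obtain ⟨b, hb⟩ := exists_gl_of_residue
    (∑ i : Fin l, B.map (hσ.integerMap^[i]) * (c i : Matrix (Fin n) (Fin n) 𝒪[F])) (by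
      convert hB using 2
      rw [← RingHom.mapMatrix_apply, map_sum]
      refine Finset.sum_congr rfl fun i _ => ?_
      rw [map_mul]
      congr 1
      ext r t
      change IsLocalRing.residue 𝒪[F] (hσ.integerMap^[i] (s (Bbar r t))) = _
      rw [hres, hs]
      rfl)
  have hcoe : ∀ (i : ℕ) (x : 𝒪[F]), ((hσ.integerMap^[i] x : 𝒪[F]) : F) = σ^[i] x := by
    intro i x
    induction i with
    | zero => rfl
    | succ i ih =>
      rw [Function.iterate_succ_apply', Function.iterate_succ_apply', hσ.coe_integerMap, ih]
  let f : ℕ → Matrix (Fin n) (Fin n) F := fun i =>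
    (B.map fun x => σ^[i] (x : F)) * ((glFrob n σ)^[i] g).1
  have hbg : ((glInt n F b * g : GL (Fin n) F) : Matrix (Fin n) (Fin n) F) =
      ∑ i ∈ Finset.range l, f i := by
    rw [Units.val_mul, Finset.sum_range]
    change (𝒪[F]).subtype.mapMatrix (b : Matrix (Fin n) (Fin n) 𝒪[F]) * _ = _
    rw [hb, map_sum, Finset.sum_mul]
    refine Finset.sum_congr rfl fun i _ => ?_
    rw [map_mul, mul_assoc]
    change _ * ((glInt n F (c i) : Matrix (Fin n) (Fin n) F) * g) = _
    rw [← Units.val_mul, ← hc]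
    congr 1
    ext r t
    exact hcoe i _
  have hfs : ∀ i, (σ : F →+* F).mapMatrix (f i) = f (i + 1) := fun i => by
    change (σ : F →+* F).mapMatrix ((B.map fun x => σ^[i] (x : F)) *
      ((glFrob n σ)^[i] g).1) = (B.map fun x => σ^[i + 1] (x : F)) *
      ((glFrob n σ)^[i + 1] g).1
    rw [map_mul, Function.iterate_succ_apply']
    congr 1
    ext r t
    exact (Function.iterate_succ_apply' σ i _).symm
  have hfl : f l = f 0 := by
    have h1 : (glFrob n σ)^[l] g = g := by
      ext r t
      rw [glFrob_iterate_apply, hσ.iterate_apply hl h]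
    change (B.map fun x => σ^[l] (x : F)) * ((glFrob n σ)^[l] g).1 = B.map _ * _
    rw [h1]
    congr 1
    ext r t
    exact hσ.iterate_apply hl h _
  have hfix : glFrob n σ (glInt n F b * g) = glInt n F b * g := by
    refine Units.ext ?_
    change (σ : F →+* F).mapMatrix ((glInt n F b * g).1) = _
    rw [hbg, map_sum, Finset.sum_congr rfl fun i _ => hfs i]
    have e := Finset.sum_range_succ f l
    rw [Finset.sum_range_succ', hfl] at e
    exact add_right_cancel e
  obtain ⟨a, ha⟩ := exists_map_eq (algebraMap E F).injective (g := glInt n F b * g)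
    (fun i j => hσ.exists_of_fixed hl h (congrArg (fun g : GL (Fin n) F => g i j) hfix))
    (fun i j => hσ.exists_of_fixed hl h (congrArg (fun g : GL (Fin n) F => g i j)
      ((map_inv (glFrob n σ) _).trans (congrArg _ hfix))))
  exact ⟨b, a, ha.symm⟩

/-- The Frobenius of an unramified extension of prime degree satisfies Galois descent for the cosets
of `F^* GL_n(𝒪_F)`. -/
theorem cyclicDescent (hσ : IsArithFrobenius σ) (hl : l.Prime) (h : IsUnramifiedOfDegree E F l)
    {ϖ : Eˣ} (hϖ : IsUniformizer ϖ) (hn : 1 ≤ n) :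
    CyclicDescent (centerIntRed (hϖ.unitIncl h.2) hn) (centerIntRed hϖ hn) (glIncl E F n)
      (glResidueIncl E F n) (glFrob n σ) (glResidueFrob E F n) l where
  map_incl := glFrob_glIncl
  map_mem := by
    rintro ⟨g, hg⟩
    obtain ⟨m, x, rfl⟩ := mem_centerInt.1 hg
    rw [map_mul, glFrob_scalar, hσ.glFrob_glInt]
    exact mem_centerInt_of _ _
  red_map := by
    rintro ⟨g, hg⟩ ⟨g', hg'⟩ (rfl : g' = _)
    obtain ⟨m, x, rfl⟩ := mem_centerInt.1 hg
    simp only [map_mul, glFrob_scalar, hσ.glFrob_glInt, centerIntRed_mk, hσ.glRed_map]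
  incl_mem g := by
    refine ⟨fun hg => ?_, fun hg => ?_⟩
    · obtain ⟨m, x, hx⟩ := mem_centerInt.1 hg
      obtain ⟨g', hg'⟩ : ∃ g', g' = Matrix.GeneralLinearGroup.scalar (Fin n) (ϖ ^ (-m)) * g :=
        ⟨_, rfl⟩
      have hgx : glIncl E F n g' = glInt n F x := by
        rw [hg', map_mul, hx, glIncl_scalar, zpow_neg, map_inv, inv_mul_cancel_left]
      obtain ⟨y, hy⟩ := exists_glInt (g := g')
        (fun i j => valuation_algebraMap_le_one_iff.1 (by
          have : algebraMap E F (g' i j) = (x i j : F) :=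
            congrArg (fun g : GL (Fin n) F => g i j) hgx
          rw [this]; exact (x i j).2))
        (fun i j => valuation_algebraMap_le_one_iff.1 (by
          have : algebraMap E F (g'⁻¹ i j) = (x⁻¹ i j : F) :=
            congrArg (fun g : GL (Fin n) F => g i j)
              ((map_inv (glIncl E F n) g').trans ((congrArg _ hgx).trans (map_inv _ x).symm))
          rw [this]; exact (x⁻¹ i j).2))
      refine mem_centerInt.2 ⟨m, y, ?_⟩
      rw [hy, hg', zpow_neg, map_inv, mul_inv_cancel_left]
    · obtain ⟨m, x, rfl⟩ := mem_centerInt.1 hg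
      rw [map_mul, glIncl_scalar, glIncl_glInt]
      exact mem_centerInt_of _ _
  red_incl := by
    rintro ⟨g, hg⟩ ⟨g', hg'⟩ (rfl : g' = _)
    obtain ⟨m, x, rfl⟩ := mem_centerInt.1 hg
    simp only [map_mul, glIncl_scalar, glIncl_glInt, centerIntRed_mk, glRed_map_algebraMap]
  exists_fixed g hg := by
    obtain ⟨m, x, hx⟩ := mem_centerInt.1 hg
    have hstep : ∀ i : ℕ, ∃ y, (glFrob n σ)^[i] g =
        Matrix.GeneralLinearGroup.scalar (Fin n) (unitIncl E F ϖ ^ (m * i)) * glInt n F y * g := by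
      intro i
      induction i with
      | zero => exact ⟨1, by simp⟩
      | succ i ih =>
        obtain ⟨y, hy⟩ := ih
        refine ⟨Matrix.GeneralLinearGroup.map hσ.integerMap y * x, ?_⟩
        rw [Function.iterate_succ_apply', hy, map_mul, map_mul, glFrob_scalar, hσ.glFrob_glInt,
          eq_mul_of_mul_inv_eq hx, map_mul (glInt n F), Nat.cast_succ, mul_add, mul_one, zpow_add,
          map_mul (Matrix.GeneralLinearGroup.scalar (Fin n))]
        simp only [mul_assoc]
        rw [← mul_assoc (glInt n F _) (Matrix.GeneralLinearGroup.scalar _ _), ← scalar_mul_comm,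
          mul_assoc]
    -- After `l` steps `σ` returns to `g`, so `ϖ ^ (m l)` times an element of `GL_n(𝒪_F)` is `1`.
    -- Hence `m = 0`, and the cocycle takes values in `GL_n(𝒪_F)`.
    have hm : m = 0 := by
      obtain ⟨y, hy⟩ := hstep l
      have h1 : (glFrob n σ)^[l] g = g := by
        ext r t
        rw [glFrob_iterate_apply, hσ.iterate_apply hl h]
      rw [h1, right_eq_mul] at hy
      rw [← glCenterInt_apply, ← map_one (glCenterInt n (unitIncl E F ϖ))] at hy
      have h2 := congrArg Prod.fst ((hϖ.unitIncl h.2).glCenterInt_injective hn hy)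
      have h3 : m * l = 0 := h2
      simpa [hl.ne_zero] using h3
    subst hm
    choose c hc using hstep
    obtain ⟨b, a, hba⟩ := hσ.exists_glInt_fixed hl h c fun i => by simpa using hc i
    exact ⟨glInt n F b, glInt_mem_centerInt b, a, hba⟩
  iterate g := by
    ext r t
    rw [glFrob_iterate_apply, hσ.iterate_apply hl h]

end IsArithFrobenius
end Descent

/-! ### Cuspidality of Tate cohomology. -/

section TateCuspidal

/-- Up to norms, the sum of an equivariant function is its sum over the fixed points. -/
theorem exists_sum_sub_sum_fixed {ι R M : Type*} [DecidableEq ι] [CommRing R] [AddCommGroup M]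
    [Module R M] {l : ℕ} (hl : l.Prime) {s : ι → ι} (hs : ∀ i, s^[l] i = i) {T : M →ₗ[R] M}
    {f : ι → M} (hf : ∀ i, T (f i) = f (s i)) (t : Finset ι) (ht : ∀ i ∈ t, s i ∈ t) :
    ∃ z, ∑ i ∈ t, f i - ∑ i ∈ t with s i = i, f i = ∑ j ∈ Finset.range l, (T ^ j) z := by
  induction hN : t.card using Nat.strong_induction_on generalizing t with | _ N ih =>
  by_cases hfix : ∀ i ∈ t, s i = i
  · exact ⟨0, by rw [Finset.filter_true_of_mem hfix]; simp⟩
  push Not at hfix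
  obtain ⟨i, hit, hi⟩ := hfix
  have hst : ∀ j, s^[j] i ∈ t := fun j => by
    induction j with
    | zero => exact hit
    | succ j ih => rw [Function.iterate_succ_apply']; exact ht _ ih
  have hper : Function.minimalPeriod s i = l := by
    refine (hl.eq_one_or_self_of_dvd _ (Function.IsPeriodicPt.minimalPeriod_dvd (hs i))).resolve_left
      fun h1 => hi ?_
    exact Function.minimalPeriod_eq_one_iff_isFixedPt.1 h1
  have hinj : Set.InjOn (fun j => s^[j] i) (Finset.range l) := fun a ha b hb hab => by
    refine Function.iterate_injOn_Iio_minimalPeriod (f := s) (x := i) ?_ ?_ hab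
    · rw [hper]; exact Finset.mem_range.1 ha
    · rw [hper]; exact Finset.mem_range.1 hb
  -- A nontrivial orbit has exactly `l` elements, and the sum of `f` over it is the norm of `f i`;
  -- the induction goes on without it.
  set o := (Finset.range l).image fun j => s^[j] i with ho
  have hot : o ⊆ t := fun j hj => by
    obtain ⟨a, -, rfl⟩ := Finset.mem_image.1 hj
    exact hst a
  have hmem : ∀ j, s^[j] i ∈ o := fun j => by
    refine Finset.mem_image.2 ⟨j % l, Finset.mem_range.2 (Nat.mod_lt _ hl.pos), ?_⟩
    have : Function.IsPeriodicPt s l i := hs i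
    exact this.iterate_mod_apply j
  have hback : ∀ j, s j ∈ o → j ∈ o := fun j hj => by
    obtain ⟨a, -, ha⟩ := Finset.mem_image.1 hj
    have h1 := congrArg s^[l - 1] ha
    beta_reduce at h1
    rw [← Function.iterate_succ_apply s, Nat.succ_eq_add_one, Nat.sub_add_cancel hl.one_le, hs,
      ← Function.iterate_add_apply] at h1
    rw [← h1]
    exact hmem _
  have hne : ∀ j ∈ o, s j ≠ j := fun j hj hj' => by
    obtain ⟨a, ha, rfl⟩ := Finset.mem_image.1 hj
    refine hi ?_
    have h1 := congrArg s^[l - a] (show s (s^[a] i) = s^[a] i from hj')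
    rw [← Function.iterate_succ_apply' s, ← Function.iterate_add_apply,
      ← Function.iterate_add_apply, Nat.sub_add_cancel (Finset.mem_range.1 ha).le, hs,
      show l - a + a.succ = l + 1 by have := Finset.mem_range.1 ha; omega,
      Function.iterate_succ_apply', hs] at h1
    exact h1
  have hcard : (t \ o).card < N := by
    rw [← hN]
    exact Finset.card_lt_card (Finset.sdiff_ssubset hot ⟨i, hmem 0⟩)
  obtain ⟨z, hz⟩ := ih _ hcard (t \ o) (fun j hj => by
    rw [Finset.mem_sdiff] at hj ⊢
    exact ⟨ht j hj.1, fun h => hj.2 (hback j h)⟩) rfl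
  have hpow : ∀ j, (T ^ j) (f i) = f (s^[j] i) := fun j => by
    induction j with
    | zero => rfl
    | succ j ih => rw [pow_succ', Module.End.mul_apply, ih, hf, Function.iterate_succ_apply']
  have hfilter : (t \ o).filter (fun j => s j = j) = t.filter (fun j => s j = j) := by
    ext j
    simp only [Finset.mem_filter, Finset.mem_sdiff]
    exact ⟨fun h => ⟨h.1.1, h.2⟩, fun h => ⟨⟨h.1, fun hj => hne j hj h.2⟩, h.2⟩⟩
  refine ⟨z + f i, ?_⟩
  rw [hfilter] at hz
  simp only [map_add, Finset.sum_add_distrib, ← hz, hpow]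
  rw [← Finset.sum_sdiff hot, ho, Finset.sum_image hinj]
  abel

variable {E F : Type*} [Field E] [ValuativeRel E] [TopologicalSpace E]
  [IsNonarchimedeanLocalField E] [Field F] [ValuativeRel F] [TopologicalSpace F]
  [IsNonarchimedeanLocalField F] [Algebra E F] [ValuativeExtension E F] {l n : ℕ} {σ : F ≃ₐ[E] F}

theorem glResidueFrob_glResidueIncl (g : GL (Fin n) 𝓀[E]) :
    glResidueFrob E F n (glResidueIncl E F n g) = glResidueIncl E F n g := by
  ext i j
  exact residueFrob_algebraMap (g i j)

theorem IsArithFrobenius.glResidueFrob_iterate (hσ : IsArithFrobenius σ) (hl : l.Prime)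
    (h : IsUnramifiedOfDegree E F l) (g : GL (Fin n) 𝓀[F]) : (glResidueFrob E F n)^[l] g = g := by
  have key : ∀ (m : ℕ) (i j : Fin n),
      ((glResidueFrob E F n)^[m] g) i j = (residueFrob E F)^[m] (g i j) := by
    intro m i j
    induction m with
    | zero => rfl
    | succ m ih => rw [Function.iterate_succ_apply', Function.iterate_succ_apply', ← ih]; rfl
  ext i j
  rw [key, hσ.residueFrob_pow hl h]

theorem glResidueFrob_mem_radGroup {m : ℕ} {u : GL (Fin n) 𝓀[F]} (hu : u ∈ radGroup 𝓀[F] n m) :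
    glResidueFrob E F n u ∈ radGroup 𝓀[F] n m := by
  intro i j hij
  have h1 : u i j = (1 : Matrix (Fin n) (Fin n) 𝓀[F]) i j := hu i j hij
  change residueFrob E F (u i j) = _
  rw [h1, Matrix.one_apply]
  split_ifs <;> simp

theorem glResidueIncl_mem_radGroup {m : ℕ} {u : GL (Fin n) 𝓀[E]} :
    glResidueIncl E F n u ∈ radGroup 𝓀[F] n m ↔ u ∈ radGroup 𝓀[E] n m := by
  refine forall₂_congr fun i j => forall_congr' fun _ => ?_
  change algebraMap 𝓀[E] 𝓀[F] (u i j) = _ ↔ _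
  rw [← (algebraMap 𝓀[E] 𝓀[F]).injective.eq_iff]
  simp only [Matrix.one_apply]
  split_ifs <;> simp

theorem glResidueIncl_injective : Function.Injective (glResidueIncl E F n) := fun a b hab => by
  ext r c
  exact (algebraMap 𝓀[E] 𝓀[F]).injective (congrArg (fun g : GL (Fin n) 𝓀[F] => g r c) hab)

theorem exists_glResidueIncl_eq {u : GL (Fin n) 𝓀[F]} (hu : glResidueFrob E F n u = u) :
    ∃ u', glResidueIncl E F n u' = u :=
  exists_map_eq (algebraMap 𝓀[E] 𝓀[F]).injective
    (fun i j => exists_of_residueFrob_eq (congrArg (fun g : GL (Fin n) 𝓀[F] => g i j) hu))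
    (fun i j => exists_of_residueFrob_eq (congrArg (fun g : GL (Fin n) 𝓀[F] => g i j)
      ((map_inv (glResidueFrob E F n) u).trans (congrArg _ hu))))

/-- The sum over the radical with entries in `𝓀[F]` is zero by cuspidality, and `T` permutes its
terms since it fixes `x`. Orbits of length `l` contribute norms; the fixed terms form the sum over
the radical with entries in `𝓀[E]`, which is therefore a norm. -/
theorem CuspSum.exists_sum_eq_norm {R M : Type*} [CommRing R] [AddCommGroup M] [Module R M]
    {ρ : Representation R (GL (Fin n) 𝓀[F]) M} (hρ : CuspSum ρ) (hσ : IsArithFrobenius σ)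
    (hl : l.Prime) (h : IsUnramifiedOfDegree E F l) {T : M →ₗ[R] M}
    (hT : ∀ g v, T (ρ g v) = ρ (glResidueFrob E F n g) (T v)) {x : M} (hx : T x = x) {m : ℕ}
    (hm : 1 ≤ m) (hmn : m < n) [Fintype (radGroup 𝓀[E] n m)] :
    ∃ z, ∑ i ∈ Finset.range l, (T ^ i) z =
      ∑ u : radGroup 𝓀[E] n m, ρ (glResidueIncl E F n u) x := by
  classical
  have := Fintype.ofFinite (radGroup 𝓀[F] n m)
  have h0 := hρ m hm hmn x
  rw [finsum_eq_sum_of_fintype] at h0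
  let s : radGroup 𝓀[F] n m → radGroup 𝓀[F] n m :=
    fun u => ⟨glResidueFrob E F n u, glResidueFrob_mem_radGroup u.2⟩
  have hsl : ∀ u, s^[l] u = u := fun u => by
    refine Subtype.ext ?_
    have : ∀ i, (s^[i] u : GL (Fin n) 𝓀[F]) = (glResidueFrob E F n)^[i] u := fun i => by
      induction i with
      | zero => rfl
      | succ i ih => rw [Function.iterate_succ_apply', Function.iterate_succ_apply', ← ih]
    rw [this, hσ.glResidueFrob_iterate hl h]
  obtain ⟨z, hz⟩ := exists_sum_sub_sum_fixed hl hsl (T := T)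
    (f := fun u => ρ u x) (fun u => (hT u x).trans (by rw [hx])) Finset.univ
    fun _ _ => Finset.mem_univ _
  let j : radGroup 𝓀[E] n m → radGroup 𝓀[F] n m :=
    fun u => ⟨glResidueIncl E F n u, glResidueIncl_mem_radGroup.2 u.2⟩
  have hj : Function.Injective j := fun a b hab =>
    Subtype.ext (glResidueIncl_injective (congrArg Subtype.val hab))
  have himg : (Finset.univ.filter fun u => s u = u) = Finset.univ.image j := by
    ext u
    simp only [Finset.mem_filter, Finset.mem_univ, true_and, Finset.mem_image]
    refine ⟨fun hu => ?_, ?_⟩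
    · obtain ⟨u', he⟩ := exists_glResidueIncl_eq (congrArg Subtype.val hu)
      exact ⟨⟨u', glResidueIncl_mem_radGroup.1 (he ▸ u.2)⟩, Subtype.ext he⟩
    · rintro ⟨u, rfl⟩
      exact Subtype.ext (glResidueFrob_glResidueIncl _)
  rw [h0, himg, Finset.sum_image fun _ _ _ _ hab => hj hab, zero_sub] at hz
  refine ⟨-z, ?_⟩
  simp only [map_neg, Finset.sum_neg_distrib]
  rw [← hz, neg_neg]

theorem tateH0_eq_zero {R Γ M : Type*} [CommRing R] [Group Γ] [AddCommGroup M] [Module R M]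
    {ρ : Representation R Γ M} {l : ℕ} {T : ρ.IntertwiningMap ρ} {ι : Type*} [Fintype ι] (g : ι → Γ)
    (x : (1 - T).ker.toSubmodule) {z : M}
    (hz : ∑ i ∈ Finset.range l, (T.toLinearMap ^ i) z = ∑ i, ρ (g i) x) :
    ∑ᶠ i, tateH0 l T (g i) (Submodule.mkQ _ x) = 0 := by
  rw [finsum_eq_sum_of_fintype]
  have hsum : ((∑ i, (1 - T).ker.toRepresentation (g i) x : (1 - T).ker.toSubmodule) : M) =
      ∑ i, ρ (g i) x := by
    rw [AddSubmonoidClass.coe_finsetSum]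
    rfl
  have hmem : Submodule.mkQ ((tateNorm l T).range.toSubmodule.comap
      (1 - T).ker.toSubmodule.subtype) (∑ i, (1 - T).ker.toRepresentation (g i) x) = 0 :=
    (Submodule.Quotient.mk_eq_zero _).2 (Submodule.mem_comap.2
      (mem_range_tateNorm.2 ⟨z, hz.trans hsum.symm⟩))
  rw [map_sum] at hmem
  exact hmem

/-- Tate cohomology preserves cuspidality. -/
theorem CuspSum.tateH0 {R M : Type*} [CommRing R] [AddCommGroup M] [Module R M]
    {ρ : Representation R (GL (Fin n) 𝓀[F]) M} (hρ : CuspSum ρ) (hσ : IsArithFrobenius σ)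
    (hl : l.Prime) (h : IsUnramifiedOfDegree E F l)
    (T : Representation.IntertwiningMap (ρ.comp (glResidueIncl E F n))
      (ρ.comp (glResidueIncl E F n)))
    (hT : ∀ g v, T (ρ g v) = ρ (glResidueFrob E F n g) (T v)) :
    CuspSum (LevelZero.tateH0 l T) := by
  intro m hm hmn v
  have := Fintype.ofFinite (radGroup 𝓀[E] n m)
  induction v using Submodule.Quotient.induction_on with | H x =>
  have hTx : T (x : M) = x := mem_ker_one_sub.1 x.2
  have hz := hρ.exists_sum_eq_norm hσ hl h (T := T.toLinearMap) (x := (x : M)) hT hTx hm hmn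
  refine hz.elim fun z hz => tateH0_eq_zero (fun u : radGroup 𝓀[E] n m => (u : GL (Fin n) 𝓀[E])) x hz
end TateCuspidal

/-! ## Operators on compactly induced representations -/

section EquivEv

variable {R G Γ V X V' X' : Type*} [CommRing R] [Group G] [Group Γ] [AddCommGroup V] [Module R V]
  [AddCommGroup X] [Module R X] {H : Subgroup G} {θ : H →* Γ} {ρ : Representation R Γ V}
  {P : Representation R G X} [AddCommGroup V'] [Module R V'] [AddCommGroup X'] [Module R X']
  {ρ' : Representation R Γ V'} {P' : Representation R G X'}

theorem IndData.ev_equiv (D : IndData θ ρ P) (D' : IndData θ ρ' P') (e : ρ.Equiv ρ') (x : X) :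
    D'.ev (D.equiv D' e x) = e (D.ev x) := by
  have h : ∀ (q : Quotient (QuotientGroup.rightRel H)) x,
      D'.ev (P' q.out (D.equiv D' e x)) = e (D.ev (P q.out x)) := fun q x => by
    obtain ⟨f, rfl⟩ := D.finsuppEquiv.surjective x
    change D'.ev (P' q.out (D'.finsuppEquiv (Finsupp.mapRange.linearEquiv e.toLinearEquiv
      (D.finsuppEquiv.symm (D.finsuppEquiv f))))) = _
    rw [LinearEquiv.symm_apply_apply, ev_finsuppEquiv, ev_finsuppEquiv]
    rfl
  let q : Quotient (QuotientGroup.rightRel H) := Quotient.mk _ 1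
  have := h q (P q.out⁻¹ x)
  rwa [equiv_apply_rep, rep_apply_apply, rep_apply_apply, mul_inv_cancel, map_one, map_one] at this

theorem IndData.equiv_sec (D : IndData θ ρ P) (D' : IndData θ ρ' P') (e : ρ.Equiv ρ') (v : V) :
    D.equiv D' e (D.sec v) = D'.sec (e v) := by
  refine D'.ext_ev fun g => ?_
  rw [← equiv_apply_rep, D.ev_equiv D']
  by_cases hg : g ∈ H
  · lift g to H using hg
    rw [D.ev_apply, D'.ev_apply, D.ev_sec, D'.ev_sec, equiv_apply_rep]
  · rw [D.ev_apply_sec g hg, D'.ev_apply_sec g hg, map_zero]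

end EquivEv

section Twist

variable {R : Type*} [CommRing R] {GF ΓF GE ΓE : Type*} [Group GF] [Group ΓF] [Group GE] [Group ΓE]
    {HF : Subgroup GF} {HE : Subgroup GE} {θF : HF →* ΓF} {θE : HE →* ΓE} {ι : GE →* GF}
    {κ : ΓE →* ΓF} {σ : GF →* GF} {φ : ΓF →* ΓF} {l : ℕ}
    {V X : Type*} [AddCommGroup V] [Module R V] [AddCommGroup X] [Module R X]
    {ρ : Representation R ΓF V} {P : Representation R GF X}

theorem CyclicDescent.apply_iterate_pred (C : CyclicDescent θF θE ι κ σ φ l) (hl : l ≠ 0) (g : GF) :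
    σ (σ^[l - 1] g) = g := by
  rw [← Function.iterate_succ_apply' σ, Nat.succ_eq_add_one,
    Nat.sub_add_cancel (Nat.one_le_iff_ne_zero.2 hl), C.iterate]

theorem CyclicDescent.map_mem_iff (C : CyclicDescent θF θE ι κ σ φ l) (hl : l ≠ 0) {g : GF} :
    σ g ∈ HF ↔ g ∈ HF := by
  refine ⟨fun h => ?_, fun h => C.map_mem ⟨g, h⟩⟩
  have key : ∀ i, σ^[i] (σ g) ∈ HF := fun i => by
    induction i with
    | zero => exact h
    | succ i ih => rw [Function.iterate_succ_apply']; exact C.map_mem ⟨_, ih⟩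
  have := key (l - 1)
  rwa [← Function.iterate_succ_apply σ, Nat.succ_eq_add_one,
    Nat.sub_add_cancel (Nat.one_le_iff_ne_zero.2 hl), C.iterate] at this

/-- Twisting a compactly induced representation by `σ`. -/
def IndData.twist (C : CyclicDescent θF θE ι κ σ φ l) (hl : l ≠ 0) (D : IndData θF ρ P) :
    IndData θF (ρ.comp φ) (P.comp σ) where
  ev := D.ev
  sec := D.sec
  ev_apply h x := by
    have := D.ev_apply ⟨σ h, C.map_mem h⟩ x
    rwa [C.red_map h _ rfl] at this
  sec_apply h x := by
    have := D.sec_apply ⟨σ h, C.map_mem h⟩ x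
    rwa [C.red_map h _ rfl] at this
  ev_sec := D.ev_sec
  ev_apply_sec g hg v := D.ev_apply_sec _ (fun h => hg ((C.map_mem_iff hl).1 h)) v
  mem_closure x := by
    refine AddSubgroup.closure_mono ?_ (D.mem_closure x)
    rintro _ ⟨g, v, rfl⟩
    refine ⟨σ^[l - 1] g, v, ?_⟩
    rw [MonoidHom.comp_apply, C.apply_iterate_pred hl]

/-- An operator of finite order that intertwines `ρ` with `ρ ∘ φ` as an equivalence. -/
def twistEquiv {Γ : Type*} [Group Γ] {ρ : Representation R Γ V} {φ : Γ →* Γ} (hl : l ≠ 0)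
    {T : V →ₗ[R] V} (hT : IsTwistOperator φ l ρ T) : ρ.Equiv (ρ.comp φ) :=
  Representation.Equiv.mk
    (LinearEquiv.ofLinearMap T (T ^ (l - 1))
      (by rw [← Module.End.mul_eq_comp, ← pow_succ',
        Nat.sub_add_cancel (Nat.one_le_iff_ne_zero.2 hl), hT.2]; rfl)
      (by rw [← Module.End.mul_eq_comp, ← pow_succ,
        Nat.sub_add_cancel (Nat.one_le_iff_ne_zero.2 hl), hT.2]; rfl))
    fun g => LinearMap.ext fun v => hT.1 g v

/-- `P` and its conjugate by `σ` are induced from `ρ` and `ρ ∘ φ`, which `T` identifies, so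
uniqueness of the induction produces `T'`. Its order is visible on values, because `ev` turns `T' ^
l` into `T ^ l`. -/
theorem IndData.exists_twist (C : CyclicDescent θF θE ι κ σ φ l) (hl : l ≠ 0) (D : IndData θF ρ P)
    {T : V →ₗ[R] V} (hT : IsTwistOperator φ l ρ T) :
    ∃ T' : X →ₗ[R] X, IsTwistOperator σ l P T' ∧ (∀ x, D.ev (T' x) = T (D.ev x)) ∧
      ∀ v, T' (D.sec v) = D.sec (T v) := by
  let E := D.equiv (D.twist C hl) (twistEquiv hl hT)
  have hE : ∀ g x, E (P g x) = P (σ g) (E x) := fun g x => equiv_apply_rep E g x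
  have hev : ∀ x, D.ev (E x) = T (D.ev x) := fun x => D.ev_equiv (D.twist C hl) (twistEquiv hl hT) x
  have hpow : ∀ i g x, (E.toLinearMap ^ i) (P g x) = P (σ^[i] g) ((E.toLinearMap ^ i) x) := by
    intro i g x
    induction i with
    | zero => rfl
    | succ i ih =>
      rw [pow_succ', Module.End.mul_apply, ih, Function.iterate_succ_apply']
      exact hE _ _
  refine ⟨E.toLinearMap, ⟨hE, LinearMap.ext fun x => D.ext_ev fun g => ?_⟩, hev,
    D.equiv_sec (D.twist C hl) (twistEquiv hl hT)⟩
  rw [← C.iterate g, ← hpow, semiconj_pow (f := D.ev) (S := E.toLinearMap) hev, hT.2, C.iterate]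
  rfl

theorem IndData.map_mem_induce (C : CyclicDescent θF θE ι κ σ φ l) (hl : l ≠ 0)
    (D : IndData θF ρ P) {T : V →ₗ[R] V} {T' : X →ₗ[R] X}
    (hT' : ∀ g x, T' (P g x) = P (σ g) (T' x)) (hev : ∀ x, D.ev (T' x) = T (D.ev x))
    {Y : Subrepresentation ρ} (hY : ∀ v ∈ Y.toSubmodule, T v ∈ Y.toSubmodule) {x : X}
    (hx : x ∈ (D.induce Y).toSubmodule) : T' x ∈ (D.induce Y).toSubmodule := fun g => by
  rw [← C.apply_iterate_pred hl g, ← hT', hev]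
  exact hY _ (hx _)

theorem IndData.mem_of_map_mem_induce (D : IndData θF ρ P) {T : V →ₗ[R] V} {T' : X →ₗ[R] X}
    (hev : ∀ x, D.ev (T' x) = T (D.ev x)) {Y : Subrepresentation ρ}
    (hY : ∀ x ∈ (D.induce Y).toSubmodule, T' x ∈ (D.induce Y).toSubmodule) {v : V}
    (hv : v ∈ Y.toSubmodule) : T v ∈ Y.toSubmodule := by
  rw [← D.ev_sec v, ← hev]
  exact D.ev_mem (hY _ (D.sec_mem hv))

/-- An operator that intertwines `P` with `P ∘ σ` commutes with the fixed points of `σ`. -/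
def twistIntertwining {G Γ X : Type*} [Group G] [Group Γ] [AddCommGroup X] [Module R X]
    {P : Representation R G X} {σ : G →* G} {ι : Γ →* G} (hι : ∀ g, σ (ι g) = ι g) (T : X →ₗ[R] X)
    (hT : ∀ g x, T (P g x) = P (σ g) (T x)) :
    Representation.IntertwiningMap (P.comp ι) (P.comp ι) where
  toLinearMap := T
  isIntertwining' g := LinearMap.ext fun x => (hT (ι g) x).trans (by rw [hι]; rfl)

end Twist

section Lattices

variable {l : ℕ} [Fact l.Prime] {G Γ : Type*} [Group G] [Group Γ] {H : Subgroup G} {θ : H →* Γ}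
  {V X : Type*} [AddCommGroup V] [Module (PadicAlgCl l) V] [AddCommGroup X]
  [Module (PadicAlgCl l) X] {π : Representation (PadicAlgCl l) Γ V}
  {P : Representation (PadicAlgCl l) G X}

/-- The lattices of a compactly induced representation are the induced lattices. -/
theorem IsLattice.exists_eq_induce [FiniteDimensional (PadicAlgCl l) V] {D : IndData θ π P} {p : ℕ}
    (hD : D.HasAvg p) (hp : IsUnit (p : ZlBar l)) (hθ : Function.Surjective θ)
    {Λ : Subrepresentation (integralRestrict l P)} (hΛ : IsLattice l Λ) :
    ∃ L, IsLattice l L ∧ D.integral.induce L = Λ := by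
  have h := hD.integral.induce_evalSub hp hθ Λ
  exact ⟨_, IsLattice.of_induce D (h.symm ▸ hΛ), h⟩

/-- The homothety of the two lattices commutes with the group. Its explicit form is kept because it
also commutes with every `ℚ̄_ℓ`-linear operator `T`. -/
theorem IsLattice.exists_equiv [Nontrivial V] [FiniteDimensional (PadicAlgCl l) V]
    {L L' : Subrepresentation (integralRestrict l π)} (hL : IsLattice l L) (hL' : IsLattice l L')
    (hirr : (modL l L.toRepresentation).IsIrreducible) :
    ∃ (c : PadicAlgCl l) (e : L.toRepresentation.Equiv L'.toRepresentation),
      ∀ x, (e x : V) = c • (x : V) := by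
  obtain ⟨c, hc, h⟩ := hL.exists_homothety hL'
  have hinv : ∀ y ∈ L', c⁻¹ • y ∈ L := fun y hy => (h _).2 (by rwa [smul_inv_smul₀ hc])
  have hsmul : ∀ (a : ZlBar l) (d : PadicAlgCl l) (y : V), d • a • y = a • d • y :=
    fun a d y => smul_comm (M := PadicAlgCl l) d (a : PadicAlgCl l) y
  refine ⟨c, Representation.Equiv.mk
    { toFun := fun x => ⟨c • (x : V), (h _).1 x.2⟩
      invFun := fun y => ⟨c⁻¹ • (y : V), hinv _ y.2⟩
      map_add' := fun x y => Subtype.ext (smul_add _ _ _)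
      map_smul' := fun a x => Subtype.ext (hsmul a c _)
      left_inv := fun x => Subtype.ext (inv_smul_smul₀ hc _)
      right_inv := fun x => Subtype.ext (smul_inv_smul₀ hc _) } fun g =>
    LinearMap.ext fun x => Subtype.ext ((map_smul (π g) c (x : V)).symm), fun x => rfl⟩

/-- The restriction to a lattice of an operator that intertwines conjugate representations. -/
theorem exists_restrict {ι : Γ →* G} {σ : G →* G} (hι : ∀ g, σ (ι g) = ι g)
    {Λ : Subrepresentation (integralRestrict l P)} {T : X →ₗ[PadicAlgCl l] X}
    (hT : ∀ g x, T (P g x) = P (σ g) (T x)) (hΛ : ∀ x ∈ Λ.toSubmodule, T x ∈ Λ.toSubmodule) :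
    ∃ TL : Representation.IntertwiningMap (Λ.toRepresentation.comp ι) (Λ.toRepresentation.comp ι),
      (∀ x, ((TL x : Λ.toSubmodule) : X) = T x) ∧
      ∀ g x, TL (Λ.toRepresentation g x) = Λ.toRepresentation (σ g) (TL x) :=
  ⟨twistIntertwining hι ((T.restrictScalars (ZlBar l)).restrict hΛ) fun g x => Subtype.ext (hT g x),
    fun _ => rfl, fun g x => Subtype.ext (hT g x)⟩

/-- Compact induction commutes with the reduction of the Tate cohomology of lattices. -/
def IndData.tateLattice {GF ΓF GE ΓE : Type*} [Group GF] [Group ΓF] [Group GE] [Group ΓE]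
    {HF : Subgroup GF} {HE : Subgroup GE} {θF : HF →* ΓF} {θE : HE →* ΓE} {ι : GE →* GF}
    {κ : ΓE →* ΓF} {σ : GF →* GF} {φ : ΓF →* ΓF} {π : Representation (PadicAlgCl l) ΓF V}
    {P : Representation (PadicAlgCl l) GF X} (C : CyclicDescent θF θE ι κ σ φ l)
    (D : IndData θF π P) {T : V →ₗ[PadicAlgCl l] V} {T' : X →ₗ[PadicAlgCl l] X}
    (hT' : ∀ g x, T' (P g x) = P (σ g) (T' x)) (hev : ∀ x, D.ev (T' x) = T (D.ev x))
    (hsec : ∀ v, T' (D.sec v) = D.sec (T v)) (L : Subrepresentation (integralRestrict l π))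
    (TL : Representation.IntertwiningMap (L.toRepresentation.comp κ) (L.toRepresentation.comp κ))
    (hTL : ∀ x, ((TL x : L.toSubmodule) : V) = T x)
    (TΛ : Representation.IntertwiningMap ((D.integral.induce L).toRepresentation.comp ι)
      ((D.integral.induce L).toRepresentation.comp ι))
    (hTΛ : ∀ x, ((TΛ x : (D.integral.induce L).toSubmodule) : X) = T' x) :
    IndData θE (tateH0 l TL) (tateH0 l TΛ) :=
  (D.integral.restrictSub L).tate C Fact.out TL TΛ
    (fun g x => Subtype.ext ((hTΛ _).trans ((hT' g x).trans
      (congrArg (P (σ g)) (hTΛ x).symm))))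
    (fun x => Subtype.ext ((congrArg D.ev (hTΛ x)).trans ((hev x).trans
      (hTL ((D.integral.restrictSub L).ev x)).symm)))
    fun v => Subtype.ext ((hTΛ ((D.integral.restrictSub L).sec v)).trans
      ((hsec v).trans (congrArg D.sec (hTL v).symm)))

/-- The Tate cohomology of a lattice is finitely generated. -/
theorem finite_tateH0 {Γ' M : Type*} [Group Γ'] [AddCommGroup M] [Module (ZlBar l) M]
    [Module.Finite (ZlBar l) M] [Module.IsTorsionFree (ZlBar l) M]
    {τ : Representation (ZlBar l) Γ' M} (T : τ.IntertwiningMap τ) :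
    Module.Finite (ZlBar l) ((1 - T).ker.toSubmodule ⧸
      (tateNorm l T).range.toSubmodule.comap (1 - T).ker.toSubmodule.subtype) := by
  let f : M →ₗ[ZlBar l] M := (1 - T).toLinearMap
  have : Module.Finite (ZlBar l) (LinearMap.range f) := Module.Finite.range f
  have : Module.Flat (ZlBar l) (LinearMap.range f) := by
    rw [Module.Flat.flat_iff_torsion_eq_bot_of_isBezout, ← Submodule.isTorsionFree_iff_torsion_eq_bot]
    infer_instance
  have : Module.Free (ZlBar l) (LinearMap.range f) := Module.free_of_flat_of_isLocalRing
  -- The image of `1 - T` is free, hence finitely presented; so the kernel is finitely generated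
  -- even though `ℤ̄_ℓ` is not noetherian.
  have : Module.FinitePresentation (ZlBar l) (LinearMap.range f) :=
    Module.finitePresentation_of_projective _ _
  have h := Module.FinitePresentation.fg_ker f.rangeRestrict f.surjective_rangeRestrict
  rw [LinearMap.ker_rangeRestrict] at h
  have : Module.Finite (ZlBar l) (1 - T).ker.toSubmodule := Module.Finite.iff_fg.2 h
  infer_instance

end Lattices

/-! ## Reductions and Tate cohomology of lifts -/

section LiftReduction

variable {p l n : ℕ} [hp : Fact p.Prime] [hl : Fact l.Prime] {K : Type*} [Field K] [ValuativeRel K]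
  [TopologicalSpace K] [IsNonarchimedeanLocalField K] [CharP 𝓀[K] p] {ϖ : Kˣ}

/-- Any compact induction of a cuspidal representation has the lift of the semisimplification as
its semisimplification. -/
theorem IsSemisimplification.lift (hlp : l ≠ p) (hϖ : IsUniformizer ϖ) (hn : 1 ≤ n)
    {V W X : Type*} [AddCommGroup V] [Module (FlBar l) V] [AddCommGroup W] [Module (FlBar l) W]
    [AddCommGroup X] [Module (FlBar l) X] {ρ : Representation (FlBar l) (GL (Fin n) 𝓀[K]) V}
    {S : Representation (FlBar l) (GL (Fin n) 𝓀[K]) W} (hS : IsSemisimplification S ρ)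
    (hρ : CuspSum ρ) {P : Representation (FlBar l) (GL (Fin n) K) X}
    (D : IndData (centerIntRed hϖ hn) ρ P) : IsSemisimplification (lift ϖ S) P :=
  (hS.induced (isUnit_natCast_FlBar l hp.out hlp) (centerIntRed_surjective hϖ hn)
    (liftIndData_hasAvg hϖ hn (isUnit_natCast_FlBar l hp.out hlp) hρ) (liftIndData hϖ hn S)).congr
    ((liftIndData hϖ hn ρ).equiv D (.refl _)) (.refl _)

variable {V W : Type*} [AddCommGroup V] [Module (PadicAlgCl l) V] [AddCommGroup W]
  [Module (FlBar l) W] {π : Representation (PadicAlgCl l) (GL (Fin n) 𝓀[K]) V}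

theorem CuspSum.modL_lattice (hπ : CuspSum π)
    (L : Subrepresentation (LevelZero.integralRestrict l π)) :
    CuspSum (LevelZero.modL l L.toRepresentation) :=
  (hπ.integralRestrict.toRepresentation L).modL

/-- The induced lattice works: its reduction is the induction of the reduction. -/
theorem IsReduction.lift (hlp : l ≠ p) (hϖ : IsUniformizer ϖ) (hn : 1 ≤ n) (hπ : CuspSum π)
    {S : Representation (FlBar l) (GL (Fin n) 𝓀[K]) W} (h : IsReduction l S π) :
    IsReduction l (lift ϖ S) (lift ϖ π) := by
  obtain ⟨L, hL, hS⟩ := h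
  exact ⟨_, hL.induce (liftIndData hϖ hn π), hS.lift hlp hϖ hn (hπ.modL_lattice L)
    ((liftIndData hϖ hn π).integral.restrictSub L).modL⟩

theorem exists_eq_induce_lift (hlp : l ≠ p) (hϖ : IsUniformizer ϖ) (hn : 1 ≤ n) (hπ : CuspSum π)
    [FiniteDimensional (PadicAlgCl l) V]
    {Λ : Subrepresentation (integralRestrict l (LevelZero.lift ϖ π))} (hΛ : IsLattice l Λ) :
    ∃ L, IsLattice l L ∧ (liftIndData hϖ hn π).integral.induce L = Λ :=
  hΛ.exists_eq_induce (liftIndData_hasAvg hϖ hn (isUnit_natCast_PadicAlgCl l hp.out) hπ)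
    (isUnit_natCast_ZlBar l hp.out hlp) (centerIntRed_surjective hϖ hn)

/-- Any lattice of the lift is induced from some `L'`, which is homothetic to `L` because the
reduction of `L` is irreducible; Jordan–Hölder then identifies the semisimplifications. -/
theorem IsReduction.equiv_lift (hlp : l ≠ p) (hϖ : IsUniformizer ϖ) (hn : 1 ≤ n) (hπ : CuspSum π)
    [π.IsIrreducible] {S : Representation (FlBar l) (GL (Fin n) 𝓀[K]) W} (h : IsReduction l S π)
    {W' : Type*} [AddCommGroup W'] [Module (FlBar l) W']
    {S' : Representation (FlBar l) (GL (Fin n) K) W'} (h' : IsReduction l S' (LevelZero.lift ϖ π)) :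
    Nonempty (S'.Equiv (LevelZero.lift ϖ S)) := by
  obtain ⟨L, hL, hS⟩ := h
  obtain ⟨Λ, hΛ, hS'⟩ := h'
  have := finiteDimensional_of_isIrreducible π
  have : Nontrivial V := nontrivial_of_isIrreducible π
  obtain ⟨L', hL', rfl⟩ := exists_eq_induce_lift hlp hϖ hn hπ hΛ
  obtain ⟨-, e, -⟩ := hL.exists_equiv hL' (hL.modL_isIrreducible hlp hπ)
  exact hS'.unique ((hS.congr (modLEquiv e) (.refl _)).lift hlp hϖ hn (hπ.modL_lattice L')
    ((liftIndData hϖ hn π).integral.restrictSub L').modL)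

end LiftReduction

/-! ### The lift and the Frobenius twist. -/

section LiftFrobTwist

variable {l n : ℕ} [Fact l.Prime] {K : Type*} [Field K] [ValuativeRel K]
  [TopologicalSpace K] [IsNonarchimedeanLocalField K] {ϖ : Kˣ}

/-- The lift commutes with the Frobenius twist. -/
theorem nonempty_lift_frobTwist_equiv {V : Type*} [AddCommGroup V] [Module (FlBar l) V]
    (α : Representation (FlBar l) (GL (Fin n) 𝓀[K]) V) :
    Nonempty ((lift ϖ (frobTwist l α)).Equiv (frobTwist l (lift ϖ α))) := by
  -- The twist leaves the operators unchanged, so both sides consist of the same functions, with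
  -- scalars twisted in the same way.
  let e : liftSpace ϖ (frobTwist l α) ≃ₗ[FlBar l] FrobTwist l (liftSpace ϖ α) :=
    { toFun := fun f => (⟨f.1, f.2⟩ : liftSpace ϖ α)
      invFun := fun f => ⟨Subtype.val (p := (· ∈ liftSpace ϖ α)) f,
        Subtype.property (p := (· ∈ liftSpace ϖ α)) f⟩
      map_add' := fun _ _ => rfl
      map_smul' := fun _ _ => rfl
      left_inv := fun _ => rfl
      right_inv := fun _ => rfl }
  exact ⟨Representation.Equiv.mk e fun g => LinearMap.ext fun f => rfl⟩

end LiftFrobTwist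

/-! ### Tate cohomology of lattices for operators in characteristic zero. -/

section InducedTate

universe uV uX

/-- Equivalences can be restricted along homomorphisms. -/
def compEquiv {R G Γ X Y : Type*} [CommRing R] [Group G] [Group Γ] [AddCommGroup X] [Module R X]
    [AddCommGroup Y] [Module R Y] {P : Representation R G X} {Q : Representation R G Y}
    (e : P.Equiv Q) (ι : Γ →* G) : Representation.Equiv (P.comp ι) (Q.comp ι) :=
  Representation.Equiv.mk e.toLinearEquiv fun g =>
    LinearMap.ext fun x => equiv_apply_rep e (ι g) x

variable {l : ℕ} [hl : Fact l.Prime] {GF ΓF GE ΓE : Type*} [Group GF] [Group ΓF] [Group GE]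
  [Group ΓE] {HF : Subgroup GF} {HE : Subgroup GE} {θF : HF →* ΓF} {θE : HE →* ΓE} {ι : GE →* GF}
  {κ : ΓE →* ΓF} {σ : GF →* GF} {φ : ΓF →* ΓF} {V : Type uV} {X : Type uX} {W Z : Type*}
  [AddCommGroup V] [Module (PadicAlgCl l) V] [AddCommGroup X] [Module (PadicAlgCl l) X]
  [AddCommGroup W] [Module (FlBar l) W] [AddCommGroup Z] [Module (FlBar l) Z]
  {ρ : Representation (PadicAlgCl l) ΓF V} {P : Representation (PadicAlgCl l) GF X}
  {T : V →ₗ[PadicAlgCl l] V} {T' : X →ₗ[PadicAlgCl l] X} {S : Representation (FlBar l) ΓE W}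
  {Q : Representation (FlBar l) GE Z}

/-- The predicate `K` holds for the reductions of the Tate cohomology of all the lattices that are
stable under `T`. -/
def ForallTateH0 (κ : ΓE →* ΓF) (ρ : Representation (PadicAlgCl l) ΓF V)
    (T : V →ₗ[PadicAlgCl l] V) (K : ∀ {M : Type uV} [AddCommGroup M] [Module (FlBar l) M],
      Representation (FlBar l) ΓE M → Prop) : Prop :=
  ∀ (L : Subrepresentation (integralRestrict l ρ))
    (TL : Representation.IntertwiningMap (L.toRepresentation.comp κ) (L.toRepresentation.comp κ)),
    (∀ x, ((TL x : L.toSubmodule) : V) = T x) → K (modL l (tateH0 l TL))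

/-- The Tate cohomology of an induced lattice is induced from that of the lattice. -/
theorem IsTateH0.induce (C : CyclicDescent θF θE ι κ σ φ l) (hι : ∀ g, σ (ι g) = ι g)
    (D : IndData θF ρ P) (hT' : ∀ g x, T' (P g x) = P (σ g) (T' x))
    (hev : ∀ x, D.ev (T' x) = T (D.ev x)) (hsec : ∀ v, T' (D.sec v) = D.sec (T v))
    {K : ∀ {M : Type uV} [AddCommGroup M] [Module (FlBar l) M],
      Representation (FlBar l) ΓE M → Prop} (hK : ForallTateH0 κ ρ T K)
    (hlift : ∀ {M : Type uV} [AddCommGroup M] [Module (FlBar l) M]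
      (τ : Representation (FlBar l) ΓE M) {Y : Type uX} [AddCommGroup Y] [Module (FlBar l) Y]
      (Q' : Representation (FlBar l) GE Y) (_ : IndData θE τ Q'), K τ →
      IsSemisimplification S τ → IsSemisimplification Q Q')
    (h : IsTateH0 l κ S ρ T) : IsTateH0 l ι Q P T' := by
  obtain ⟨L, TL, hL, hTL, hS⟩ := h
  have hLT : ∀ v ∈ L.toSubmodule, T v ∈ L.toSubmodule := fun v hv => by
    rw [← hTL ⟨v, hv⟩]
    exact (TL ⟨v, hv⟩).2
  have hmem : ∀ x ∈ (D.integral.induce L).toSubmodule,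
      T' x ∈ (D.integral.induce L).toSubmodule := fun x hx =>
    D.integral.map_mem_induce C hl.out.ne_zero
      (T := T.restrictScalars (ZlBar l)) (T' := T'.restrictScalars (ZlBar l)) hT' hev hLT hx
  obtain ⟨TΛ, hTΛ, -⟩ := exists_restrict hι hT' hmem
  exact ⟨_, TΛ, hL.induce D, hTΛ, hlift _ _
    (D.tateLattice C hT' hev hsec L TL hTL TΛ hTΛ).modL (hK L TL hTL) hS⟩

/-- A `T'`-stable lattice is induced from a `T`-stable `L'`, and the homothety from `L` to `L'`
commutes with `T`, so it identifies their Tate cohomologies. The predicate `K` stands for the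
cuspidality that inducing a semisimplification requires. -/
theorem IsTateH0.equiv_induce [FiniteDimensional (PadicAlgCl l) V] [Nontrivial V]
    (C : CyclicDescent θF θE ι κ σ φ l) (hκ : ∀ g, φ (κ g) = κ g)
    (D : IndData θF ρ P) {p : ℕ} (hD : D.HasAvg p) (hp : IsUnit (p : ZlBar l))
    (hθ : Function.Surjective θF)
    (hirr : ∀ L : Subrepresentation (integralRestrict l ρ), IsLattice l L →
      (modL l L.toRepresentation).IsIrreducible)
    (hT : ∀ g v, T (ρ g v) = ρ (φ g) (T v)) (hT' : ∀ g x, T' (P g x) = P (σ g) (T' x))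
    (hev : ∀ x, D.ev (T' x) = T (D.ev x)) (hsec : ∀ v, T' (D.sec v) = D.sec (T v))
    {K : ∀ {M : Type uV} [AddCommGroup M] [Module (FlBar l) M],
      Representation (FlBar l) ΓE M → Prop} (hK : ForallTateH0 κ ρ T K)
    (hlift : ∀ {M : Type uV} [AddCommGroup M] [Module (FlBar l) M]
      (τ : Representation (FlBar l) ΓE M) {Y : Type uX} [AddCommGroup Y] [Module (FlBar l) Y]
      (Q' : Representation (FlBar l) GE Y) (_ : IndData θE τ Q'), K τ →
      IsSemisimplification S τ → IsSemisimplification Q Q')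
    (h : IsTateH0 l κ S ρ T) {W' : Type*} [AddCommGroup W'] [Module (FlBar l) W']
    {S' : Representation (FlBar l) GE W'} (h' : IsTateH0 l ι S' P T') : Nonempty (S'.Equiv Q) := by
  obtain ⟨L, TL, hL, hTL, hS⟩ := h
  obtain ⟨Λ, TΛ, hΛ, hTΛ, hS'⟩ := h'
  obtain ⟨L', hL', rfl⟩ := hΛ.exists_eq_induce hD hp hθ
  obtain ⟨c, e, he⟩ := hL.exists_equiv hL' (hirr L hL)
  have hmem : ∀ x ∈ (D.integral.induce L').toSubmodule,
      T' x ∈ (D.integral.induce L').toSubmodule := fun x hx => by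
    rw [← hTΛ ⟨x, hx⟩]
    exact (TΛ ⟨x, hx⟩).2
  have hLT : ∀ v ∈ L'.toSubmodule, T v ∈ L'.toSubmodule := fun v hv =>
    D.integral.mem_of_map_mem_induce
      (T := T.restrictScalars (ZlBar l)) (T' := T'.restrictScalars (ZlBar l)) hev hmem hv
  obtain ⟨TL', hTL', -⟩ := exists_restrict hκ hT hLT
  have he' : ∀ x, compEquiv e κ (TL x) = TL' (compEquiv e κ x) := fun x => Subtype.ext (by
    refine (he _).trans ?_
    rw [hTL, hTL', ← map_smul]
    exact congrArg T (he x).symm)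
  have e₂ := tateEquiv l TL TL' (compEquiv e κ) he'
  exact hS'.unique (hlift _ _ (D.tateLattice C hT' hev hsec L' TL' hTL' TΛ hTΛ).modL
    (hK L' TL' hTL') (hS.congr (modLEquiv e₂) (.refl _)))

theorem exists_isTateH0 {V : Type u} [AddCommGroup V] [Module (PadicAlgCl l) V] [Finite ΓF]
    {ρ : Representation (PadicAlgCl l) ΓF V} [ρ.IsIrreducible] (hκ : ∀ g, φ (κ g) = κ g)
    {T : V →ₗ[PadicAlgCl l] V} (hT : IsTwistOperator φ l ρ T) :
    ∃ (W : Type u) (_ : AddCommGroup W) (_ : Module (FlBar l) W)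
      (S : Representation (FlBar l) ΓE W), IsTateH0 l κ S ρ T := by
  have := finiteDimensional_of_isIrreducible ρ
  obtain ⟨L, hL, hTL⟩ := exists_isLattice_of_twist ρ hl.out.pos hT
  obtain ⟨TL, hTL', -⟩ := exists_restrict (Λ := L) hκ hT.1 hTL
  have := hL.finite
  have : Module.IsTorsionFree (ZlBar l) V := .trans_faithfulSMul (ZlBar l) (PadicAlgCl l) V
  have := finite_tateH0 TL
  obtain ⟨W, i1, i2, S, hS⟩ := exists_isSemisimplification (modL l (tateH0 l TL))
  exact ⟨W, i1, i2, S, L, TL, hL, hTL', hS⟩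

end InducedTate

section LiftTate

variable {p l n : ℕ} [hp : Fact p.Prime] [hl : Fact l.Prime] {E F : Type*} [Field E]
  [ValuativeRel E] [TopologicalSpace E] [IsNonarchimedeanLocalField E] [CharP 𝓀[E] p] [Field F]
  [ValuativeRel F] [TopologicalSpace F] [IsNonarchimedeanLocalField F] [Algebra E F]
  [ValuativeExtension E F] {σ : F ≃ₐ[E] F} {ϖ : Eˣ}

theorem charP_residueField (E F : Type*) [Field E] [ValuativeRel E] [TopologicalSpace E]
    [IsNonarchimedeanLocalField E] [CharP 𝓀[E] p] [Field F] [ValuativeRel F] [TopologicalSpace F]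
    [IsNonarchimedeanLocalField F] [Algebra E F] [ValuativeExtension E F] : CharP 𝓀[F] p :=
  charP_of_injective_algebraMap (algebraMap 𝓀[E] 𝓀[F]).injective p

/-- An isomorphism `ρ ≅ ρ ∘ Frob` can be normalized to have order dividing `ℓ`. -/
theorem exists_isTwistOperator {C : Type*} [Field C] [IsAlgClosed C] {V : Type*} [AddCommGroup V]
    [Module C V] {G : Type*} [Group G] [Finite G] {ρ : Representation C G V} [ρ.IsIrreducible]
    {φ : G →* G} {r : ℕ} (hr : 0 < r) (hφ : ∀ g, φ^[r] g = g) (e : ρ.Equiv (ρ.comp φ)) :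
    ∃ T, IsTwistOperator φ r ρ T := by
  have := finiteDimensional_of_isIrreducible ρ
  have := nontrivial_of_isIrreducible ρ
  let S : V →ₗ[C] V := e.toLinearMap
  have hS : ∀ g v, S (ρ g v) = ρ (φ g) (S v) := fun g v => equiv_apply_rep e g v
  have hpow : ∀ i g v, (S ^ i) (ρ g v) = ρ (φ^[i] g) ((S ^ i) v) := by
    intro i g v
    induction i with
    | zero => rfl
    | succ i ih =>
      rw [pow_succ', Module.End.mul_apply, ih, hS, Function.iterate_succ_apply']
      rfl
  -- `S ^ r` commutes with `ρ`, so it is a scalar `c`; multiplying `S` by an `r`-th root of `c⁻¹`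
  -- gives order dividing `r`.
  obtain ⟨c, hc⟩ := exists_eq_smul_of_commute (ρ := ρ) (S := S ^ r)
    fun g v => by rw [hpow, hφ]
  have hc0 : c ≠ 0 := by
    rintro rfl
    obtain ⟨v, hv⟩ := exists_ne (0 : V)
    have hinj : Function.Injective (S ^ r) := by
      rw [Module.End.coe_pow]
      exact Function.Injective.iterate e.toLinearEquiv.injective r
    exact hv (hinj (by rw [hc, zero_smul, map_zero]))
  obtain ⟨d, hd⟩ := IsAlgClosed.exists_pow_nat_eq c⁻¹ hr
  refine ⟨d • S, fun g v => ?_, LinearMap.ext fun v => ?_⟩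
  · rw [LinearMap.smul_apply, hS, LinearMap.smul_apply, map_smul]
  · rw [smul_pow, hd, LinearMap.smul_apply, hc, smul_smul, inv_mul_cancel₀ hc0, one_smul]
    rfl

/-- The formula for `T' f` at `σ g` is the compatibility of `T'` with evaluation at `1`, applied to
the translate of `f` by `g`. -/
theorem IsArithFrobenius.exists_twist_lift (hσ : IsArithFrobenius σ)
    (hFE : IsUnramifiedOfDegree E F l) (hϖ : IsUniformizer ϖ) (hn : 1 ≤ n) {R V : Type*}
    [CommRing R] [AddCommGroup V] [Module R V] {ρ : Representation R (GL (Fin n) 𝓀[F]) V}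
    {T : V →ₗ[R] V} (hT : IsTwistOperator (glResidueFrob E F n) l ρ T) :
    ∃ T' : liftSpace (unitIncl E F ϖ) ρ →ₗ[R] liftSpace (unitIncl E F ϖ) ρ,
      (∀ f g, (T' f).1 (glFrob n σ g) = T (f.1 g)) ∧
      IsTwistOperator (glFrob n σ) l (LevelZero.lift (unitIncl E F ϖ) ρ) T' ∧
      (∀ f, (liftIndData (hϖ.unitIncl hFE.2) hn ρ).ev (T' f) =
        T ((liftIndData (hϖ.unitIncl hFE.2) hn ρ).ev f)) ∧
      ∀ v, T' ((liftIndData (hϖ.unitIncl hFE.2) hn ρ).sec v) =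
        (liftIndData (hϖ.unitIncl hFE.2) hn ρ).sec (T v) := by
  obtain ⟨T', hT', hev, hsec⟩ := (liftIndData (hϖ.unitIncl hFE.2) hn ρ).exists_twist
    (hσ.cyclicDescent hl.out hFE hϖ hn) hl.out.ne_zero hT
  refine ⟨T', fun f g => ?_, hT', hev, hsec⟩
  have h1 := hev (LevelZero.lift (unitIncl E F ϖ) ρ g f)
  rw [hT'.1] at h1
  change (T' f).1 (1 * glFrob n σ g) = T (f.1 (1 * g)) at h1
  rwa [one_mul, one_mul] at h1

variable {V W : Type*} [AddCommGroup V] [Module (PadicAlgCl l) V] [AddCommGroup W]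
  [Module (FlBar l) W] {ρ : Representation (PadicAlgCl l) (GL (Fin n) 𝓀[F]) V}
  {S : Representation (FlBar l) (GL (Fin n) 𝓀[E]) W}

variable {X : Type*} [AddCommGroup X] [Module (PadicAlgCl l) X]
  {P : Representation (PadicAlgCl l) (GL (Fin n) F) X} {T : V →ₗ[PadicAlgCl l] V}
  {T' : X →ₗ[PadicAlgCl l] X}

theorem CuspSum.forallTateH0 (hFE : IsUnramifiedOfDegree E F l) (hσ : IsArithFrobenius σ)
    (hρ : CuspSum ρ) (hT : IsTwistOperator (glResidueFrob E F n) l ρ T) :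
    ForallTateH0 (glResidueIncl E F n) ρ T fun τ => CuspSum τ := by
  intro L TL hTL
  have hTL' : ∀ g v, TL (L.toRepresentation g v) =
      L.toRepresentation (glResidueFrob E F n g) (TL v) := fun g v => Subtype.ext (by
    refine (hTL _).trans ((hT.1 g v).trans ?_)
    rw [← hTL]
    rfl)
  exact ((hρ.integralRestrict.toRepresentation L).tateH0 hσ hl.out hFE TL hTL').modL

theorem IsTateH0.lift (hlp : l ≠ p) (hn : 1 ≤ n)
    (hFE : IsUnramifiedOfDegree E F l) (hσ : IsArithFrobenius σ) (hϖ : IsUniformizer ϖ)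
    (D : IndData (centerIntRed (hϖ.unitIncl hFE.2) hn) ρ P) (hρ : CuspSum ρ)
    (hT : IsTwistOperator (glResidueFrob E F n) l ρ T) (hT' : IsTwistOperator (glFrob n σ) l P T')
    (hev : ∀ x, D.ev (T' x) = T (D.ev x)) (hsec : ∀ v, T' (D.sec v) = D.sec (T v))
    (h : IsTateH0 l (glResidueIncl E F n) S ρ T) :
    IsTateH0 l (glIncl E F n) (LevelZero.lift ϖ S) P T' :=
  h.induce (hσ.cyclicDescent hl.out hFE hϖ hn) glFrob_glIncl D hT'.1 hev hsec
    (hρ.forallTateH0 hFE hσ hT) fun _ _ _ _ _ D' hτ hS => hS.lift hlp hϖ hn hτ D'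

theorem IsTateH0.equiv_lift (hlp : l ≠ p) (hn : 1 ≤ n)
    (hFE : IsUnramifiedOfDegree E F l) (hσ : IsArithFrobenius σ) (hϖ : IsUniformizer ϖ)
    (D : IndData (centerIntRed (hϖ.unitIncl hFE.2) hn) ρ P) (hD : D.HasAvg p)
    (hρ : CuspSum ρ) [ρ.IsIrreducible]
    (hT : IsTwistOperator (glResidueFrob E F n) l ρ T) (hT' : IsTwistOperator (glFrob n σ) l P T')
    (hev : ∀ x, D.ev (T' x) = T (D.ev x)) (hsec : ∀ v, T' (D.sec v) = D.sec (T v))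
    (h : IsTateH0 l (glResidueIncl E F n) S ρ T) {W' : Type*} [AddCommGroup W']
    [Module (FlBar l) W'] {S' : Representation (FlBar l) (GL (Fin n) E) W'}
    (h' : IsTateH0 l (glIncl E F n) S' P T') : Nonempty (S'.Equiv (LevelZero.lift ϖ S)) := by
  have := charP_residueField (p := p) E F
  have := finiteDimensional_of_isIrreducible ρ
  have := nontrivial_of_isIrreducible ρ
  exact h.equiv_induce (hσ.cyclicDescent hl.out hFE hϖ hn) glResidueFrob_glResidueIncl D hD
    (isUnit_natCast_ZlBar l hp.out hlp) (centerIntRed_surjective _ hn)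
    (fun L hL => hL.modL_isIrreducible hlp hρ) hT.1 hT'.1 hev hsec (hρ.forallTateH0 hFE hσ hT)
    (fun _ _ _ _ _ D' hτ hS => hS.lift hlp hϖ hn hτ D') h'

end LiftTate

section TwistEv

variable {R : Type*} [CommRing R] {GF ΓF GE ΓE : Type*} [Group GF] [Group ΓF] [Group GE] [Group ΓE]
    {HF : Subgroup GF} {HE : Subgroup GE} {θF : HF →* ΓF} {θE : HE →* ΓE} {ι : GE →* GF}
    {κ : ΓE →* ΓF} {σ : GF →* GF} {φ : ΓF →* ΓF} {l : ℕ}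
    {V X : Type*} [AddCommGroup V] [Module R V] [AddCommGroup X] [Module R X]
    {ρ : Representation R ΓF V} {P : Representation R GF X}

/-- By `ev_twist`, evaluation intertwines `T'` with `ev ∘ T' ∘ sec`, so the relation `T' ^ l = 1`
descends to the inducing representation. -/
theorem IndData.HasAvg.isTwistOperator_ev (C : CyclicDescent θF θE ι κ σ φ l)
    (hθ : Function.Surjective θF) {D : IndData θF ρ P} {p : ℕ} (h : D.HasAvg p)
    (hp : IsUnit (p : R)) {T' : X →ₗ[R] X} (hT' : IsTwistOperator σ l P T') :
    IsTwistOperator φ l ρ (D.ev ∘ₗ T' ∘ₗ D.sec) := by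
  refine ⟨fun g v => ?_, LinearMap.ext fun v => ?_⟩
  · obtain ⟨h, rfl⟩ := hθ g
    change D.ev (T' (D.sec _)) = _
    rw [← D.sec_apply, hT'.1]
    have := D.ev_apply ⟨σ h, C.map_mem h⟩ (T' (D.sec v))
    rwa [C.red_map h _ rfl] at this
  · have h1 := semiconj_pow (f := D.ev) (S := T') (T := D.ev ∘ₗ T' ∘ₗ D.sec)
      (fun x => h.ev_twist C hp hT'.1 x) l (D.sec v)
    rw [D.ev_sec, hT'.2] at h1
    rw [← h1]
    exact D.ev_sec v

theorem IsTwistOperator.conj {V' : Type*} [AddCommGroup V'] [Module R V']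
    {ρ' : Representation R ΓF V'} {T : V →ₗ[R] V} (hT : IsTwistOperator φ l ρ T)
    (e : ρ.Equiv ρ') :
    IsTwistOperator φ l ρ' (e.toLinearMap ∘ₗ T ∘ₗ e.symm.toLinearMap) := by
  refine ⟨fun g v => ?_, LinearMap.ext fun v => ?_⟩
  · change e (T (e.symm (ρ' g v))) = ρ' (φ g) (e (T (e.symm v)))
    rw [equiv_apply_rep, hT.1, equiv_apply_rep]
  · have h1 := semiconj_pow (f := e.toLinearMap) (S := T)
      (T := e.toLinearMap ∘ₗ T ∘ₗ e.symm.toLinearMap)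
      (fun x => congrArg (fun y => e (T y)) (e.symm_apply_apply x).symm) l (e.symm v)
    rw [hT.2] at h1
    have h2 : e.toLinearMap (e.symm v) = v := e.apply_symm_apply v
    rw [h2] at h1
    rw [← h1]
    exact h2

end TwistEv

/-! ### Tate cohomology of reductions, for operators modulo `𝔩`. -/

section LiftModularTate

variable {p l n : ℕ} [hp : Fact p.Prime] [hl : Fact l.Prime] {E F : Type*} [Field E]
  [ValuativeRel E] [TopologicalSpace E] [IsNonarchimedeanLocalField E] [CharP 𝓀[E] p] [Field F]
  [ValuativeRel F] [TopologicalSpace F] [IsNonarchimedeanLocalField F] [Algebra E F]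
  [ValuativeExtension E F] {σ : F ≃ₐ[E] F} {ϖ : Eˣ}
  {V W : Type*} [AddCommGroup V] [Module (PadicAlgCl l) V] [AddCommGroup W]
  [Module (FlBar l) W] {ρ : Representation (PadicAlgCl l) (GL (Fin n) 𝓀[F]) V}
  {S : Representation (FlBar l) (GL (Fin n) 𝓀[E]) W}

/-- The Tate cohomology of a compactly induced modular representation. -/
theorem IsSemisimplification.lift_tateH0 (hlp : l ≠ p) (hn : 1 ≤ n)
    (hFE : IsUnramifiedOfDegree E F l) (hσ : IsArithFrobenius σ) (hϖ : IsUniformizer ϖ)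
    {M X : Type*} [AddCommGroup M] [Module (FlBar l) M] [AddCommGroup X] [Module (FlBar l) X]
    {τ : Representation (FlBar l) (GL (Fin n) 𝓀[F]) M} (hτ : CuspSum τ)
    {P : Representation (FlBar l) (GL (Fin n) F) X}
    (D : IndData (centerIntRed (hϖ.unitIncl hFE.2) hn) τ P)
    {T : Representation.IntertwiningMap (τ.comp (glResidueIncl E F n))
      (τ.comp (glResidueIncl E F n))}
    (hT : ∀ g v, T (τ g v) = τ (glResidueFrob E F n g) (T v))
    {T' : Representation.IntertwiningMap (P.comp (glIncl E F n)) (P.comp (glIncl E F n))}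
    (hT' : ∀ g x, T' (P g x) = P (glFrob n σ g) (T' x)) (hev : ∀ x, D.ev (T' x) = T (D.ev x))
    (hsec : ∀ v, T' (D.sec v) = D.sec (T v)) (hS : IsSemisimplification S (tateH0 l T)) :
    IsSemisimplification (LevelZero.lift ϖ S) (tateH0 l T') :=
  hS.lift hlp hϖ hn (hτ.tateH0 hσ hl.out hFE T hT)
    (D.tate (hσ.cyclicDescent hl.out hFE hϖ hn) hl.out T T' hT' hev hsec)

/-- The operator lives on the reduced lattice only, and it is induced there, over `𝔽̄_ℓ`; it need
not lift to characteristic zero. -/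
theorem IsModularTateH0.lift (hlp : l ≠ p) (hn : 1 ≤ n)
    (hFE : IsUnramifiedOfDegree E F l) (hσ : IsArithFrobenius σ) (hϖ : IsUniformizer ϖ)
    (hρ : CuspSum ρ)
    (h : IsModularTateH0 l (glResidueFrob E F n) (glResidueIncl E F n) S ρ) :
    IsModularTateH0 l (glFrob n σ) (glIncl E F n) (LevelZero.lift ϖ S)
      (LevelZero.lift (unitIncl E F ϖ) ρ) := by
  obtain ⟨L, T, hL, hT, hS⟩ := h
  let D := ((liftIndData (hϖ.unitIncl hFE.2) hn ρ).integral.restrictSub L).modL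
  obtain ⟨T', hT', hev, hsec⟩ :=
    D.exists_twist (hσ.cyclicDescent hl.out hFE hϖ hn) hl.out.ne_zero hT
  exact ⟨_, twistIntertwining glFrob_glIncl T' hT'.1, hL.induce _, hT',
    hS.lift_tateH0 hlp hn hFE hσ hϖ (hρ.modL_lattice L) D hT.1 hT'.1 hev hsec⟩

/-- `T'` determines the operator `ev ∘ T' ∘ sec` on the reduction of `L'`, an irreducible
representation in characteristic `l`. By `twist_unique` it is the transport of `T` along the
homothety from `L` to `L'`, so arbitrary choices of `T` and `T'` are compatible. -/
theorem IsModularTateH0.equiv_lift (hlp : l ≠ p) (hn : 1 ≤ n)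
    (hFE : IsUnramifiedOfDegree E F l) (hσ : IsArithFrobenius σ) (hϖ : IsUniformizer ϖ)
    (hρ : CuspSum ρ) [ρ.IsIrreducible]
    (h : IsModularTateH0 l (glResidueFrob E F n) (glResidueIncl E F n) S ρ)
    {W' : Type*} [AddCommGroup W']
    [Module (FlBar l) W'] {S' : Representation (FlBar l) (GL (Fin n) E) W'}
    (h' : IsModularTateH0 l (glFrob n σ) (glIncl E F n) S' (LevelZero.lift (unitIncl E F ϖ) ρ)) :
    Nonempty (S'.Equiv (LevelZero.lift ϖ S)) := by
  obtain ⟨L, T, hL, hT, hS⟩ := h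
  obtain ⟨Λ, T', hΛ, hT', hS'⟩ := h'
  have := charP_residueField (p := p) E F
  have := finiteDimensional_of_isIrreducible ρ
  have := nontrivial_of_isIrreducible ρ
  have C := hσ.cyclicDescent hl.out hFE hϖ hn
  obtain ⟨L', hL', rfl⟩ := exists_eq_induce_lift hlp (hϖ.unitIncl hFE.2) hn hρ hΛ
  obtain ⟨-, e, -⟩ := hL.exists_equiv hL' (hL.modL_isIrreducible hlp hρ)
  have hirr := hL'.modL_isIrreducible hlp hρ
  have := hL'.finite
  let D := ((liftIndData (hϖ.unitIncl hFE.2) hn ρ).integral.restrictSub L').modL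
  have hD : D.HasAvg p := IndData.HasAvg.modL (IndData.HasAvg.restrictSub
    (IndData.HasAvg.integral (liftIndData_hasAvg (hϖ.unitIncl hFE.2) hn
      (isUnit_natCast_PadicAlgCl l hp.out) hρ)) L')
  have hpF := isUnit_natCast_FlBar l hp.out hlp
  let T₁ := D.ev ∘ₗ T'.toLinearMap ∘ₗ D.sec
  have hT₁ := hD.isTwistOperator_ev C (centerIntRed_surjective _ hn) hpF hT'
  have hT₁e := twist_unique hT₁ (hT.conj (modLEquiv e))
  let T₁i := twistIntertwining (ι := glResidueIncl E F n) glResidueFrob_glResidueIncl T₁ hT₁.1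
  have hS₁ : IsSemisimplification S (tateH0 l T₁i) := by
    refine hS.congr (tateEquiv l T T₁i (compEquiv (modLEquiv e) (glResidueIncl E F n))
      fun x => ?_) (.refl _)
    have h1 := LinearMap.congr_fun hT₁e (modLEquiv e x)
    refine Eq.trans ?_ h1.symm
    exact congrArg (fun y => modLEquiv e (T y)) ((modLEquiv e).symm_apply_apply x).symm
  exact hS'.unique (hS₁.lift_tateH0 hlp hn hFE hσ hϖ (hρ.modL_lattice L') D hT₁.1 hT'.1
    (fun x => hD.ev_twist C hpF hT'.1 x)
    fun v => hD.twist_sec C hl.out.ne_zero hpF hT'.1 v)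

theorem exists_isModularTateH0 {V : Type u} [AddCommGroup V] [Module (PadicAlgCl l) V]
    {ρ : Representation (PadicAlgCl l) (GL (Fin n) 𝓀[F]) V} [ρ.IsIrreducible]
    {T : V →ₗ[PadicAlgCl l] V} (hT : IsTwistOperator (glResidueFrob E F n) l ρ T) :
    ∃ (W : Type u) (_ : AddCommGroup W) (_ : Module (FlBar l) W)
      (S : Representation (FlBar l) (GL (Fin n) 𝓀[E]) W),
      IsModularTateH0 l (glResidueFrob E F n) (glResidueIncl E F n) S ρ := by
  have := finiteDimensional_of_isIrreducible ρ
  obtain ⟨L, hL, hTL⟩ := exists_isLattice_of_twist ρ hl.out.pos hT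
  have := hL.finite
  let T₀ : L.toSubmodule →ₗ[ZlBar l] L.toSubmodule := (T.restrictScalars (ZlBar l)).restrict hTL
  have hT₀ : T₀ ^ l = 1 := by
    have h1 := fun x => semiconj_pow (f := L.toSubmodule.subtype) (S := T₀)
      (T := T.restrictScalars (ZlBar l)) (fun _ => rfl) l x
    refine LinearMap.ext fun x => Subtype.ext ((h1 x).trans ?_)
    have h2 := LinearMap.congr_fun hT.2 (x : V)
    rw [Module.End.pow_apply] at h2 ⊢
    exact h2
  have hTm : IsTwistOperator (glResidueFrob E F n) l (modL l L.toRepresentation)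
      (T₀.baseChange (FlBar l)) := by
    refine ⟨fun g x => ?_, ?_⟩
    · obtain ⟨x, rfl⟩ := exists_one_tmul l x
      exact congrArg (TensorProduct.tmul _ 1) (Subtype.ext (hT.1 g x))
    · rw [← LinearMap.baseChange_pow, hT₀]
      exact LinearMap.baseChange_id
  let Ti := twistIntertwining (ι := glResidueIncl E F n) glResidueFrob_glResidueIncl _ hTm.1
  obtain ⟨W, i1, i2, S, hS⟩ := exists_isSemisimplification (tateH0 l Ti)
  exact ⟨W, i1, i2, S, L, Ti, hL, hTm, hS⟩

end LiftModularTate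
end LevelZero
end
theorem mainTheorem9 (p l n : ℕ) [Fact p.Prime] [Fact l.Prime] (hlp : l ≠ p) (hn : 1 ≤ n)
    (E : Type v) [Field E] [ValuativeRel E] [TopologicalSpace E] [IsNonarchimedeanLocalField E]
    [CharZero E] [CharP 𝓀[E] p]
    (F : Type w) [Field F] [ValuativeRel F] [TopologicalSpace F] [IsNonarchimedeanLocalField F]
    [Algebra E F] [ValuativeExtension E F] (hFE : IsUnramifiedOfDegree E F l)
    (σ : F ≃ₐ[E] F) (hσ : IsArithFrobenius σ) (ϖ : Eˣ) (hϖ : IsUniformizer ϖ) :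
    -- (1) lifting commutes with reduction mod `ℓ`
    (∀ (V : Type u) [AddCommGroup V] [Module (PadicAlgCl l) V]
      (π : Representation (PadicAlgCl l) (GL (Fin n) 𝓀[E]) V),
      π.IsIrreducible → IsCuspidal π →
      (∃ (W : Type u) (_ : AddCommGroup W) (_ : Module (FlBar l) W)
        (S : Representation (FlBar l) (GL (Fin n) 𝓀[E]) W), IsReduction l S π) ∧
      ∀ (W : Type u) [AddCommGroup W] [Module (FlBar l) W]
        (S : Representation (FlBar l) (GL (Fin n) 𝓀[E]) W), IsReduction l S π →
        IsReduction l (lift ϖ S) (lift ϖ π) ∧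
        ∀ (W' : Type (max u v)) [AddCommGroup W'] [Module (FlBar l) W']
          (S' : Representation (FlBar l) (GL (Fin n) E) W'), IsReduction l S' (lift ϖ π) →
          Nonempty (S'.Equiv (lift ϖ S))) ∧
    -- (2) lifting commutes with the Frobenius twist
    (∀ (V : Type u) [AddCommGroup V] [Module (FlBar l) V]
      (α : Representation (FlBar l) (GL (Fin n) 𝓀[E]) V),
      Nonempty ((lift ϖ (frobTwist l α)).Equiv (frobTwist l (lift ϖ α)))) ∧
    -- (3) lifting commutes with Tate cohomology
    (∀ (V : Type u) [AddCommGroup V] [Module (PadicAlgCl l) V]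
      (ρ : Representation (PadicAlgCl l) (GL (Fin n) 𝓀[F]) V),
      ρ.IsIrreducible → IsCuspidal ρ →
      Nonempty (Representation.Equiv ρ (ρ.comp (glResidueFrob E F n))) →
      -- (3a) `T⁰` of lattices, for a Frobenius operator `T` and the operator `T'` it induces
      (∃ T, IsTwistOperator (glResidueFrob E F n) l ρ T) ∧
      (∀ T, IsTwistOperator (glResidueFrob E F n) l ρ T →
        (∃ (W : Type u) (_ : AddCommGroup W) (_ : Module (FlBar l) W)
          (S : Representation (FlBar l) (GL (Fin n) 𝓀[E]) W),
          IsTateH0 l (glResidueIncl E F n) S ρ T) ∧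
        ∃ T' : liftSpace (unitIncl E F ϖ) ρ →ₗ[PadicAlgCl l] liftSpace (unitIncl E F ϖ) ρ,
          (∀ f g, (T' f).1 (glFrob n σ g) = T (f.1 g)) ∧
          IsTwistOperator (glFrob n σ) l (lift (unitIncl E F ϖ) ρ) T' ∧
          ∀ (W : Type u) [AddCommGroup W] [Module (FlBar l) W]
            (S : Representation (FlBar l) (GL (Fin n) 𝓀[E]) W),
            IsTateH0 l (glResidueIncl E F n) S ρ T →
            IsTateH0 l (glIncl E F n) (lift ϖ S) (lift (unitIncl E F ϖ) ρ) T' ∧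
            ∀ (W' : Type (max u v w)) [AddCommGroup W'] [Module (FlBar l) W']
              (S' : Representation (FlBar l) (GL (Fin n) E) W'),
              IsTateH0 l (glIncl E F n) S' (lift (unitIncl E F ϖ) ρ) T' →
              Nonempty (S'.Equiv (lift ϖ S))) ∧
      -- (3b) `T⁰` of the reductions mod `ℓ`, with no choice of operators
      (∃ (W : Type u) (_ : AddCommGroup W) (_ : Module (FlBar l) W)
        (S : Representation (FlBar l) (GL (Fin n) 𝓀[E]) W),
        IsModularTateH0 l (glResidueFrob E F n) (glResidueIncl E F n) S ρ) ∧
      ∀ (W : Type u) [AddCommGroup W] [Module (FlBar l) W]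
        (S : Representation (FlBar l) (GL (Fin n) 𝓀[E]) W),
        IsModularTateH0 l (glResidueFrob E F n) (glResidueIncl E F n) S ρ →
        IsModularTateH0 l (glFrob n σ) (glIncl E F n) (lift ϖ S) (lift (unitIncl E F ϖ) ρ) ∧
        ∀ (W' : Type (max u v w)) [AddCommGroup W'] [Module (FlBar l) W']
          (S' : Representation (FlBar l) (GL (Fin n) E) W'),
          IsModularTateH0 l (glFrob n σ) (glIncl E F n) S' (lift (unitIncl E F ϖ) ρ) →
          Nonempty (S'.Equiv (lift ϖ S))) := by
  have hp : p.Prime := Fact.out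
  have hl : l.Prime := Fact.out
  have : CharP 𝓀[F] p := charP_residueField E F
  refine ⟨fun V _ _ π hπ hcusp => ⟨?_, fun W _ _ S hS => ⟨hS.lift hlp hϖ hn hcusp.cuspSum,
    fun W' _ _ S' hS' => hS.equiv_lift hlp hϖ hn hcusp.cuspSum hS'⟩⟩,
    fun V _ _ α => nonempty_lift_frobTwist_equiv α, fun V _ _ ρ hρ hcusp ⟨e⟩ => ?_⟩
  · have := finiteDimensional_of_isIrreducible π
    obtain ⟨L, hL⟩ := exists_isLattice π
    have := hL.finite
    obtain ⟨W, i1, i2, S, hS⟩ := exists_isSemisimplification (modL l L.toRepresentation)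
    exact ⟨W, i1, i2, S, L, hL, hS⟩
  have hc := hcusp.cuspSum
  obtain ⟨T, hT⟩ := exists_isTwistOperator hl.pos (hσ.glResidueFrob_iterate hl hFE) e
  refine ⟨⟨T, hT⟩, fun T hT => ⟨exists_isTateH0 glResidueFrob_glResidueIncl hT, ?_⟩,
    exists_isModularTateH0 hT, fun W _ _ S hS => ⟨hS.lift hlp hn hFE hσ hϖ hc,
      fun W' _ _ S' hS' => hS.equiv_lift hlp hn hFE hσ hϖ hc hS'⟩⟩
  obtain ⟨T', hT'f, hT', hev, hsec⟩ := hσ.exists_twist_lift hFE hϖ hn hT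
  exact ⟨T', hT'f, hT', fun W _ _ S hS => ⟨hS.lift hlp hn hFE hσ hϖ _ hc hT hT' hev hsec,
    fun W' _ _ S' hS' => hS.equiv_lift hlp hn hFE hσ hϖ _
      (liftIndData_hasAvg _ hn (isUnit_natCast_PadicAlgCl l hp) hc) hc hT hT' hev hsec hS'⟩⟩
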